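/- Let $r\in\mathbb N$, $p\in[1,\infty)$, and let $\mathcal M_n$ be the algebra of complex $n\times n$ matrices with the operator norm on $\mathbb C^n$. A function $h\in L_1((-1,1),\mathcal M_r)$ is called an *accelerant* if for each $\alpha\in(0,1]$ the equation $$f(x)+\int_0^\alpha h(x-t)f(t)\,dt=0,\qquad x\in(0,1),$$ has only the zero solution in $L_2((0,1),\mathbb C^r)$. Let $\mathfrak H_{p,r}$ be the set of accelerants belonging to $L_p((-1,1),\mathcal M_r)$, with the metric of $L_p$. Let $G_{p,r}$ be the set of all measurable $K:[0,1]^2\to\mathcal M_r$ such that $K(x,\cdot),K(\cdot,t)\in L_p((0,1),\mathcal M_r)$ for all $x,t\in[0,1]$ and the maps $x\mapsto K(x,\cdot)$, $t\mapsto K(\cdot,t)$ from $[0,1]$ to $L_p((0,1),\mathcal M_r)$ are continuous; two such functions are identified if $\max\{\max_x\|K(x,\cdot)\|_{L_p},\max_t\|K(\cdot,t)\|_{L_p}\}$ vanishes for their difference. Let $G^+_{p,r}$ be the set of those $K\in G_{p,r}$ that vanish a.e. on $\{0<x<t<1\}$. Put $h^\sharp(x):=h(-x)$, $J:=\frac1{i}\begin{pmatrix}I&0\\0&-I\end{pmatrix}$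 and $$\mathfrak Q_p:=\{Q\in L_p((0,1),\mathcal M_{2r})\mid Q(x)J=-JQ(x)\ \text{a.e. on }(0,1)\},$$ with the metric of $L_p$. Then for every $h\in\mathfrak H_{p,r}$ each of the Krein equations $$R(x,t)+g(x-t)+\int_0^x R(x,s)\,g(s-t)\,ds=0\quad\text{for a.e. }(x,t)\text{ with }0<t<x<1,\qquad g\in\{h,h^\sharp\},$$ has a unique solution $R=r_g$ in $G^+_{p,r}$, and the Krein mapping $\Theta:\mathfrak H_{p,r}\to\mathfrak Q_p$, $$[\Theta(h)](x):=\begin{pmatrix}0&i\,r_h(x,0)\\-i\,r_{h^\sharp}(x,0)&0\end{pmatrix},\qquad x\in(0,1),$$ is locally Lipschitz: for each $h_0\in\mathfrak H_{p,r}$ there are a neighbourhood $\mathcal U$ of $h_0$ in $L_p((-1,1),\mathcal M_r)$ with $\mathcal U\subset\mathfrak H_{p,r}$ and a constant $c>0$ such that $\|\Theta(h_1)-\Theta(h_2)\|_{L_p}\le c\,\|h_1-h_2\|_{L_p}$ for all $h_1,h_2\in\mathcal U$. -/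

import Mathlib

open MeasureTheory Set Filter Topology
open scoped ENNReal Matrix.Norms.L2Operator

noncomputable section

namespace Krein

/-- The algebra of complex `n × n` matrices. Its norm is the operator norm on the Euclidean
space `ℂⁿ` (the scope `Matrix.Norms.L2Operator` is open). -/
abbrev Mat (n : Type*) := Matrix n n ℂ

/-- The functions `h ∈ L_p((-1,1), M_r)`. -/
abbrev LpSym (p : ℝ≥0∞) (r : ℕ) :=
  Lp (Mat (Fin r)) p (volume.restrict (Ioo (-1 : ℝ) 1))

/-- The functions `Q ∈ L_p((0,1), M_{2r})`; the `2r` coordinates are indexed by two copies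
of `Fin r`. -/
abbrev LpPot (p : ℝ≥0∞) (r : ℕ) :=
  Lp (Mat (Fin r ⊕ Fin r)) p (volume.restrict (Ioo (0 : ℝ) 1))

/-- `h` is an accelerant: `h ∈ L_1((-1,1), M_r)`, and for every `α ∈ (0,1]` the equation
`f(x) + ∫_0^α h(x-t) f(t) dt = 0`, `x ∈ (0,1)`, has only the zero solution in
`L_2((0,1), ℂ^r)`. -/
def IsAccelerant {r : ℕ} (h : ℝ → Mat (Fin r)) : Prop :=
  MemLp h 1 (volume.restrict (Ioo (-1 : ℝ) 1)) ∧
  ∀ α ∈ Ioc (0 : ℝ) 1,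
    ∀ f : Lp (EuclideanSpace ℂ (Fin r)) 2 (volume.restrict (Ioo (0 : ℝ) 1)),
      (∀ᵐ x ∂volume.restrict (Ioo (0 : ℝ) 1),
        f x + ∫ t in Ioo (0 : ℝ) α, Matrix.toEuclideanLin (h (x - t)) (f t) = 0) →
      f = 0

/-- The set of accelerants in `L_p((-1,1), M_r)`, with the metric of `L_p`. -/
def accelerants (p : ℝ≥0∞) (r : ℕ) : Set (LpSym p r) :=
  {h | IsAccelerant (h : ℝ → Mat (Fin r))}

/-- The reflected function `h^♯(x) = h(-x)`. -/
def sharp {r : ℕ} (h : ℝ → Mat (Fin r)) : ℝ → Mat (Fin r) := fun x => h (-x)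

/-- `K ∈ G_{p,r}`: `K` is (Lebesgue) measurable on `[0,1]²`, all its slices `K(x,·)` and `K(·,t)`
with `x, t ∈ [0,1]` belong to `L_p(0,1)`, and they depend continuously, in `L_p(0,1)`, on
`x ∈ [0,1]` and on `t ∈ [0,1]`. Only the values of `K` on `[0,1]²` matter. -/
structure MemG (p : ℝ≥0∞) {r : ℕ} (K : ℝ → ℝ → Mat (Fin r)) : Prop where
  aestronglyMeasurable : AEStronglyMeasurable (fun z : ℝ × ℝ => K z.1 z.2)
    (volume.restrict (Icc (0 : ℝ) 1 ×ˢ Icc (0 : ℝ) 1))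
  memLp_left : ∀ x ∈ Icc (0 : ℝ) 1,
    MemLp (fun t => K x t) p (volume.restrict (Ioo (0 : ℝ) 1))
  memLp_right : ∀ t ∈ Icc (0 : ℝ) 1,
    MemLp (fun x => K x t) p (volume.restrict (Ioo (0 : ℝ) 1))
  continuous_left : ∀ x₀ ∈ Icc (0 : ℝ) 1,
    Tendsto (fun x => eLpNorm (fun t => K x t - K x₀ t) p (volume.restrict (Ioo (0 : ℝ) 1)))
      (𝓝[Icc (0 : ℝ) 1] x₀) (𝓝 0)
  continuous_right : ∀ t₀ ∈ Icc (0 : ℝ) 1,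
    Tendsto (fun t => eLpNorm (fun x => K x t - K x t₀) p (volume.restrict (Ioo (0 : ℝ) 1)))
      (𝓝[Icc (0 : ℝ) 1] t₀) (𝓝 0)

/-- The triangle `Ω₊ = {(x,t) | 0 < t < x < 1}`. -/
def OmegaPlus : Set (ℝ × ℝ) := {z | 0 < z.2 ∧ z.2 < z.1 ∧ z.1 < 1}

/-- The triangle `Ω₋ = {(x,t) | 0 < x < t < 1}`. -/
def OmegaMinus : Set (ℝ × ℝ) := {z | 0 < z.1 ∧ z.1 < z.2 ∧ z.2 < 1}

/-- `K ∈ G⁺_{p,r}`: `K ∈ G_{p,r}` and `K = 0` a.e. on `Ω₋`. -/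
structure MemGPlus (p : ℝ≥0∞) {r : ℕ} (K : ℝ → ℝ → Mat (Fin r)) : Prop extends MemG p K where
  eq_zero : ∀ᵐ z ∂(volume : Measure (ℝ × ℝ)).restrict OmegaMinus, K z.1 z.2 = 0

/-- Equality of elements of `G_{p,r}`: the norm
`max (max_x ‖K(x,·)‖_{L_p}) (max_t ‖K(·,t)‖_{L_p})` of the difference vanishes. -/
def GEq {r : ℕ} (K L : ℝ → ℝ → Mat (Fin r)) : Prop :=
  (∀ x ∈ Icc (0 : ℝ) 1, ∀ᵐ t ∂volume.restrict (Ioo (0 : ℝ) 1), K x t = L x t) ∧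
  (∀ t ∈ Icc (0 : ℝ) 1, ∀ᵐ x ∂volume.restrict (Ioo (0 : ℝ) 1), K x t = L x t)

/-- `R ∈ G⁺_{p,r}` is a solution of the Krein equation
`R(x,t) + h(x-t) + ∫_0^x R(x,s) h(s-t) ds = 0` on `Ω₊`. -/
structure IsKreinSolution (p : ℝ≥0∞) {r : ℕ} (h : ℝ → Mat (Fin r))
    (R : ℝ → ℝ → Mat (Fin r)) : Prop where
  memGPlus : MemGPlus p R
  equation : ∀ᵐ z ∂(volume : Measure (ℝ × ℝ)).restrict OmegaPlus,
    R z.1 z.2 + h (z.1 - z.2) + ∫ s in Ioo (0 : ℝ) z.1, R z.1 s * h (s - z.2) = 0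

/-- The Krein equation for `h` has exactly one solution in `G⁺_{p,r}`. -/
def HasUniqueKreinSolution (p : ℝ≥0∞) {r : ℕ} (h : ℝ → Mat (Fin r)) : Prop :=
  (∃ R, IsKreinSolution p h R) ∧
  ∀ R₁ R₂, IsKreinSolution p h R₁ → IsKreinSolution p h R₂ → GEq R₁ R₂

open Classical in
/-- The solution `r_h ∈ G⁺_{p,r}` of the Krein equation (`0` if there is no solution). -/
def kreinKernel (p : ℝ≥0∞) {r : ℕ} (h : ℝ → Mat (Fin r)) : ℝ → ℝ → Mat (Fin r) :=
  if H : ∃ R, IsKreinSolution p h R then H.choose else 0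

/-- The `2r × 2r` matrix `J = (1/i) diag(I, -I)`. -/
def J (r : ℕ) : Mat (Fin r ⊕ Fin r) :=
  (1 / Complex.I) • Matrix.fromBlocks 1 0 0 (-1)

/-- The class `𝔔_p` of all `Q ∈ L_p((0,1), M_{2r})` with `Q(x) J = -J Q(x)` a.e. on `(0,1)`. -/
def potentials (p : ℝ≥0∞) (r : ℕ) : Set (LpPot p r) :=
  {Q | ∀ᵐ x ∂volume.restrict (Ioo (0 : ℝ) 1), Q x * J r = -(J r * Q x)}

/-- The matrix-valued function with off-diagonal blocks `i r_h(x,0)` and `-i r_{h^♯}(x,0)`. -/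
def kreinPotential (p : ℝ≥0∞) {r : ℕ} (h : ℝ → Mat (Fin r)) (x : ℝ) : Mat (Fin r ⊕ Fin r) :=
  Matrix.fromBlocks 0 (Complex.I • kreinKernel p h x 0)
    (-(Complex.I • kreinKernel p (sharp h) x 0)) 0

theorem memLp_kreinKernel (p : ℝ≥0∞) {r : ℕ} (h : ℝ → Mat (Fin r)) :
    MemLp (fun x => kreinKernel p h x 0) p (volume.restrict (Ioo (0 : ℝ) 1)) := by
  by_cases H : ∃ R, IsKreinSolution p h R
  · simp only [kreinKernel, dif_pos H]
    exact H.choose_spec.memGPlus.memLp_right 0 ⟨le_rfl, zero_le_one⟩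
  · simp only [kreinKernel, dif_neg H]
    exact MemLp.zero

theorem memLp_kreinPotential (p : ℝ≥0∞) {r : ℕ} (h : ℝ → Mat (Fin r)) :
    MemLp (kreinPotential p h) p (volume.restrict (Ioo (0 : ℝ) 1)) := by
  let T₁ : Mat (Fin r) →ₗ[ℂ] Mat (Fin r ⊕ Fin r) :=
    { toFun := fun A => Matrix.fromBlocks 0 (Complex.I • A) 0 0
      map_add' := fun A B => by simp [Matrix.fromBlocks_add]
      map_smul' := fun c A => by simp [Matrix.fromBlocks_smul, smul_comm c] }
  let T₂ : Mat (Fin r) →ₗ[ℂ] Mat (Fin r ⊕ Fin r) :=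
    { toFun := fun A => Matrix.fromBlocks 0 0 (-(Complex.I • A)) 0
      map_add' := fun A B => by simp [Matrix.fromBlocks_add, add_comm]
      map_smul' := fun c A => by simp [Matrix.fromBlocks_smul, smul_comm c] }
  have h₁ := T₁.toContinuousLinearMap.comp_memLp' (memLp_kreinKernel p h)
  have h₂ := T₂.toContinuousLinearMap.comp_memLp' (memLp_kreinKernel p (sharp h))
  refine (memLp_congr_ae (Eventually.of_forall fun x => ?_)).1 (h₁.add h₂)
  simp [T₁, T₂, kreinPotential, Matrix.fromBlocks_add]

theorem kreinPotential_mul_J (p : ℝ≥0∞) {r : ℕ} (h : ℝ → Mat (Fin r)) (x : ℝ) :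
    kreinPotential p h x * J r = -(J r * kreinPotential p h x) := by
  simp [kreinPotential, J, Matrix.fromBlocks_multiply, Matrix.fromBlocks_neg,
    Matrix.fromBlocks_smul]

/-- The Krein mapping `Θ : 𝔥_{p,r} → 𝔔_p`. -/
def kreinMap (p : ℝ≥0∞) (r : ℕ) (h : accelerants p r) : potentials p r :=
  ⟨(memLp_kreinPotential p (h : LpSym p r)).toLp _, by
    filter_upwards [(memLp_kreinPotential p (h : LpSym p r)).coeFn_toLp] with x hx
    rw [hx]
    exact kreinPotential_mul_J p _ x⟩

/-- A map `φ` from a set `O` in a metric space `X` to a metric space is locally Lipschitz (on the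
open set `O`): every point of `O` has a neighbourhood in `X` that is contained in `O` and on which
`φ` is Lipschitz. -/
def LocallyLipschitzMap {X Y : Type*} [PseudoMetricSpace X] [PseudoMetricSpace Y] {O : Set X}
    (φ : O → Y) : Prop :=
  ∀ x₀ : O, ∃ U ∈ 𝓝 (x₀ : X), U ⊆ O ∧ ∃ c : ℝ, 0 < c ∧
    ∀ x₁ x₂ : O, (x₁ : X) ∈ U → (x₂ : X) ∈ U → dist (φ x₁) (φ x₂) ≤ c * dist x₁ x₂

end Krein

end

noncomputable section

namespace Krein

/-! ### Integral inequalities for nonnegative kernels -/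

section Kernels

variable {X Y : Type*} [MeasurableSpace X] [MeasurableSpace Y] {μ : Measure X} {ν : Measure Y}

/-! For fixed x the Krein equation involves only the row φ = R(x,·). Extended by zero beyond x, it
reads (1 + P_x T)φ = −P_x h(x−·), where Tφ(t) = ∫ φ(s) h(s−t) ds on L_1(0,1) and P_x is
multiplication by the indicator of (−∞,x). The operator T is compact, being a norm limit of finite
rank convolutions with polynomial kernels, and P_x is strongly continuous in x, so x ↦ P_x T is norm
continuous. Once all 1 + P_x T are injective, their inverses are therefore bounded uniformly in x ∈
[0,1] and locally uniformly in h for the L_1 distance (`exists_row_bound`).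

Injectivity comes by duality (`IsAccelerant.row_injective`). For an accelerant the column operators
on L_2 are injective, hence invertible by the Fredholm alternative. A row solution in L_1 is
automatically bounded, so it can be paired with L_2 solutions of column equations, and the pairing
annihilates it. A reflection about a/2 shows that h^♯ is an accelerant together with h.

All inversion takes place in L_1, whatever p is. The Krein mapping, however, sees the single column
R(·,0), which bounds on rows do not control. To reach it, split h = g + d with g bounded and ‖d‖_1 ≤
1/2. In the equation for the difference D of two solutions, the action of g on D(x,·) is controlled
by the L_1 norm of that row, while d gives a kernel with marginals at most 1/2, which is absorbed
after taking p-th powers and integrating in x (`ae_lintegral_column_rpow_le`,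
`IsRowSolution.column_sub_le`). This bounds almost every column of D by ‖h₁ − h₂‖_p, and continuity
of t ↦ R(·,t) in L_p carries the bound to t = 0.

Uniqueness is the row bound with h₁ = h₂. For existence, the rows −(1 + P_x T)⁻¹ P_x h(x−·) are
continuous in x with values in L_1 and have a jointly measurable representative Φ. The kernel
−(h(x−t) + ∫ Φ(x,s) h(s−t) ds), cut off to t < x, lies in G⁺: its rows by Young's inequality, its
columns by the Schur test for Φ, whose column bound is again the estimate above, now for the
comparison with zero. -/

theorem ae_aemeasurable_left [SFinite ν] {κ : X → Y → ℝ≥0∞}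
    (hκ : AEMeasurable (fun z : X × Y => κ z.1 z.2) (μ.prod ν)) :
    ∀ᵐ x ∂μ, AEMeasurable (fun y => κ x y) ν := by
  filter_upwards [hκ.aestronglyMeasurable.prodMk_left] with x hx using hx.aemeasurable

theorem ae_aemeasurable_right [SFinite μ] [SFinite ν] {κ : X → Y → ℝ≥0∞}
    (hκ : AEMeasurable (fun z : X × Y => κ z.1 z.2) (μ.prod ν)) :
    ∀ᵐ y ∂ν, AEMeasurable (fun x => κ x y) μ := by
  filter_upwards [hκ.aestronglyMeasurable.prodMk_right] with x hx using hx.aemeasurable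

/-- Jensen's inequality for the weight `w`. -/
theorem rpow_lintegral_mul_le {w f : Y → ℝ≥0∞} (hw : AEMeasurable w ν) (hf : AEMeasurable f ν)
    {q : ℝ} (hq : 1 ≤ q) :
    (∫⁻ y, w y * f y ∂ν) ^ q ≤ (∫⁻ y, w y ∂ν) ^ (q - 1) * ∫⁻ y, w y * f y ^ q ∂ν := by
  have hq0 : 0 < q := by linarith
  have h1 : (0 : ℝ) ≤ 1 - 1 / q := by
    rw [sub_nonneg, div_le_one hq0]; exact hq
  have h2 : (0 : ℝ) ≤ 1 / q := by positivity
  -- Hölder with exponents 1 − 1/q and 1/q for the functions w and w f^q, whose weighted product is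
  -- w f.
  have key := ENNReal.lintegral_mul_norm_pow_le hw (hw.mul (hf.pow_const q)) h1 h2 (by ring)
  have e : ∀ y, w y ^ (1 - 1 / q) * (w y * f y ^ q) ^ (1 / q) = w y * f y := fun y => by
    rw [ENNReal.mul_rpow_of_nonneg _ _ h2, ← ENNReal.rpow_mul, mul_one_div_cancel hq0.ne',
      ENNReal.rpow_one, ← mul_assoc, ← ENNReal.rpow_add_of_nonneg _ _ h1 h2, sub_add_cancel,
      ENNReal.rpow_one]
  simp only [Pi.mul_apply, e] at key
  calc (∫⁻ y, w y * f y ∂ν) ^ q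
      ≤ ((∫⁻ y, w y ∂ν) ^ (1 - 1 / q) * (∫⁻ y, w y * f y ^ q ∂ν) ^ (1 / q)) ^ q := by
        gcongr
    _ = _ := by
        rw [ENNReal.mul_rpow_of_nonneg _ _ hq0.le, ← ENNReal.rpow_mul, ← ENNReal.rpow_mul,
          one_div_mul_cancel hq0.ne', ENNReal.rpow_one]
        congr 2
        field_simp

/-- The Schur test. -/
theorem lintegral_rpow_lintegral_mul_le [SFinite μ] [SFinite ν] {κ : X → Y → ℝ≥0∞}
    (hκ : AEMeasurable (fun z : X × Y => κ z.1 z.2) (μ.prod ν)) {f : Y → ℝ≥0∞}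
    (hf : AEMeasurable f ν) {q : ℝ} (hq : 1 ≤ q) {A B : ℝ≥0∞}
    (hA : ∀ᵐ x ∂μ, ∫⁻ y, κ x y ∂ν ≤ A) (hB : ∀ᵐ y ∂ν, ∫⁻ x, κ x y ∂μ ≤ B) :
    ∫⁻ x, (∫⁻ y, κ x y * f y ∂ν) ^ q ∂μ ≤ A ^ (q - 1) * B * ∫⁻ y, f y ^ q ∂ν := by
  have hfq : AEMeasurable (fun z : X × Y => κ z.1 z.2 * f z.2 ^ q) (μ.prod ν) :=
    hκ.mul ((hf.pow_const q).comp_snd)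
  calc ∫⁻ x, (∫⁻ y, κ x y * f y ∂ν) ^ q ∂μ
      ≤ ∫⁻ x, A ^ (q - 1) * ∫⁻ y, κ x y * f y ^ q ∂ν ∂μ := by
        refine lintegral_mono_ae ?_
        filter_upwards [hA, ae_aemeasurable_left hκ] with x hx hm
        refine (rpow_lintegral_mul_le hm hf hq).trans ?_
        gcongr
    _ = A ^ (q - 1) * ∫⁻ y, ∫⁻ x, κ x y * f y ^ q ∂μ ∂ν := by
        rw [lintegral_const_mul'' _ hfq.lintegral_prod_right', lintegral_lintegral_swap hfq]
    _ ≤ A ^ (q - 1) * ∫⁻ y, B * f y ^ q ∂ν := by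
        refine mul_le_mul_right ?_ _
        refine lintegral_mono_ae ?_
        filter_upwards [hB, ae_aemeasurable_right hκ] with y hy hm
        rw [lintegral_mul_const'' _ hm]
        gcongr
    _ = _ := by
        rw [lintegral_const_mul'' _ (hf.pow_const q), mul_assoc]

/-- An integrable function that is bounded by a constant plus its image under a kernel with small
marginals is bounded. -/
theorem ae_le_two_mul_of_le_add_lintegral [SFinite μ] {κ : X → X → ℝ≥0∞}
    (hκ : AEMeasurable (fun z : X × X => κ z.1 z.2) (μ.prod μ)) {ρ : X → ℝ≥0∞}
    (hρ : AEMeasurable ρ μ) (hfin : ∫⁻ x, ρ x ∂μ ≠ ∞) {C : ℝ≥0∞}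
    (h₁ : ∀ᵐ s ∂μ, ∫⁻ t, κ s t ∂μ ≤ 2⁻¹) (h₂ : ∀ᵐ t ∂μ, ∫⁻ s, κ s t ∂μ ≤ 2⁻¹)
    (h : ∀ᵐ t ∂μ, ρ t ≤ C + ∫⁻ s, ρ s * κ s t ∂μ) : ∀ᵐ t ∂μ, ρ t ≤ 2 * C := by
  -- The excess of ρ over 2C. Since C + 2C · ½ = 2C, the bound `h₂` gives σ ≤ ∫ σκ; integrating and
  -- using `h₁` gives ∫σ ≤ ½∫σ, and ∫σ is finite, so it vanishes.
  set σ : X → ℝ≥0∞ := fun t => ρ t - 2 * C with hσ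
  have hσm : AEMeasurable σ μ := hρ.sub_const _
  have hprod : AEMeasurable (fun z : X × X => σ z.1 * κ z.1 z.2) (μ.prod μ) :=
    hσm.comp_fst.mul hκ
  have hσle : ∀ᵐ t ∂μ, σ t ≤ ∫⁻ s, σ s * κ s t ∂μ := by
    filter_upwards [h, h₂, ae_aemeasurable_right hκ] with t ht h2 hm
    rw [hσ]
    refine tsub_le_iff_left.2 (ht.trans ?_)
    calc C + ∫⁻ s, ρ s * κ s t ∂μ ≤ C + ∫⁻ s, (2 * C * κ s t + σ s * κ s t) ∂μ := by
          gcongr with s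
          rw [← add_mul]
          gcongr
          exact le_add_tsub
      _ = C + (2 * C * ∫⁻ s, κ s t ∂μ + ∫⁻ s, σ s * κ s t ∂μ) := by
          rw [lintegral_add_left' (hm.const_mul _), lintegral_const_mul'' _ hm]
      _ ≤ C + (2 * C * 2⁻¹ + ∫⁻ s, σ s * κ s t ∂μ) := by gcongr
      _ = 2 * C + ∫⁻ s, σ s * κ s t ∂μ := by
          rw [mul_right_comm, ENNReal.mul_inv_cancel two_ne_zero ENNReal.ofNat_ne_top, one_mul,
            ← add_assoc, two_mul]
  have hint : ∫⁻ t, σ t ∂μ ≤ 2⁻¹ * ∫⁻ t, σ t ∂μ := by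
    calc ∫⁻ t, σ t ∂μ ≤ ∫⁻ t, ∫⁻ s, σ s * κ s t ∂μ ∂μ := lintegral_mono_ae hσle
      _ = ∫⁻ s, ∫⁻ t, σ s * κ s t ∂μ ∂μ := (lintegral_lintegral_swap hprod).symm
      _ ≤ ∫⁻ s, σ s * 2⁻¹ ∂μ := by
          refine lintegral_mono_ae ?_
          filter_upwards [h₁, ae_aemeasurable_left hκ] with s hs hm
          rw [lintegral_const_mul'' _ hm]
          gcongr
      _ = _ := by rw [lintegral_mul_const'' _ hσm, mul_comm]
  have hσfin : ∫⁻ t, σ t ∂μ ≠ ∞ :=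
    ne_top_of_le_ne_top hfin (lintegral_mono fun t => tsub_le_self)
  have hzero : ∫⁻ t, σ t ∂μ = 0 := by
    by_contra h0
    have : 2⁻¹ * ∫⁻ t, σ t ∂μ < ∫⁻ t, σ t ∂μ := by
      rw [mul_comm, ← div_eq_mul_inv]
      exact ENNReal.half_lt_self h0 hσfin
    exact absurd hint (not_le.2 this)
  filter_upwards [(lintegral_eq_zero_iff' hσm).1 hzero] with t ht
  exact tsub_eq_zero_iff_le.1 ht

end Kernels

/-! ### Integral operators with operator-valued kernels -/

theorem eLpNorm_rpow_toReal {X F : Type*} [MeasurableSpace X] {μ : Measure X}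
    [NormedAddCommGroup F] {p : ℝ≥0∞} (h0 : p ≠ 0) (hp : p ≠ ∞) (f : X → F) :
    eLpNorm f p μ ^ p.toReal = ∫⁻ x, ‖f x‖ₑ ^ p.toReal ∂μ := by
  have hpos := ENNReal.toReal_pos h0 hp
  rw [eLpNorm_eq_lintegral_rpow_enorm_toReal h0 hp, ← ENNReal.rpow_mul,
    one_div_mul_cancel hpos.ne', ENNReal.rpow_one]

theorem one_le_toReal {p : ℝ≥0∞} (h1 : 1 ≤ p) (hp : p ≠ ∞) : 1 ≤ p.toReal := by
  rwa [← ENNReal.ofReal_le_iff_le_toReal hp, ENNReal.ofReal_one]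

section Operators

variable {X E : Type*} [MeasurableSpace X] {μ : Measure X} [SFinite μ] [NormedAddCommGroup E]
  [NormedSpace ℂ E] {p : ℝ≥0∞}

/-- Measurability of `κ` together with the bounds of the Schur test. -/
structure IsSchurKernel (μ : Measure X) (κ : X → X → E →L[ℂ] E) (C : ℝ≥0∞) : Prop where
  aestronglyMeasurable : AEStronglyMeasurable (fun z : X × X => κ z.1 z.2) (μ.prod μ)
  left : ∀ᵐ x ∂μ, ∫⁻ y, ‖κ x y‖ₑ ∂μ ≤ C
  right : ∀ᵐ y ∂μ, ∫⁻ x, ‖κ x y‖ₑ ∂μ ≤ C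

namespace IsSchurKernel

variable {κ : X → X → E →L[ℂ] E} {C : ℝ≥0∞}

omit [SFinite μ] in
theorem aestronglyMeasurable_apply (hκ : IsSchurKernel μ κ C) {f : X → E}
    (hf : AEStronglyMeasurable f μ) :
    AEStronglyMeasurable (fun z : X × X => κ z.1 z.2 (f z.2)) (μ.prod μ) :=
  isBoundedBilinearMap_apply.continuous.comp_aestronglyMeasurable
    (hκ.aestronglyMeasurable.prodMk hf.comp_snd)

theorem lintegral_rpow_le (hκ : IsSchurKernel μ κ C) {f : X → E} (hf : AEStronglyMeasurable f μ)
    (h1 : 1 ≤ p) (hp : p ≠ ∞) :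
    ∫⁻ x, (∫⁻ y, ‖κ x y‖ₑ * ‖f y‖ₑ ∂μ) ^ p.toReal ∂μ ≤ (C * eLpNorm f p μ) ^ p.toReal := by
  have hq := one_le_toReal h1 hp
  refine (lintegral_rpow_lintegral_mul_le hκ.aestronglyMeasurable.enorm hf.enorm hq
    hκ.left hκ.right).trans_eq ?_
  rw [ENNReal.mul_rpow_of_nonneg _ _ (by linarith), eLpNorm_rpow_toReal (by positivity) hp]
  congr 1
  calc C ^ (p.toReal - 1) * C = C ^ (p.toReal - 1) * C ^ (1 : ℝ) := by rw [ENNReal.rpow_one]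
    _ = _ := by
      rw [← ENNReal.rpow_add_of_nonneg _ _ (by linarith) zero_le_one, sub_add_cancel]

theorem ae_integrable (hκ : IsSchurKernel μ κ C) (hC : C ≠ ∞) {f : X → E} (h1 : 1 ≤ p)
    (hp : p ≠ ∞) (hf : MemLp f p μ) : ∀ᵐ x ∂μ, Integrable (fun y => κ x y (f y)) μ := by
  have hq := one_le_toReal h1 hp
  have hm := hκ.aestronglyMeasurable_apply hf.1
  have hfin : ∀ᵐ x ∂μ, (∫⁻ y, ‖κ x y‖ₑ * ‖f y‖ₑ ∂μ) ^ p.toReal < ∞ := by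
    refine ae_lt_top' ?_ (ne_top_of_le_ne_top ?_ (hκ.lintegral_rpow_le hf.1 h1 hp))
    · exact (AEMeasurable.lintegral_prod_right'
        (hκ.aestronglyMeasurable.enorm.mul hf.1.enorm.comp_snd)).pow_const _
    · exact ENNReal.rpow_ne_top_of_nonneg (by linarith) (ENNReal.mul_ne_top hC hf.2.ne)
  filter_upwards [hfin, hm.prodMk_left] with x hx hmx
  refine ⟨hmx, ?_⟩
  exact lt_of_le_of_lt (lintegral_mono fun y => (κ x y).le_opENorm (f y))
    ((ENNReal.rpow_lt_top_iff_of_pos (by linarith)).1 hx)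

theorem eLpNorm_integral_le (hκ : IsSchurKernel μ κ C) {f : X → E}
    (hf : AEStronglyMeasurable f μ) (h1 : 1 ≤ p) (hp : p ≠ ∞) :
    eLpNorm (fun x => ∫ y, κ x y (f y) ∂μ) p μ ≤ C * eLpNorm f p μ := by
  have hq := one_le_toReal h1 hp
  rw [← ENNReal.rpow_le_rpow_iff (show 0 < p.toReal by linarith),
    eLpNorm_rpow_toReal (by positivity) hp]
  refine (lintegral_mono fun x => ?_).trans (hκ.lintegral_rpow_le hf h1 hp)
  gcongr
  refine (enorm_integral_le_lintegral_enorm _).trans (lintegral_mono fun y => ?_)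
  exact (κ x y).le_opENorm (f y)

theorem memLp_integral (hκ : IsSchurKernel μ κ C) (hC : C ≠ ∞) {f : X → E} (h1 : 1 ≤ p)
    (hp : p ≠ ∞) (hf : MemLp f p μ) : MemLp (fun x => ∫ y, κ x y (f y) ∂μ) p μ :=
  ⟨(hκ.aestronglyMeasurable_apply hf.1).integral_prod_right',
    (hκ.eLpNorm_integral_le hf.1 h1 hp).trans_lt
      (ENNReal.mul_lt_top hC.lt_top hf.2)⟩

end IsSchurKernel

variable [Fact (1 ≤ p)]

/-- The integral operator on `L_p` with the kernel `κ`. -/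
def kernelOp (hp : p ≠ ∞) {κ : X → X → E →L[ℂ] E} {C : ℝ≥0∞} (hκ : IsSchurKernel μ κ C)
    (hC : C ≠ ∞) : Lp E p μ →L[ℂ] Lp E p μ :=
  LinearMap.mkContinuous
    { toFun := fun f => (hκ.memLp_integral hC Fact.out hp (Lp.memLp f)).toLp _
      map_add' := fun f g => by
        rw [← MemLp.toLp_add]
        refine MemLp.toLp_congr _ _ ?_
        filter_upwards [hκ.ae_integrable hC Fact.out hp (Lp.memLp f),
          hκ.ae_integrable hC Fact.out hp (Lp.memLp g)] with x hf hg
        rw [Pi.add_apply, ← integral_add hf hg]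
        refine integral_congr_ae ?_
        filter_upwards [Lp.coeFn_add f g] with y hy
        rw [hy, Pi.add_apply, map_add]
      map_smul' := fun c f => by
        rw [RingHom.id_apply, ← MemLp.toLp_const_smul]
        refine MemLp.toLp_congr _ _ (Eventually.of_forall fun x => ?_)
        rw [Pi.smul_apply, ← integral_smul]
        refine integral_congr_ae ?_
        filter_upwards [Lp.coeFn_smul c f] with y hy
        rw [hy, Pi.smul_apply, map_smul] }
    C.toReal fun f => by
      change ‖(hκ.memLp_integral hC Fact.out hp (Lp.memLp f)).toLp _‖ ≤ _
      rw [Lp.norm_toLp, Lp.norm_def, ← ENNReal.toReal_mul]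
      exact ENNReal.toReal_mono (ENNReal.mul_ne_top hC (Lp.eLpNorm_ne_top f))
        (hκ.eLpNorm_integral_le (Lp.aestronglyMeasurable f) Fact.out hp)

theorem kernelOp_coeFn (hp : p ≠ ∞) {κ : X → X → E →L[ℂ] E} {C : ℝ≥0∞}
    (hκ : IsSchurKernel μ κ C) (hC : C ≠ ∞) (f : Lp E p μ) :
    kernelOp hp hκ hC f =ᵐ[μ] fun x => ∫ y, κ x y (f y) ∂μ :=
  MemLp.coeFn_toLp (hκ.memLp_integral hC Fact.out hp (Lp.memLp f))

theorem norm_kernelOp_le (hp : p ≠ ∞) {κ : X → X → E →L[ℂ] E} {C : ℝ≥0∞}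
    (hκ : IsSchurKernel μ κ C) (hC : C ≠ ∞) : ‖kernelOp hp hκ hC‖ ≤ C.toReal :=
  LinearMap.mkContinuous_norm_le _ ENNReal.toReal_nonneg _

/-- The operator norm of the difference of two integral operators is controlled by the kernel. -/
theorem norm_kernelOp_sub_le (hp : p ≠ ∞) {κ₁ κ₂ : X → X → E →L[ℂ] E} {C₁ C₂ C : ℝ≥0∞}
    (hκ₁ : IsSchurKernel μ κ₁ C₁) (hC₁ : C₁ ≠ ∞) (hκ₂ : IsSchurKernel μ κ₂ C₂) (hC₂ : C₂ ≠ ∞)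
    (hκ : IsSchurKernel μ (fun x y => κ₁ x y - κ₂ x y) C) (hC : C ≠ ∞) :
    ‖kernelOp hp hκ₁ hC₁ - kernelOp hp hκ₂ hC₂‖ ≤ C.toReal := by
  have : kernelOp hp hκ₁ hC₁ - kernelOp hp hκ₂ hC₂ = kernelOp hp hκ hC := by
    ext1 f
    refine Lp.ext ?_
    rw [sub_apply]
    filter_upwards [Lp.coeFn_sub (kernelOp hp hκ₁ hC₁ f) (kernelOp hp hκ₂ hC₂ f),
      kernelOp_coeFn hp hκ₁ hC₁ f, kernelOp_coeFn hp hκ₂ hC₂ f, kernelOp_coeFn hp hκ hC f,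
      hκ₁.ae_integrable hC₁ Fact.out hp (Lp.memLp f),
      hκ₂.ae_integrable hC₂ Fact.out hp (Lp.memLp f)] with x h h₁ h₂ h₃ i₁ i₂
    rw [h, Pi.sub_apply, h₁, h₂, h₃, ← integral_sub i₁ i₂]
    rfl
  rw [this]
  exact norm_kernelOp_le hp hκ hC

end Operators

/-! ### Compact perturbations of the identity -/

section Compact

variable {X : Type*} [NormedAddCommGroup X] [NormedSpace ℂ X]

/-- The Fredholm alternative at the point −1: it is either an eigenvalue of T, which `h` excludes,
or a point of the resolvent set. -/
theorem isUnit_one_add_of_isCompactOperator [CompleteSpace X] {T : X →L[ℂ] X}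
    (hT : IsCompactOperator T) (h : ∀ v, v + T v = 0 → v = 0) : IsUnit (1 + T) := by
  rcases hT.hasEigenvalue_or_mem_resolventSet
    (neg_ne_zero.2 (one_ne_zero (α := ℂ))) with h1 | h1
  · obtain ⟨v, hv⟩ := h1.exists_hasEigenvector
    refine absurd (h v ?_) hv.2
    have := hv.apply_eq_smul
    simp only [neg_smul, one_smul] at this
    rw [show T v = -v from this, add_neg_cancel]
  · rw [spectrum.mem_resolventSet_iff] at h1
    have := h1.neg
    simpa [add_comm] using this

/-- Strong convergence of a bounded family is uniform on totally bounded sets, and T maps the unit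
ball into such a set. A finite ε/4-net of the image reduces the claim to finitely many vectors. -/
theorem continuous_comp_of_isCompactOperator {A : Type*} [TopologicalSpace A] {P : A → X →L[ℂ] X}
    (hP : ∀ a, ‖P a‖ ≤ 1) (hPc : ∀ v, Continuous fun a => P a v) {T : X →L[ℂ] X}
    (hT : IsCompactOperator T) : Continuous fun a => P a ∘L T := by
  refine continuous_iff_continuousAt.2 fun a₀ => Metric.tendsto_nhds.2 fun ε hε => ?_
  have hK := (hT.isCompact_closure_image_closedBall 1).totallyBounded
  obtain ⟨s, hs, hcov⟩ := Metric.totallyBounded_iff.1 hK (ε / 4) (by positivity)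
  have hev : ∀ᶠ a in 𝓝 a₀, ∀ y ∈ s, dist (P a y) (P a₀ y) < ε / 4 :=
    (hs.eventually_all).2 fun y _ =>
      Metric.tendsto_nhds.1 ((hPc y).continuousAt (x := a₀)) (ε / 4) (by positivity)
  filter_upwards [hev] with a ha
  rw [dist_eq_norm]
  refine lt_of_le_of_lt (b := 3 * (ε / 4)) ?_ (by linarith)
  let : NormedSpace ℝ X := NormedSpace.complexToReal
  refine ContinuousLinearMap.opNorm_le_of_unit_norm (by positivity) fun v hv => ?_
  obtain ⟨y, hy, hyv⟩ := mem_iUnion₂.1 (hcov (subset_closure ⟨v, by simp [hv], rfl⟩))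
  have e : (P a ∘L T - P a₀ ∘L T) v = P a (T v - y) + (P a y - P a₀ y) - P a₀ (T v - y) := by
    simp
  have hb : ∀ b, ‖P b (T v - y)‖ ≤ ε / 4 := fun b =>
    ((P b).le_of_opNorm_le (hP b) _).trans (by
      rw [one_mul, ← dist_eq_norm]; exact (Metric.mem_ball.1 hyv).le)
  rw [e]
  calc _ ≤ ‖P a (T v - y)‖ + ‖P a y - P a₀ y‖ + ‖P a₀ (T v - y)‖ :=
        (norm_sub_le _ _).trans (by gcongr; exact norm_add_le _ _)
    _ ≤ ε / 4 + ε / 4 + ε / 4 := by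
        gcongr
        · exact hb a
        · rw [← dist_eq_norm]; exact (ha y hy).le
        · exact hb a₀
    _ = 3 * (ε / 4) := by ring

theorem isCompactOperator_of_forall_mem {T : X →L[ℂ] X} (W : Submodule ℂ X)
    [FiniteDimensional ℂ W] (h : ∀ v, T v ∈ W) : IsCompactOperator T := by
  have : ProperSpace W := FiniteDimensional.proper ℂ W
  exact (isCompactOperator_of_locallyCompactSpace_dom (T.codRestrict W h)).clm_comp W.subtypeL

end Compact

/-! ### Convolution operators on `L_p(0,1)` and their compressions -/

/-- Lebesgue measure on `(0,1)`. -/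
abbrev unitVol : Measure ℝ := volume.restrict (Ioo (0 : ℝ) 1)

/-- Lebesgue measure on `(-1,1)`. -/
abbrev symVol : Measure ℝ := volume.restrict (Ioo (-1 : ℝ) 1)

/-- This makes h(x − y) a well-defined, a.e. measurable kernel on the square when h is only given
almost everywhere on (−1,1). -/
theorem quasiMeasurePreserving_sub_unitVol :
    Measure.QuasiMeasurePreserving (fun z : ℝ × ℝ => z.1 - z.2) (unitVol.prod unitVol) symVol := by
  rw [Measure.prod_restrict]
  refine (quasiMeasurePreserving_sub volume volume).restrict ?_
  rintro ⟨x, y⟩ ⟨⟨h1, h2⟩, h3, h4⟩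
  simp only [mem_Ioo] at *
  constructor <;> linarith

theorem lintegral_sub_left_le (f : ℝ → ℝ≥0∞) {x : ℝ} (hx : x ∈ Icc (0 : ℝ) 1) :
    ∫⁻ y, f (x - y) ∂unitVol ≤ ∫⁻ u, f u ∂symVol := by
  rw [← lintegral_indicator measurableSet_Ioo, ← lintegral_indicator measurableSet_Ioo,
    ← lintegral_sub_left_eq_self ((Ioo (-1 : ℝ) 1).indicator f) x]
  refine lintegral_mono fun y => ?_
  by_cases hy : y ∈ Ioo (0 : ℝ) 1
  · rw [indicator_of_mem hy, indicator_of_mem]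
    constructor <;> [linarith [hx.1, hy.2]; linarith [hx.2, hy.1]]
  · rw [indicator_of_notMem hy]; positivity

theorem lintegral_sub_right_le (f : ℝ → ℝ≥0∞) {y : ℝ} (hy : y ∈ Icc (0 : ℝ) 1) :
    ∫⁻ x, f (x - y) ∂unitVol ≤ ∫⁻ u, f u ∂symVol := by
  rw [← lintegral_indicator measurableSet_Ioo, ← lintegral_indicator measurableSet_Ioo,
    ← lintegral_sub_right_eq_self ((Ioo (-1 : ℝ) 1).indicator f) y]
  refine lintegral_mono fun x => ?_
  by_cases hx : x ∈ Ioo (0 : ℝ) 1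
  · rw [indicator_of_mem hx, indicator_of_mem]
    constructor <;> [linarith [hx.1, hy.2]; linarith [hx.2, hy.1]]
  · rw [indicator_of_notMem hx]; positivity

theorem ae_unitVol_mem : ∀ᵐ x ∂unitVol, x ∈ Ioo (0 : ℝ) 1 := ae_restrict_mem measurableSet_Ioo

section Convolution

variable {E : Type*} [NormedAddCommGroup E] [NormedSpace ℂ E] {p : ℝ≥0∞}

theorem isSchurKernel_sub {k : ℝ → E →L[ℂ] E} (hk : Integrable k symVol) :
    IsSchurKernel unitVol (fun x y => k (x - y)) (∫⁻ u, ‖k u‖ₑ ∂symVol) where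
  aestronglyMeasurable := hk.1.comp_quasiMeasurePreserving quasiMeasurePreserving_sub_unitVol
  left := by
    filter_upwards [ae_unitVol_mem] with x hx
    exact lintegral_sub_left_le (fun u => ‖k u‖ₑ) (Ioo_subset_Icc_self hx)
  right := by
    filter_upwards [ae_unitVol_mem] with x hx
    exact lintegral_sub_right_le (fun u => ‖k u‖ₑ) (Ioo_subset_Icc_self hx)

variable [Fact (1 ≤ p)]

/-- The operator of convolution with `k` on `L_p(0,1)`. -/
def convOp (hp : p ≠ ∞) {k : ℝ → E →L[ℂ] E} (hk : Integrable k symVol) :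
    Lp E p unitVol →L[ℂ] Lp E p unitVol :=
  kernelOp hp (isSchurKernel_sub hk) hk.2.ne

theorem convOp_coeFn (hp : p ≠ ∞) {k : ℝ → E →L[ℂ] E} (hk : Integrable k symVol)
    (f : Lp E p unitVol) :
    convOp hp hk f =ᵐ[unitVol] fun x => ∫ y, k (x - y) (f y) ∂unitVol :=
  kernelOp_coeFn hp _ _ f

theorem norm_convOp_sub_le (hp : p ≠ ∞) {k₁ k₂ : ℝ → E →L[ℂ] E} (hk₁ : Integrable k₁ symVol)
    (hk₂ : Integrable k₂ symVol) :
    ‖convOp (p := p) hp hk₁ - convOp hp hk₂‖ ≤ (∫⁻ u, ‖k₁ u - k₂ u‖ₑ ∂symVol).toReal :=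
  norm_kernelOp_sub_le hp _ _ _ _ (isSchurKernel_sub (hk₁.sub hk₂)) (hk₁.sub hk₂).2.ne

theorem convOp_add (hp : p ≠ ∞) {k₁ k₂ : ℝ → E →L[ℂ] E} (hk₁ : Integrable k₁ symVol)
    (hk₂ : Integrable k₂ symVol) (hk : Integrable (fun u => k₁ u + k₂ u) symVol) :
    convOp (p := p) hp hk = convOp hp hk₁ + convOp hp hk₂ := by
  ext1 f
  refine Lp.ext ?_
  rw [add_apply]
  filter_upwards [Lp.coeFn_add (convOp hp hk₁ f) (convOp hp hk₂ f),
    convOp_coeFn hp hk₁ f, convOp_coeFn hp hk₂ f, convOp_coeFn hp hk f,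
    (isSchurKernel_sub hk₁).ae_integrable hk₁.2.ne Fact.out hp (Lp.memLp f),
    (isSchurKernel_sub hk₂).ae_integrable hk₂.2.ne Fact.out hp (Lp.memLp f)]
    with x h h₁ h₂ h₃ i₁ i₂
  rw [h, Pi.add_apply, h₁, h₂, h₃, ← integral_add i₁ i₂]
  rfl

/-- Multiplication by the indicator function of `(-∞, a)` on `L_p(0,1)`. -/
def trunc (a : ℝ) : Lp E p unitVol →L[ℂ] Lp E p unitVol :=
  LinearMap.mkContinuous
    { toFun := fun f => ((Lp.memLp f).indicator (measurableSet_Iio (a := a))).toLp _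
      map_add' := fun f g => by
        rw [← MemLp.toLp_add]
        refine MemLp.toLp_congr _ _ ?_
        rw [← indicator_add']
        exact (Lp.coeFn_add f g).indicator
      map_smul' := fun c f => by
        rw [RingHom.id_apply, ← MemLp.toLp_const_smul]
        refine MemLp.toLp_congr _ _ ?_
        filter_upwards [Lp.coeFn_smul c f] with y hy
        by_cases h : y ∈ Iio a
        · simp only [indicator_of_mem h, hy, Pi.smul_apply]
        · simp only [indicator_of_notMem h, Pi.smul_apply, smul_zero] }
    1 fun f => by
      change ‖((Lp.memLp f).indicator (measurableSet_Iio (a := a))).toLp _‖ ≤ _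
      rw [Lp.norm_toLp, Lp.norm_def, one_mul]
      exact ENNReal.toReal_mono (Lp.eLpNorm_ne_top f) (eLpNorm_indicator_le _)

theorem trunc_coeFn (a : ℝ) (f : Lp E p unitVol) :
    trunc a f =ᵐ[unitVol] (Iio a).indicator f := by
  have : trunc a f = ((Lp.memLp f).indicator (measurableSet_Iio (a := a))).toLp _ := rfl
  rw [this]
  exact MemLp.coeFn_toLp _

theorem norm_trunc_le (a : ℝ) : ‖(trunc a : Lp E p unitVol →L[ℂ] _)‖ ≤ 1 :=
  LinearMap.mkContinuous_norm_le _ zero_le_one _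

omit [NormedSpace ℂ E] [Fact (1 ≤ p)] in
/-- Cutting off an `L_p` function depends continuously on the place of the cut. -/
theorem tendsto_eLpNorm_indicator_sub (h0 : p ≠ 0) (hp : p ≠ ∞) {μ : Measure ℝ} [NullSingletonClass μ]
    {f : ℝ → E} (hf : MemLp f p μ) {I : ℝ → Set ℝ} (hI : ∀ a, MeasurableSet (I a)) {a₀ : ℝ}
    (hloc : ∀ x, x ≠ a₀ → ∀ᶠ a in 𝓝 a₀, x ∈ I a ↔ x ∈ I a₀) :
    Tendsto (fun a => eLpNorm (fun x => (I a).indicator f x - (I a₀).indicator f x) p μ)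
      (𝓝 a₀) (𝓝 0) := by
  have hq := ENNReal.toReal_pos h0 hp
  have key : Tendsto (fun a => ∫⁻ x, ‖(I a).indicator f x - (I a₀).indicator f x‖ₑ ^ p.toReal ∂μ)
      (𝓝 a₀) (𝓝 (∫⁻ _, 0 ∂μ)) := by
    refine tendsto_lintegral_filter_of_dominated_convergence' (fun x => ‖f x‖ₑ ^ p.toReal)
      (Eventually.of_forall fun a => ?_) (Eventually.of_forall fun a => ?_) ?_ ?_
    · exact ((hf.1.indicator (hI a)).sub (hf.1.indicator (hI a₀))).enorm.pow_const _
    · refine Eventually.of_forall fun x => ?_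
      gcongr
      by_cases h1 : x ∈ I a <;> by_cases h2 : x ∈ I a₀ <;> simp [h1, h2]
    · rw [← eLpNorm_rpow_toReal h0 hp]
      exact ENNReal.rpow_ne_top_of_nonneg hq.le hf.2.ne
    -- At every x other than the null point a₀ the integrand vanishes for a close to a₀.
    · have : ∀ᵐ x ∂μ, x ≠ a₀ := by simp [ae_iff, measure_singleton]
      filter_upwards [this] with x hx
      refine tendsto_const_nhds.congr' ?_
      filter_upwards [hloc x hx] with a ha
      by_cases h2 : x ∈ I a₀
      · simp [h2, ha.2 h2, hq]
      · simp [h2, mt ha.1 h2, hq]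
  rw [lintegral_zero] at key
  have := (ENNReal.continuous_rpow_const (y := 1 / p.toReal)).tendsto 0 |>.comp key
  rw [ENNReal.zero_rpow_of_pos (by positivity)] at this
  refine this.congr fun a => ?_
  rw [Function.comp_apply, eLpNorm_eq_lintegral_rpow_enorm_toReal h0 hp]

theorem eventually_mem_Iio_iff {x a₀ : ℝ} (h : x ≠ a₀) :
    ∀ᶠ a in 𝓝 a₀, x ∈ Iio a ↔ x ∈ Iio a₀ := by
  rcases h.lt_or_gt with h | h
  · filter_upwards [eventually_gt_nhds h] with a ha using by simp [h, ha]
  · filter_upwards [eventually_lt_nhds h] with a ha using by simp [not_lt.2 h.le, not_lt.2 ha.le]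

theorem continuous_trunc_apply (hp : p ≠ ∞) (f : Lp E p unitVol) :
    Continuous fun a => trunc a f := by
  refine continuous_iff_continuousAt.2 fun a₀ => tendsto_iff_edist_tendsto_0.2 ?_
  refine (tendsto_eLpNorm_indicator_sub (zero_lt_one.trans_le Fact.out).ne' hp (Lp.memLp f)
    (fun a => measurableSet_Iio) (fun x hx => eventually_mem_Iio_iff hx)).congr fun a => ?_
  rw [Lp.edist_def]
  refine eLpNorm_congr_ae ?_
  filter_upwards [trunc_coeFn a f, trunc_coeFn a₀ f] with x h1 h2
  rw [Pi.sub_apply, h1, h2]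

end Convolution

/-! ### Compactness of convolution operators -/

section CompactConvolution

variable {E : Type*} [NormedAddCommGroup E] [NormedSpace ℂ E] {p : ℝ≥0∞} [Fact (1 ≤ p)]

/-- `k` is integrable on `(-1,1)` and convolution with `k` is compact on `L_p(0,1)`. -/
def IsCompactConv (hp : p ≠ ∞) (k : ℝ → E →L[ℂ] E) : Prop :=
  ∃ hk : Integrable k symVol, IsCompactOperator (convOp (p := p) hp hk)

theorem IsCompactConv.zero (hp : p ≠ ∞) : IsCompactConv (E := E) hp fun _ => 0 := by
  have hk : Integrable (fun _ : ℝ => (0 : E →L[ℂ] E)) symVol := by simp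
  refine ⟨hk, ?_⟩
  have : convOp (p := p) hp hk = 0 := by
    rw [← norm_le_zero_iff]
    simpa [convOp] using norm_kernelOp_le (p := p) hp (isSchurKernel_sub hk) hk.2.ne
  rw [this]
  exact isCompactOperator_zero

theorem IsCompactConv.add {hp : p ≠ ∞} {k₁ k₂ : ℝ → E →L[ℂ] E} (h₁ : IsCompactConv hp k₁)
    (h₂ : IsCompactConv hp k₂) : IsCompactConv hp fun u => k₁ u + k₂ u := by
  obtain ⟨hk₁, h₁⟩ := h₁
  obtain ⟨hk₂, h₂⟩ := h₂
  have hk : Integrable (fun u => k₁ u + k₂ u) symVol := by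
    refine (hk₁.sub hk₂.neg).congr (Eventually.of_forall fun u => ?_)
    simp
  refine ⟨hk, ?_⟩
  have e := convOp_add (p := p) hp hk₁ hk₂ hk
  rw [e]
  exact (compactOperator (RingHom.id ℂ) (Lp E p unitVol) (Lp E p unitVol)).add_mem h₁ h₂

theorem IsCompactConv.sum {hp : p ≠ ∞} {ι : Type*} (s : Finset ι) {k : ι → ℝ → E →L[ℂ] E}
    (h : ∀ i ∈ s, IsCompactConv hp (k i)) : IsCompactConv hp fun u => ∑ i ∈ s, k i u := by
  classical
  induction s using Finset.induction_on with
  | empty => simpa using IsCompactConv.zero hp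
  | insert a s ha ih =>
    simp only [Finset.sum_insert ha]
    exact (h a (Finset.mem_insert_self a s)).add
      (ih fun i hi => h i (Finset.mem_insert_of_mem hi))

/-- The norm of a convolution operator is at most the L_1 norm of its kernel, and the compact
operators form a closed set. -/
theorem IsCompactConv.of_approx {hp : p ≠ ∞} [CompleteSpace E] {k : ℝ → E →L[ℂ] E}
    (hk : Integrable k symVol)
    (h : ∀ ε : ℝ, 0 < ε → ∃ k', IsCompactConv hp k' ∧ ∫ u, ‖k u - k' u‖ ∂symVol ≤ ε) :
    IsCompactConv hp k := by
  refine ⟨hk, ?_⟩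
  have hcl := isClosed_setOfPred_isCompactOperator (σ₁₂ := RingHom.id ℂ)
    (M₁ := Lp E p unitVol) (M₂ := Lp E p unitVol)
  refine hcl.closure_subset (Metric.mem_closure_iff.2 fun ε hε => ?_)
  obtain ⟨k', ⟨hk', hc⟩, hle⟩ := h (ε / 2) (by positivity)
  refine ⟨convOp hp hk', hc, ?_⟩
  rw [dist_eq_norm]
  refine (norm_convOp_sub_le hp hk hk').trans_lt ?_
  have := integral_norm_eq_lintegral_enorm (hk.sub hk').1
  simp only [Pi.sub_apply] at this
  rw [← this]
  exact hle.trans_lt (by linarith)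

theorem integrable_symVol_of_continuous {F : Type*} [NormedAddCommGroup F] {f : ℝ → F}
    (hf : Continuous f) : Integrable f symVol :=
  (hf.continuousOn.integrableOn_Icc (a := -1) (b := 1)).mono_set Ioo_subset_Icc_self

omit [Fact (1 ≤ p)] in
theorem memLp_unitVol_of_continuous {F : Type*} [NormedAddCommGroup F] {f : ℝ → F}
    (hf : Continuous f) : MemLp f p unitVol := by
  obtain ⟨C, hC⟩ := isCompact_Icc.exists_bound_of_continuousOn (hf.continuousOn (s := Icc 0 1))
  refine MemLp.of_bound hf.aestronglyMeasurable C ?_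
  filter_upwards [ae_unitVol_mem] with x hx using hC x (Ioo_subset_Icc_self hx)

variable [FiniteDimensional ℂ E]

/-- Taylor expansion of P(x − y) at −y separates the variables, so every value of the operator is a
polynomial in x of degree at most that of P with coefficients in E. The operator has finite rank. -/
theorem isCompactConv_polynomial_smul (hp : p ≠ ∞) (P : Polynomial ℝ) (c : E →L[ℂ] E) :
    IsCompactConv hp fun u => P.eval u • c := by
  have : CompleteSpace E := FiniteDimensional.complete ℂ E
  have hk : Integrable (fun u => P.eval u • c) symVol :=
    integrable_symVol_of_continuous (by fun_prop)
  refine ⟨hk, ?_⟩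
  have hmem : ∀ e : Fin (P.natDegree + 1) → E,
      MemLp (fun x : ℝ => ∑ m : Fin (P.natDegree + 1), x ^ (m : ℕ) • e m) p unitVol :=
    fun e => memLp_unitVol_of_continuous
      (continuous_finsetSum _ fun m _ => by fun_prop)
  let Γ : (Fin (P.natDegree + 1) → E) →ₗ[ℂ] Lp E p unitVol :=
    { toFun := fun e => (hmem e).toLp _
      map_add' := fun e e' => by
        rw [← MemLp.toLp_add]
        refine MemLp.toLp_congr _ _ (Eventually.of_forall fun x => ?_)
        simp [smul_add, Finset.sum_add_distrib]
      map_smul' := fun z e => by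
        rw [RingHom.id_apply, ← MemLp.toLp_const_smul]
        refine MemLp.toLp_congr _ _ (Eventually.of_forall fun x => ?_)
        simp [Finset.smul_sum, smul_comm z] }
  refine isCompactOperator_of_forall_mem (LinearMap.range Γ) fun f => ?_
  have hfint : Integrable f unitVol := (Lp.memLp f).integrable Fact.out
  have hq : ∀ m : ℕ, Integrable (fun y : ℝ =>
      (Polynomial.hasseDeriv m P).eval (-y) • c (f y)) unitVol := fun m => by
    obtain ⟨C, hC⟩ := isCompact_Icc.exists_bound_of_continuousOn (s := Icc (0 : ℝ) 1)
      (f := fun y : ℝ => (Polynomial.hasseDeriv m P).eval (-y)) (by fun_prop)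
    refine (c.integrable_comp hfint).bdd_smul (𝕜 := ℝ)
      (φ := fun y => (Polynomial.hasseDeriv m P).eval (-y)) C ?_ ?_
    · exact Continuous.aestronglyMeasurable (by fun_prop)
    · filter_upwards [ae_unitVol_mem] with x hx using hC x (Ioo_subset_Icc_self hx)
  refine ⟨fun m => ∫ y, (Polynomial.hasseDeriv m P).eval (-y) • c (f y) ∂unitVol, ?_⟩
  refine Lp.ext ?_
  have h1 := MemLp.coeFn_toLp
    (hmem fun m => ∫ y, (Polynomial.hasseDeriv m P).eval (-y) • c (f y) ∂unitVol)
  filter_upwards [convOp_coeFn hp hk f, h1] with x hx h1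
  rw [hx]
  refine h1.trans ?_
  have hexp : ∀ y : ℝ, (P.eval (x - y) • c) (f y) = ∑ m : Fin (P.natDegree + 1),
      x ^ (m : ℕ) • ((Polynomial.hasseDeriv m P).eval (-y) • c (f y)) := fun y => by
    rw [sub_eq_add_neg, ← Polynomial.taylor_eval, Polynomial.eval_eq_sum_range,
      Polynomial.natDegree_taylor, smul_apply, Finset.sum_smul,
      Finset.sum_range]
    refine Finset.sum_congr rfl fun m _ => ?_
    rw [Polynomial.taylor_coeff, smul_smul, mul_comm]
  simp only [hexp]
  rw [integral_finsetSum (μ := unitVol) Finset.univ (f := fun (m : Fin (P.natDegree + 1)) y =>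
    x ^ (m : ℕ) • ((Polynomial.hasseDeriv m P).eval (-y) • c (f y)))
    fun m _ => (hq m).smul (x ^ (m : ℕ))]
  refine Finset.sum_congr rfl fun m _ => ?_
  rw [integral_smul]

/-- Weierstrass approximation reduces a continuous scalar factor to a polynomial one. -/
theorem isCompactConv_smul (hp : p ≠ ∞) {g : ℝ → ℝ} (hg : Continuous g) (c : E →L[ℂ] E) :
    IsCompactConv hp fun u => g u • c := by
  have : CompleteSpace E := FiniteDimensional.complete ℂ E
  refine IsCompactConv.of_approx (integrable_symVol_of_continuous (by fun_prop)) fun ε hε => ?_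
  -- The 2 is the length of (−1,1); adding 1 to ‖c‖ keeps the denominator positive when c = 0.
  obtain ⟨P, hP⟩ := exists_polynomial_near_of_continuousOn (-1) 1 g hg.continuousOn
    (ε / (2 * (‖c‖ + 1))) (by positivity)
  refine ⟨_, isCompactConv_polynomial_smul hp P c, ?_⟩
  calc ∫ u, ‖g u • c - P.eval u • c‖ ∂symVol
      ≤ ∫ _, ε / 2 ∂symVol := by
        refine integral_mono_ae ?_ (integrable_const _) ?_
        · exact (integrable_symVol_of_continuous (by fun_prop)).norm
        · filter_upwards [ae_restrict_mem measurableSet_Ioo] with u hu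
          rw [← sub_smul, norm_smul, norm_sub_rev]
          calc _ ≤ ε / (2 * (‖c‖ + 1)) * (‖c‖ + 1) := by
                gcongr
                · exact (hP u (Ioo_subset_Icc_self hu)).le
                · linarith
            _ = ε / 2 := by field_simp
    _ = ε := by
        simp
        norm_num
        ring

/-- Convolution with an integrable kernel is a compact operator on `L_p(0,1)`. -/
theorem isCompactOperator_convOp (hp : p ≠ ∞) {k : ℝ → E →L[ℂ] E} (hk : Integrable k symVol) :
    IsCompactOperator (convOp (p := p) hp hk) := by
  have : CompleteSpace E := FiniteDimensional.complete ℂ E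
  suffices h : IsCompactConv hp k from h.2
  refine IsCompactConv.of_approx hk fun ε hε => ?_
  obtain ⟨g, -, hg, hgc, -⟩ := hk.exists_hasCompactSupport_integral_sub_le hε
  refine ⟨g, ?_, hg⟩
  let : NormedSpace ℝ (E →L[ℂ] E) := NormedSpace.complexToReal
  -- In coordinates with respect to a basis, a continuous operator-valued kernel is a finite sum of
  -- scalar kernels times fixed operators.
  let b := Module.finBasis ℝ (E →L[ℂ] E)
  have hgb : g = fun u => ∑ i, b.repr (g u) i • b i := funext fun u => (b.sum_repr (g u)).symm
  rw [hgb]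
  refine IsCompactConv.sum _ fun i _ => isCompactConv_smul hp ?_ (b i)
  exact (LinearMap.continuous_of_finiteDimensional (b.coord i)).comp hgc

end CompactConvolution

/-! ### Invertibility of the truncated operators -/

section Invertibility

variable {X : Type*} [NormedAddCommGroup X] [NormedSpace ℂ X]

/-- Inversion is continuous on the units, so the norms of the inverses are bounded on the compact
interval [0,1]. -/
theorem exists_forall_norm_le [CompleteSpace X] {S : ℝ → X →L[ℂ] X} (hS : Continuous S)
    (hu : ∀ a, IsUnit (1 + S a)) :
    ∃ M : ℝ, 0 < M ∧ ∀ a ∈ Icc (0 : ℝ) 1, ∀ v, ‖v‖ ≤ M * ‖v + S a v‖ := by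
  have hinv : Continuous fun a => Ring.inverse (1 + S a) :=
    continuous_iff_continuousAt.2 fun a => by
      have h1 := NormedRing.inverse_continuousAt (hu a).unit
      rw [IsUnit.unit_spec] at h1
      exact h1.comp (f := fun a => 1 + S a) (by fun_prop)
  obtain ⟨C, hC⟩ := isCompact_Icc.exists_bound_of_continuousOn (hinv.continuousOn (s := Icc 0 1))
  refine ⟨|C| + 1, by positivity, fun a ha v => ?_⟩
  have e : Ring.inverse (1 + S a) (v + S a v) = v := by
    have := Ring.inverse_mul_cancel (1 + S a) (hu a)
    simpa using congrArg (fun T : X →L[ℂ] X => T v) this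
  calc ‖v‖ = ‖Ring.inverse (1 + S a) (v + S a v)‖ := by rw [e]
    _ ≤ (|C| + 1) * ‖v + S a v‖ :=
      (Ring.inverse (1 + S a)).le_of_opNorm_le ((hC a ha).trans (by linarith [le_abs_self C])) _

/-- A lower bound for `1 + S` survives small perturbations of `S`. -/
theorem norm_le_of_norm_sub_le {S S' : X →L[ℂ] X} {M : ℝ} (hM : 0 < M)
    (h : ∀ v, ‖v‖ ≤ M * ‖v + S v‖) (hSS : M * ‖S' - S‖ ≤ 1 / 2) (v : X) :
    ‖v‖ ≤ 2 * M * ‖v + S' v‖ := by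
  have h1 : ‖v + S v‖ ≤ ‖v + S' v‖ + ‖S' - S‖ * ‖v‖ := by
    have : v + S v = (v + S' v) - (S' - S) v := by
      rw [sub_apply]
      abel
    rw [this]
    exact (norm_sub_le _ _).trans (by gcongr; exact (S' - S).le_opNorm v)
  have h2 : M * ‖v + S v‖ ≤ M * (‖v + S' v‖ + ‖S' - S‖ * ‖v‖) := by gcongr
  have h3 : M * ‖S' - S‖ * ‖v‖ ≤ 1 / 2 * ‖v‖ := by gcongr
  nlinarith [h v]

/-- A lower bound for `1 + P_a T`, uniform in `a` and locally uniform in `T`. -/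
theorem exists_bound_of_isUnit [CompleteSpace X] {P : ℝ → X →L[ℂ] X} (hP : ∀ a, ‖P a‖ ≤ 1)
    (hPc : ∀ v, Continuous fun a => P a v) {T : X →L[ℂ] X} (hT : IsCompactOperator T)
    (hu : ∀ a, IsUnit (1 + P a ∘L T)) :
    ∃ M δ : ℝ, 0 < M ∧ 0 < δ ∧ ∀ T' : X →L[ℂ] X, ‖T' - T‖ ≤ δ → ∀ a ∈ Icc (0 : ℝ) 1,
      ∀ v, ‖v‖ ≤ M * ‖v + P a (T' v)‖ := by
  obtain ⟨M, hM, hbd⟩ := exists_forall_norm_le (continuous_comp_of_isCompactOperator hP hPc hT) hu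
  -- As ‖P_a‖ ≤ 1, this δ keeps M‖P_a(T' − T)‖ ≤ 1/2 for all a at once, at the cost of doubling M.
  refine ⟨2 * M, 1 / (2 * M), by positivity, by positivity, fun T' hle a ha v => ?_⟩
  refine norm_le_of_norm_sub_le (S' := P a ∘L T') hM (hbd a ha) ?_ v
  rw [← ContinuousLinearMap.comp_sub]
  have h1 : ‖P a ∘L (T' - T)‖ ≤ 1 / (2 * M) :=
    (ContinuousLinearMap.opNorm_comp_le _ _).trans
      ((mul_le_of_le_one_left (norm_nonneg _) (hP a)).trans hle)
  calc M * ‖P a ∘L (T' - T)‖ ≤ M * (1 / (2 * M)) := by gcongr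
    _ = 1 / 2 := by field_simp

end Invertibility

/-! ### Accelerants and the operators `f ↦ ∫ h(x-t) f(t) dt` on `L_2` -/

variable {r : ℕ}

/-- The action of matrices on the Euclidean space, as a bounded linear map. -/
def matAct (r : ℕ) : Mat (Fin r) →L[ℂ]
    EuclideanSpace ℂ (Fin r) →L[ℂ] EuclideanSpace ℂ (Fin r) :=
  LinearMap.toContinuousLinearMap
    (Matrix.toEuclideanCLM (n := Fin r) (𝕜 := ℂ)).toAlgEquiv.toLinearMap

theorem matAct_apply (A : Mat (Fin r)) (v : EuclideanSpace ℂ (Fin r)) :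
    matAct r A v = Matrix.toEuclideanLin A v := rfl

theorem matAct_mul (A B : Mat (Fin r)) : matAct r (A * B) = matAct r A ∘L matAct r B :=
  map_mul (Matrix.toEuclideanCLM (n := Fin r) (𝕜 := ℂ)) A B

theorem norm_matAct (A : Mat (Fin r)) : ‖matAct r A‖ = ‖A‖ :=
  Matrix.l2_opNorm_toEuclideanCLM A

theorem matAct_injective : Function.Injective (matAct r) :=
  (Matrix.toEuclideanCLM (n := Fin r) (𝕜 := ℂ)).injective

theorem trunc_of_nonpos {E : Type*} [NormedAddCommGroup E] [NormedSpace ℂ E] {p : ℝ≥0∞}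
    [Fact (1 ≤ p)] {a : ℝ} (ha : a ≤ 0) (f : Lp E p unitVol) : trunc a f = 0 := by
  refine Lp.ext ?_
  filter_upwards [trunc_coeFn a f, Lp.coeFn_zero E p unitVol, ae_unitVol_mem] with x h h0 hx
  rw [h, h0, indicator_of_notMem (show x ∉ Iio a from not_lt.2 (ha.trans hx.1.le))]
  rfl

theorem trunc_of_one_le {E : Type*} [NormedAddCommGroup E] [NormedSpace ℂ E] {p : ℝ≥0∞}
    [Fact (1 ≤ p)] {a : ℝ} (ha : 1 ≤ a) (f : Lp E p unitVol) : trunc a f = f := by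
  refine Lp.ext ?_
  filter_upwards [trunc_coeFn a f, ae_unitVol_mem] with x h hx
  rw [h, indicator_of_mem (show x ∈ Iio a from hx.2.trans_le ha)]

/-- If `1 + P_a T` is injective for `a ∈ (0,1]`, then it is injective for all `a`. -/
theorem trunc_injective_of_Ioc {E : Type*} [NormedAddCommGroup E] [NormedSpace ℂ E] {p : ℝ≥0∞}
    [Fact (1 ≤ p)] {T : Lp E p unitVol →L[ℂ] Lp E p unitVol}
    (h : ∀ a ∈ Ioc (0 : ℝ) 1, ∀ f, f + trunc a (T f) = 0 → f = 0) (a : ℝ) (f : Lp E p unitVol)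
    (hf : f + trunc a (T f) = 0) : f = 0 := by
  rcases le_or_gt a 0 with ha | ha
  · rwa [trunc_of_nonpos ha, add_zero] at hf
  rcases le_or_gt a 1 with h1 | h1
  · exact h a ⟨ha, h1⟩ f hf
  · refine h 1 ⟨one_pos, le_rfl⟩ f ?_
    rwa [trunc_of_one_le le_rfl, ← trunc_of_one_le h1.le (T f)]

theorem integrable_matAct {h : ℝ → Mat (Fin r)} (hh : Integrable h symVol) :
    Integrable (fun u => matAct r (h u)) symVol := (matAct r).integrable_comp hh

/-- Convolution with `h` on `L_2((0,1), ℂ^r)`. -/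
def colOp {h : ℝ → Mat (Fin r)} (hh : Integrable h symVol) :
    Lp (EuclideanSpace ℂ (Fin r)) 2 unitVol →L[ℂ] Lp (EuclideanSpace ℂ (Fin r)) 2 unitVol :=
  convOp ENNReal.ofNat_ne_top (integrable_matAct hh)

theorem colOp_coeFn {h : ℝ → Mat (Fin r)} (hh : Integrable h symVol)
    (f : Lp (EuclideanSpace ℂ (Fin r)) 2 unitVol) :
    colOp hh f =ᵐ[unitVol] fun x => ∫ t, matAct r (h (x - t)) (f t) ∂unitVol :=
  convOp_coeFn _ _ f

theorem colOp_trunc_coeFn {h : ℝ → Mat (Fin r)} (hh : Integrable h symVol) {a : ℝ} (ha : a ≤ 1)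
    (f : Lp (EuclideanSpace ℂ (Fin r)) 2 unitVol) :
    colOp hh (trunc a f) =ᵐ[unitVol]
      fun x => ∫ t in Ioo (0 : ℝ) a, Matrix.toEuclideanLin (h (x - t)) (f t) := by
  filter_upwards [colOp_coeFn hh (trunc a f)] with x hx
  have hset : Iio a ∩ Ioo (0 : ℝ) 1 = Ioo 0 a := by
    ext t
    simp only [mem_inter_iff, mem_Iio, mem_Ioo]
    exact ⟨fun h => ⟨h.2.1, h.1⟩, fun h => ⟨h.2, h.1, h.2.trans_le ha⟩⟩
  rw [hx, ← hset, ← Measure.restrict_restrict measurableSet_Iio,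
    ← integral_indicator measurableSet_Iio]
  refine integral_congr_ae ?_
  filter_upwards [trunc_coeFn a f] with t ht
  by_cases h1 : t ∈ Iio a
  · rw [ht, indicator_of_mem h1, indicator_of_mem h1, matAct_apply]
  · rw [ht, indicator_of_notMem h1, indicator_of_notMem h1, map_zero]

/-- With C the convolution operator, the definition concerns 1 + C P_a, the criterion 1 + P_a C. The
maps f ↦ −C f and f ↦ P_a f carry the kernel of each operator into that of the other and are inverse
there. The form with the cut on the outside fits the norm continuity of P_a C. -/
theorem isAccelerant_iff {h : ℝ → Mat (Fin r)} (hh : Integrable h symVol) :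
    IsAccelerant h ↔ ∀ a ∈ Ioc (0 : ℝ) 1, ∀ f, f + trunc a (colOp hh f) = 0 → f = 0 := by
  have key : ∀ a ∈ Ioc (0 : ℝ) 1, ∀ f : Lp (EuclideanSpace ℂ (Fin r)) 2 unitVol,
      (∀ᵐ x ∂unitVol, f x + ∫ t in Ioo (0 : ℝ) a, Matrix.toEuclideanLin (h (x - t)) (f t) = 0) ↔
        f + colOp hh (trunc a f) = 0 := fun a ha f => by
    rw [Lp.eq_zero_iff_ae_eq_zero]
    refine eventually_congr ?_
    filter_upwards [Lp.coeFn_add f (colOp hh (trunc a f)), colOp_trunc_coeFn hh ha.2 f]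
      with x h1 h2
    rw [h1, Pi.add_apply, h2]
    rfl
  constructor
  · rintro ⟨-, H⟩ a ha f hf
    have hg : trunc a (-colOp hh f) = f := by
      rw [map_neg]
      exact (eq_neg_of_add_eq_zero_left hf).symm
    have := H a ha (-colOp hh f) ((key a ha _).2 (by rw [hg, neg_add_cancel]))
    rw [← hg, this, map_zero]
  · intro H
    refine ⟨memLp_one_iff_integrable.2 hh, fun a ha f hf => ?_⟩
    have hf' := (key a ha f).1 hf
    have h0 : trunc a f = 0 := H a ha _ (by rw [← map_add, hf', map_zero])
    rwa [h0, map_zero, add_zero] at hf'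

theorem IsAccelerant.integrable {h : ℝ → Mat (Fin r)} (hacc : IsAccelerant h) :
    Integrable h symVol := memLp_one_iff_integrable.1 hacc.1

theorem IsAccelerant.isUnit {h : ℝ → Mat (Fin r)} (hacc : IsAccelerant h) (a : ℝ) :
    IsUnit (1 + trunc a ∘L colOp hacc.integrable) :=
  isUnit_one_add_of_isCompactOperator
    ((isCompactOperator_convOp _ (integrable_matAct hacc.integrable)).clm_comp (trunc a))
    (trunc_injective_of_Ioc ((isAccelerant_iff hacc.integrable).1 hacc) a)

/-- The accelerants form an open set with respect to the `L_1` distance. -/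
theorem IsAccelerant.exists_forall_isAccelerant {h : ℝ → Mat (Fin r)} (hacc : IsAccelerant h) :
    ∃ δ : ℝ, 0 < δ ∧ ∀ h' : ℝ → Mat (Fin r), Integrable h' symVol →
      ∫⁻ u, ‖h' u - h u‖ₑ ∂symVol ≤ ENNReal.ofReal δ → IsAccelerant h' := by
  have hh := hacc.integrable
  obtain ⟨M, δ, -, hδ, hbd⟩ := exists_bound_of_isUnit norm_trunc_le
    (continuous_trunc_apply (p := 2) ENNReal.ofNat_ne_top)
    (isCompactOperator_convOp (p := 2) ENNReal.ofNat_ne_top (integrable_matAct hh)) hacc.isUnit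
  refine ⟨δ, hδ, fun h' hh' hle => (isAccelerant_iff hh').2 fun a ha f hf => ?_⟩
  have hS : ‖colOp hh' - colOp hh‖ ≤ δ := by
    refine (norm_convOp_sub_le _ (integrable_matAct hh') (integrable_matAct hh)).trans ?_
    refine le_of_eq_of_le ?_ (ENNReal.toReal_le_of_le_ofReal hδ.le hle)
    congr 1
    refine lintegral_congr fun u => ?_
    rw [← map_sub, ← ofReal_norm, norm_matAct, ofReal_norm]
  have := hbd (colOp hh') hS a (Ioc_subset_Icc_self ha) f
  rw [hf, norm_zero, mul_zero] at this
  exact norm_le_zero_iff.1 this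

theorem measurePreserving_neg_symVol : MeasurePreserving (fun u : ℝ => -u) symVol symVol := by
  have h := (Measure.measurePreserving_neg (volume : Measure ℝ)).restrict_preimage
    (measurableSet_Ioo (a := (-1 : ℝ)) (b := 1))
  have e : (Neg.neg : ℝ → ℝ) ⁻¹' Ioo (-1) 1 = Ioo (-1) 1 := by simp
  rwa [e] at h

theorem integrable_sharp {h : ℝ → Mat (Fin r)} (hh : Integrable h symVol) :
    Integrable (sharp h) symVol :=
  (measurePreserving_neg_symVol.integrable_comp hh.1).2 hh

/-- The reflection of an accelerant is an accelerant. -/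
theorem IsAccelerant.sharp {h : ℝ → Mat (Fin r)} (hacc : IsAccelerant h) :
    IsAccelerant (sharp h) := by
  have hh := hacc.integrable
  refine (isAccelerant_iff (integrable_sharp hh)).2 fun a ha f hf => ?_
  have hsub : Ioo (0 : ℝ) a ⊆ Ioo 0 1 := Ioo_subset_Ioo_right ha.2
  -- The equation forces f to vanish beyond a, so F is a version of f defined on the whole line,
  -- where it can be reflected.
  let F : ℝ → EuclideanSpace ℂ (Fin r) := (Ioo (0 : ℝ) a).indicator f
  have hFf : F =ᵐ[unitVol] f := by
    filter_upwards [Lp.coeFn_add f (trunc a (colOp (integrable_sharp hh) f)),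
      trunc_coeFn a (colOp (integrable_sharp hh) f), ae_unitVol_mem,
      Lp.coeFn_zero (EuclideanSpace ℂ (Fin r)) 2 unitVol] with x h1 h2 hx h0
    by_cases hxa : x ∈ Ioo (0 : ℝ) a
    · simp only [F, indicator_of_mem hxa]
    · have hxa' : x ∉ Iio a := fun h' => hxa ⟨hx.1, h'⟩
      rw [hf, h0, Pi.add_apply, h2, indicator_of_notMem hxa', add_zero] at h1
      simp only [F, indicator_of_notMem hxa]
      exact h1
  have hFeq : ∀ᵐ y, y ∈ Ioo (0 : ℝ) a → F y + ∫ t, matAct r (h (t - y)) (F t) = 0 := by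
    have : ∀ᵐ y ∂unitVol, y ∈ Ioo (0 : ℝ) a → F y + ∫ t, matAct r (h (t - y)) (F t) = 0 := by
      filter_upwards [Lp.coeFn_add f (trunc a (colOp (integrable_sharp hh) f)),
        trunc_coeFn a (colOp (integrable_sharp hh) f), hFf, colOp_coeFn (integrable_sharp hh) f,
        Lp.coeFn_zero (EuclideanSpace ℂ (Fin r)) 2 unitVol] with x h1 h2 h3 h4 h0 hx
      rw [hf, h0, Pi.add_apply, h2, indicator_of_mem (show x ∈ Iio a from hx.2), h4, ← h3] at h1
      refine Eq.trans ?_ h1.symm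
      congr 1
      rw [← integral_indicator measurableSet_Ioo]
      have : ∀ᵐ t, t ∈ Ioo (0 : ℝ) 1 → F t = f t := (ae_restrict_iff' measurableSet_Ioo).1 hFf
      refine integral_congr_ae ?_
      filter_upwards [this] with t ht
      by_cases ht1 : t ∈ Ioo (0 : ℝ) 1
      · rw [indicator_of_mem ht1, ← ht ht1, Krein.sharp, neg_sub]
      · rw [indicator_of_notMem ht1, show F t = 0 from indicator_of_notMem (mt (@hsub t) ht1) _,
          map_zero]
    filter_upwards [(ae_restrict_iff' measurableSet_Ioo).1 this] with y hy hya
      using hy (hsub hya) hya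
  have hFmem : MemLp F 2 volume := by
    have : MemLp F 2 unitVol := (memLp_congr_ae hFf).2 (Lp.memLp f)
    refine (memLp_indicator_iff_restrict measurableSet_Ioo).2 ?_
    exact (Lp.memLp f).mono_measure (Measure.restrict_mono hsub le_rfl)
  -- Reflection about a/2: with y = a − x, substituting a − t for t turns h(t − y) into h(x − t), so
  -- x ↦ F(a − x) solves the equation for h itself.
  have hmp := Measure.measurePreserving_sub_left (volume : Measure ℝ) a
  have hGmem : MemLp (fun x => F (a - x)) 2 unitVol :=
    (hFmem.comp_measurePreserving hmp).mono_measure Measure.restrict_le_self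
  have hG : hGmem.toLp _ = 0 := by
    refine (isAccelerant_iff hh).1 hacc a ha _ ?_
    rw [Lp.eq_zero_iff_ae_eq_zero]
    have hF' := hmp.quasiMeasurePreserving.ae hFeq
    filter_upwards [Lp.coeFn_add (hGmem.toLp _) (trunc a (colOp hh (hGmem.toLp _))),
      trunc_coeFn a (colOp hh (hGmem.toLp _)), hGmem.coeFn_toLp, colOp_coeFn hh (hGmem.toLp _),
      ae_unitVol_mem, ae_restrict_of_ae hF'] with x h1 h2 h3 h4 hx h5
    rw [h1, Pi.add_apply, h2, h3]
    by_cases hxa : x ∈ Iio a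
    · rw [indicator_of_mem hxa, h4]
      have h5 := h5 ⟨sub_pos.2 hxa, by linarith [hx.1]⟩
      refine Eq.trans ?_ h5
      congr 1
      rw [← integral_sub_left_eq_self _ volume a, ← integral_indicator measurableSet_Ioo]
      have hG' : ∀ᵐ t, t ∈ Ioo (0 : ℝ) 1 → hGmem.toLp _ t = F (a - t) :=
        (ae_restrict_iff' measurableSet_Ioo).1 hGmem.coeFn_toLp
      refine integral_congr_ae ?_
      filter_upwards [hG'] with t ht
      by_cases ht1 : t ∈ Ioo (0 : ℝ) 1
      · rw [indicator_of_mem ht1, ht ht1]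
        congr 3
        ring
      · have : a - t ∉ Ioo (0 : ℝ) a := fun h' => ht1 ⟨by linarith [h'.2], by
          linarith [h'.1, ha.2]⟩
        rw [indicator_of_notMem ht1, show F (a - t) = 0 from indicator_of_notMem this _, map_zero]
    · have : a - x ∉ Ioo (0 : ℝ) a := fun h' => hxa (sub_pos.1 h'.1)
      rw [indicator_of_notMem hxa, add_zero, show F (a - x) = 0 from indicator_of_notMem this _]
      rfl
  have hG0 : ∀ᵐ x ∂unitVol, F (a - x) = 0 := by
    have := hGmem.coeFn_toLp
    rw [hG] at this
    filter_upwards [this, Lp.coeFn_zero (EuclideanSpace ℂ (Fin r)) 2 unitVol] with x h1 h2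
    rw [← h1, h2]
    rfl
  have hF0 : ∀ᵐ y, F y = 0 := by
    have h1 : ∀ᵐ x, F (a - x) = 0 := by
      filter_upwards [(ae_restrict_iff' measurableSet_Ioo).1 hG0] with x hx
      by_cases hx1 : x ∈ Ioo (0 : ℝ) 1
      · exact hx hx1
      · exact indicator_of_notMem (fun h' => hx1 ⟨by linarith [h'.2], by
          linarith [h'.1, ha.2]⟩) _
    filter_upwards [hmp.quasiMeasurePreserving.ae h1] with y hy
    simpa using hy
  rw [Lp.eq_zero_iff_ae_eq_zero]
  filter_upwards [hFf, ae_restrict_of_ae hF0] with x h1 h2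
  rw [← h1, h2]
  rfl

/-! ### The operators `φ ↦ ∫ φ(s) h(s-t) ds` on `L_1` -/

section Row

variable {A : Type*} [NormedRing A] [NormedAlgebra ℂ A]

variable (A) in
/-- Right multiplication: `rowMul A a b = b * a`. -/
def rowMul : A →L[ℂ] A →L[ℂ] A := (ContinuousLinearMap.mul ℂ A).flip

theorem rowMul_apply (a b : A) : rowMul A a b = b * a := rfl

theorem enorm_rowMul_le (a : A) : ‖rowMul A a‖ₑ ≤ ‖a‖ₑ := by
  rw [← ofReal_norm, ← ofReal_norm]
  refine ENNReal.ofReal_le_ofReal ?_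
  refine ContinuousLinearMap.opNorm_le_bound _ (norm_nonneg _) fun B => ?_
  rw [rowMul_apply, mul_comm]
  exact norm_mul_le _ _

/-- The row operator becomes a convolution: the operator-valued kernel taken at t − s sends φ(s) to
φ(s) h(s − t). -/
theorem integrable_rowMul {h : ℝ → A} (hh : Integrable h symVol) :
    Integrable (fun u => rowMul A (h (-u))) symVol :=
  (rowMul A).integrable_comp (φ := fun u => h (-u)) ((measurePreserving_neg_symVol.integrable_comp hh.1).2 hh)

/-- The operator `φ ↦ ∫ φ(s) h(s - ·) ds` on `L_1(0,1)`. -/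
def rowOp {h : ℝ → A} (hh : Integrable h symVol) :
    Lp A 1 unitVol →L[ℂ] Lp A 1 unitVol :=
  convOp ENNReal.one_ne_top (integrable_rowMul hh)

theorem rowOp_coeFn {h : ℝ → A} (hh : Integrable h symVol)
    (φ : Lp A 1 unitVol) :
    rowOp hh φ =ᵐ[unitVol] fun t => ∫ s, φ s * h (s - t) ∂unitVol := by
  filter_upwards [convOp_coeFn ENNReal.one_ne_top (integrable_rowMul hh) φ] with t ht
  rw [rowOp, ht]
  simp only [rowMul_apply, neg_sub]

theorem lintegral_comp_neg_symVol (f : ℝ → ℝ≥0∞) :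
    ∫⁻ u, f (-u) ∂symVol = ∫⁻ u, f u ∂symVol :=
  measurePreserving_neg_symVol.lintegral_comp_emb (MeasurableEquiv.neg ℝ).measurableEmbedding f

theorem norm_rowOp_sub_le {h h' : ℝ → A} (hh : Integrable h symVol)
    (hh' : Integrable h' symVol) :
    ‖rowOp hh' - rowOp hh‖ ≤ (∫⁻ u, ‖h' u - h u‖ₑ ∂symVol).toReal := by
  refine (norm_convOp_sub_le _ (integrable_rowMul hh') (integrable_rowMul hh)).trans ?_
  refine ENNReal.toReal_mono (hh'.sub hh).2.ne ?_
  rw [← lintegral_comp_neg_symVol fun u => ‖h' u - h u‖ₑ]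
  refine lintegral_mono fun u => ?_
  rw [← map_sub]
  exact enorm_rowMul_le _

/-- An integrable function is the sum of a bounded one and of one with small norm. -/
theorem exists_bounded_lintegral_sub_le {h : ℝ → A} (hh : Integrable h symVol)
    {ε : ℝ≥0∞} (hε : ε ≠ 0) :
    ∃ (g : ℝ → A) (N : ℝ≥0∞), N ≠ ∞ ∧ (∀ u, ‖g u‖ₑ ≤ N) ∧ Integrable g symVol ∧
      ∫⁻ u, ‖h u - g u‖ₑ ∂symVol ≤ ε := by
  obtain ⟨g, hgc, hg, hgcont, hgi⟩ := hh.exists_hasCompactSupport_lintegral_sub_le hε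
  obtain ⟨C, hC⟩ := hgcont.bounded_above_of_compact_support hgc
  refine ⟨g, ENNReal.ofReal C, ENNReal.ofReal_ne_top, fun u => ?_, hgi, hg⟩
  rw [← ofReal_norm]
  exact ENNReal.ofReal_le_ofReal (hC u)

omit [NormedAlgebra ℂ A] in
theorem aemeasurable_enorm_sub {h : ℝ → A} (hh : Integrable h symVol) :
    AEMeasurable (fun z : ℝ × ℝ => ‖h (z.1 - z.2)‖ₑ) (unitVol.prod unitVol) :=
  (hh.1.comp_quasiMeasurePreserving quasiMeasurePreserving_sub_unitVol).enorm

omit [NormedAlgebra ℂ A] in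
theorem aestronglyMeasurable_comp_sub_right {h : ℝ → A}
    (hh : AEStronglyMeasurable h symVol) {t : ℝ} (ht : t ∈ Icc (0 : ℝ) 1) :
    AEStronglyMeasurable (fun s => h (s - t)) unitVol := by
  refine hh.comp_quasiMeasurePreserving
    ((measurePreserving_sub_right volume t).quasiMeasurePreserving.restrict fun s hs => ?_)
  constructor <;> linarith [hs.1, hs.2, ht.1, ht.2]

omit [NormedAlgebra ℂ A] in
theorem aestronglyMeasurable_comp_sub_left {h : ℝ → A}
    (hh : AEStronglyMeasurable h symVol) {t : ℝ} (ht : t ∈ Icc (0 : ℝ) 1) :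
    AEStronglyMeasurable (fun s => h (t - s)) unitVol := by
  refine hh.comp_quasiMeasurePreserving
    ((Measure.measurePreserving_sub_left volume t).quasiMeasurePreserving.restrict fun s hs => ?_)
  constructor <;> linarith [hs.1, hs.2, ht.1, ht.2]

/-- The pointwise bound of `∫ φ(s) h(s-t) ds` through a bounded function `g` close to `h`. -/
theorem enorm_integral_mul_le {h g : ℝ → A} {N : ℝ≥0∞} (hN : ∀ u, ‖g u‖ₑ ≤ N)
    {φ : ℝ → A} (hφ : AEStronglyMeasurable φ unitVol) (t : ℝ) :
    ‖∫ s, φ s * h (s - t) ∂unitVol‖ₑ ≤ N * ∫⁻ s, ‖φ s‖ₑ ∂unitVol +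
      ∫⁻ s, ‖φ s‖ₑ * ‖h (s - t) - g (s - t)‖ₑ ∂unitVol := by
  refine (enorm_integral_le_lintegral_enorm _).trans ?_
  rw [← lintegral_const_mul'' _ hφ.enorm,
    ← lintegral_add_left' (hφ.enorm.const_mul _)]
  refine lintegral_mono fun s => ?_
  calc ‖φ s * h (s - t)‖ₑ ≤ ‖φ s‖ₑ * ‖h (s - t)‖ₑ := by
        rw [← enorm_norm (φ s), ← enorm_norm (h _), ← enorm_mul, ← ofReal_norm, ← ofReal_norm]
        refine ENNReal.ofReal_le_ofReal ?_
        rw [Real.norm_of_nonneg (by positivity)]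
        exact norm_mul_le _ _
    _ ≤ ‖φ s‖ₑ * (N + ‖h (s - t) - g (s - t)‖ₑ) := by
        gcongr
        calc ‖h (s - t)‖ₑ = ‖g (s - t) + (h (s - t) - g (s - t))‖ₑ := by rw [add_sub_cancel]
          _ ≤ _ := (enorm_add_le _ _).trans (by gcongr; exact hN _)
    _ = N * ‖φ s‖ₑ + ‖φ s‖ₑ * ‖h (s - t) - g (s - t)‖ₑ := by ring

theorem exists_add_apply_eq {X : Type*} [NormedAddCommGroup X] [NormedSpace ℂ X] {T : X →L[ℂ] X}
    (h : IsUnit (1 + T)) (f : X) : ∃ u, u + T u = f := by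
  have e := congrArg (fun S : X →L[ℂ] X => S f) (Ring.mul_inverse_cancel (1 + T) h)
  exact ⟨Ring.inverse (1 + T) f, by simpa using e⟩

theorem row_eq_ae {h : ℝ → A} (hh : Integrable h symVol) {a : ℝ}
    {φ : Lp A 1 unitVol} (hφ : φ + trunc a (rowOp hh φ) = 0) :
    ∀ᵐ t ∂unitVol, φ t = -(Iio a).indicator (fun t => ∫ s, φ s * h (s - t) ∂unitVol) t := by
  filter_upwards [Lp.coeFn_add φ (trunc a (rowOp hh φ)), trunc_coeFn a (rowOp hh φ),
    rowOp_coeFn hh φ, Lp.coeFn_zero A 1 unitVol] with t h1 h2 h3 h0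
  rw [hφ, h0, Pi.add_apply, h2] at h1
  rw [eq_neg_of_add_eq_zero_left h1.symm]
  by_cases ht : t ∈ Iio a
  · rw [indicator_of_mem ht, indicator_of_mem ht, h3]
  · rw [indicator_of_notMem ht, indicator_of_notMem ht]

/-- Bootstrapping from L_1 to L_∞: the bounded part g of h contributes at most N‖φ‖_1, and the
remainder has mass at most 1/2 and is absorbed by `ae_le_two_mul_of_le_add_lintegral`. -/
theorem row_memLp {h : ℝ → A} (hh : Integrable h symVol) {a : ℝ}
    {φ : Lp A 1 unitVol} (hφ : φ + trunc a (rowOp hh φ) = 0) :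
    MemLp φ ∞ unitVol := by
  obtain ⟨g, N, hN, hgN, hgi, hg⟩ := exists_bounded_lintegral_sub_le hh (ε := 2⁻¹) (by simp)
  have hφm := Lp.aestronglyMeasurable φ
  have hfin : ∫⁻ s, ‖φ s‖ₑ ∂unitVol ≠ ∞ := by
    rw [← eLpNorm_one_eq_lintegral_enorm]
    exact Lp.eLpNorm_ne_top φ
  have hb := ae_le_two_mul_of_le_add_lintegral (aemeasurable_enorm_sub (hh.sub hgi)) hφm.enorm
    hfin (C := N * ∫⁻ s, ‖φ s‖ₑ ∂unitVol)
    (by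
      filter_upwards [ae_unitVol_mem] with s hs
      exact (lintegral_sub_left_le (fun u => ‖(h - g) u‖ₑ) (Ioo_subset_Icc_self hs)).trans hg)
    (by
      filter_upwards [ae_unitVol_mem] with s hs
      exact (lintegral_sub_right_le (fun u => ‖(h - g) u‖ₑ) (Ioo_subset_Icc_self hs)).trans hg)
    (by
      filter_upwards [row_eq_ae hh hφ] with t ht
      rw [ht, enorm_neg]
      refine le_trans ?_ (enorm_integral_mul_le (h := h) hgN hφm t)
      by_cases h1 : t ∈ Iio a
      · rw [indicator_of_mem h1]
      · rw [indicator_of_notMem h1, enorm_zero]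
        positivity)
  refine ⟨hφm, ?_⟩
  rw [eLpNorm_exponent_top]
  refine lt_of_le_of_lt (essSup_le_of_ae_le _ hb) ?_
  exact ENNReal.mul_lt_top ENNReal.ofNat_lt_top (ENNReal.mul_lt_top hN.lt_top hfin.lt_top)

variable [FiniteDimensional ℂ A]

theorem isCompactOperator_rowOp {h : ℝ → A} (hh : Integrable h symVol) :
    IsCompactOperator (rowOp hh) :=
  isCompactOperator_convOp _ (integrable_rowMul hh)

theorem continuous_trunc_rowOp {h : ℝ → A} (hh : Integrable h symVol) :
    Continuous fun a => trunc a ∘L rowOp hh :=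
  continuous_comp_of_isCompactOperator norm_trunc_le
    (continuous_trunc_apply ENNReal.one_ne_top) (isCompactOperator_rowOp hh)

/-- The lower bound for the row operators, uniform in the length of the interval and locally
uniform in `h`. -/
theorem exists_row_bound [CompleteSpace A] {h : ℝ → A} (hh : Integrable h symVol)
    (hu : ∀ a, IsUnit (1 + trunc a ∘L rowOp hh)) :
    ∃ M δ : ℝ, 0 < M ∧ 0 < δ ∧ ∀ h' : ℝ → A, ∀ hh' : Integrable h' symVol,
      ∫⁻ u, ‖h' u - h u‖ₑ ∂symVol ≤ ENNReal.ofReal δ → ∀ a ∈ Icc (0 : ℝ) 1,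
        ∀ φ, ‖φ‖ ≤ M * ‖φ + trunc a (rowOp hh' φ)‖ := by
  obtain ⟨M, δ, hM, hδ, hbd⟩ := exists_bound_of_isUnit norm_trunc_le
    (continuous_trunc_apply ENNReal.one_ne_top) (isCompactOperator_rowOp hh) hu
  exact ⟨M, δ, hM, hδ, fun h' hh' hle a ha φ => hbd (rowOp hh')
    ((norm_rowOp_sub_le hh hh').trans (ENNReal.toReal_le_of_le_ofReal hδ.le hle)) a ha φ⟩

end Row

variable {r : ℕ}

/-- The column operator and the row operator are transposes of each other under the pairing (φ, u) ↦
∫ φu. Boundedness of φ makes the double integral absolutely convergent, so that Fubini applies. -/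
theorem integral_matAct_integral_swap {h : ℝ → Mat (Fin r)} (hh : Integrable h symVol)
    {φ : ℝ → Mat (Fin r)} (hφint : Integrable φ unitVol) {C : ℝ}
    (hC : ∀ᵐ x ∂unitVol, ‖φ x‖ ≤ C) {u : ℝ → EuclideanSpace ℂ (Fin r)}
    (huint : Integrable u unitVol) :
    Integrable (fun t => matAct r (∫ x, φ x * h (x - t) ∂unitVol) (u t)) unitVol ∧
    ∫ x, matAct r (φ x) (∫ t, matAct r (h (x - t)) (u t) ∂unitVol) ∂unitVol =
      ∫ t, matAct r (∫ x, φ x * h (x - t) ∂unitVol) (u t) ∂unitVol := by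
  have hprod : Integrable (fun z : ℝ × ℝ => matAct r (φ z.1) (matAct r (h (z.1 - z.2)) (u z.2)))
      (unitVol.prod unitVol) := by
    have hk := isSchurKernel_sub (integrable_matAct hh)
    have hm := hk.aestronglyMeasurable_apply huint.1
    have hi : Integrable (fun z : ℝ × ℝ => matAct r (h (z.1 - z.2)) (u z.2))
        (unitVol.prod unitVol) := by
      refine ⟨hm, ?_⟩
      have := hk.lintegral_rpow_le huint.1 le_rfl ENNReal.one_ne_top
      simp only [ENNReal.toReal_one, ENNReal.rpow_one] at this
      rw [hasFiniteIntegral_iff_enorm, lintegral_prod _ hm.enorm]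
      refine lt_of_le_of_lt (le_trans (lintegral_mono fun x => lintegral_mono fun y => ?_) this)
        (ENNReal.mul_lt_top (integrable_matAct hh).2
          (memLp_one_iff_integrable.2 huint).2)
      exact (matAct r (h (x - y))).le_opENorm (u y)
    refine Integrable.mono' (hi.norm.const_mul C)
      (isBoundedBilinearMap_apply.continuous.comp_aestronglyMeasurable
        (((matAct r).continuous.comp_aestronglyMeasurable hφint.1.comp_fst).prodMk hm)) ?_
    filter_upwards [Measure.quasiMeasurePreserving_fst.ae hC] with z hz
    refine ((matAct r (φ z.1)).le_opNorm _).trans ?_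
    rw [norm_matAct]
    gcongr
  have hinner : ∀ᵐ t ∂unitVol, ∫ x, matAct r (φ x) (matAct r (h (x - t)) (u t)) ∂unitVol =
      matAct r (∫ x, φ x * h (x - t) ∂unitVol) (u t) := by
    filter_upwards [(isSchurKernel_sub (integrable_rowMul hh)).ae_integrable
      (integrable_rowMul hh).2.ne le_rfl ENNReal.one_ne_top
      (memLp_one_iff_integrable.2 hφint)] with t ht
    simp only [rowMul_apply, neg_sub] at ht
    have := ((ContinuousLinearMap.apply ℂ (EuclideanSpace ℂ (Fin r)) (u t)).comp
      (matAct r)).integral_comp_comm ht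
    simp only [ContinuousLinearMap.comp_apply, ContinuousLinearMap.apply_apply] at this
    rw [← this]
    refine integral_congr_ae (Eventually.of_forall fun x => ?_)
    simp only [matAct_mul, ContinuousLinearMap.comp_apply]
  refine ⟨hprod.integral_prod_right.congr hinner, ?_⟩
  calc _ = ∫ x, ∫ t, matAct r (φ x) (matAct r (h (x - t)) (u t)) ∂unitVol ∂unitVol := by
          refine integral_congr_ae ?_
          filter_upwards [(isSchurKernel_sub (integrable_matAct hh)).ae_integrable
            (integrable_matAct hh).2.ne le_rfl ENNReal.one_ne_top
            (memLp_one_iff_integrable.2 huint)] with x hx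
          exact ((matAct r (φ x)).integral_comp_comm hx).symm
      _ = ∫ t, ∫ x, matAct r (φ x) (matAct r (h (x - t)) (u t)) ∂unitVol ∂unitVol :=
          integral_integral_swap hprod
      _ = _ := integral_congr_ae hinner

/-- For an accelerant `h` the equation `φ(t) + ∫_0^a φ(s) h(s-t) ds = 0` has only the zero
solution in `L_1`. -/
theorem IsAccelerant.row_injective {h : ℝ → Mat (Fin r)} (hacc : IsAccelerant h)
    (a : ℝ) (φ : Lp (Mat (Fin r)) 1 unitVol)
    (hφ : φ + trunc a (rowOp hacc.integrable φ) = 0) : φ = 0 := by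
  have hh := hacc.integrable
  have hrow := row_eq_ae hh hφ
  have hbdd := row_memLp hh hφ
  have hφint : Integrable φ unitVol := hbdd.integrable le_top
  obtain ⟨C, hC⟩ : ∃ C : ℝ, ∀ᵐ x ∂unitVol, ‖φ x‖ ≤ C := by
    refine ⟨(eLpNorm φ ∞ unitVol).toReal, ?_⟩
    filter_upwards [ae_le_eLpNormEssSup (f := φ) (μ := unitVol)] with x hx
    rw [← toReal_enorm]
    exact ENNReal.toReal_mono hbdd.2.ne hx
  suffices hv : ∀ v : EuclideanSpace ℂ (Fin r), ∀ᵐ x ∂unitVol, matAct r (φ x) v = 0 by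
    rw [Lp.eq_zero_iff_ae_eq_zero]
    have hall : ∀ᵐ x ∂unitVol, ∀ i, matAct r (φ x) (EuclideanSpace.basisFun (Fin r) ℂ i) = 0 :=
      (ae_all_iff).2 fun i => hv _
    filter_upwards [hall] with x hx
    refine matAct_injective ?_
    rw [Pi.zero_apply, map_zero]
    exact ContinuousLinearMap.coe_injective
      ((EuclideanSpace.basisFun (Fin r) ℂ).toBasis.ext fun i => by simpa using hx i)
  intro v
  have happ : ∀ {f : ℝ → EuclideanSpace ℂ (Fin r)}, Integrable f unitVol →
      Integrable (fun x => matAct r (φ x) (f x)) unitVol := fun {f} hf => by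
    refine Integrable.mono' (hf.norm.const_mul C)
      (isBoundedBilinearMap_apply.continuous.comp_aestronglyMeasurable
        (((matAct r).continuous.comp_aestronglyMeasurable hφint.1).prodMk hf.1)) ?_
    filter_upwards [hC] with x hx
    refine ((matAct r (φ x)).le_opNorm _).trans ?_
    rw [norm_matAct]
    gcongr
  refine Integrable.ae_eq_zero_of_forall_setIntegral_eq_zero (happ (integrable_const v))
    fun s hs _ => ?_
  have hmemf : MemLp ((s ∩ Iio a).indicator fun _ => v) 2 unitVol :=
    (memLp_const v).indicator (hs.inter measurableSet_Iio)
  set f := hmemf.toLp _ with hf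
  -- Surjectivity of the column operator supplies u with (1 + P_a C)u equal to the test function.
  -- Moving C to the other side of the pairing then produces the row equation for φ.
  obtain ⟨u, hu⟩ : ∃ u, u + trunc a (colOp hh u) = f := exists_add_apply_eq (hacc.isUnit a) f
  have hueq : ∀ᵐ x ∂unitVol, (s ∩ Iio a).indicator (fun _ => v) x = u x +
      (Iio a).indicator (fun x => ∫ t, matAct r (h (x - t)) (u t) ∂unitVol) x := by
    filter_upwards [Lp.coeFn_add u (trunc a (colOp hh u)), trunc_coeFn a (colOp hh u),
      colOp_coeFn hh u, hmemf.coeFn_toLp] with x h1 h2 h3 h4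
    rw [← h4, ← hf, ← hu, h1, Pi.add_apply, h2]
    by_cases hx : x ∈ Iio a
    · rw [indicator_of_mem hx, indicator_of_mem hx, h3]
    · rw [indicator_of_notMem hx, indicator_of_notMem hx]
  have huint : Integrable u unitVol := (Lp.memLp u).integrable one_le_two
  have hcint : Integrable (fun x => ∫ t, matAct r (h (x - t)) (u t) ∂unitVol) unitVol :=
    ((Lp.memLp (colOp hh u)).integrable one_le_two).congr (colOp_coeFn hh u)
  obtain ⟨hrint, hswap⟩ := integral_matAct_integral_swap hh hφint hC huint
  have h1 : ∫ x in s, matAct r (φ x) v ∂unitVol =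
      ∫ x, (matAct r (φ x) (u x) +
        matAct r (φ x) (∫ t, matAct r (h (x - t)) (u t) ∂unitVol)) ∂unitVol := by
    rw [← integral_indicator hs]
    refine integral_congr_ae ?_
    filter_upwards [hueq, hrow] with x hx hr
    by_cases hxa : x ∈ Iio a
    · rw [indicator_of_mem hxa] at hx
      rw [← map_add, ← hx]
      by_cases hxs : x ∈ s
      · rw [indicator_of_mem hxs, indicator_of_mem (show x ∈ s ∩ Iio a from ⟨hxs, hxa⟩)]
      · rw [indicator_of_notMem hxs, indicator_of_notMem (fun h' => hxs h'.1), map_zero]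
    -- Beyond a the row φ vanishes, so nothing is lost by testing only on s ∩ (−∞,a).
    · rw [indicator_of_notMem hxa, neg_zero] at hr
      by_cases hxs : x ∈ s
      · rw [indicator_of_mem hxs, hr]
        simp
      · rw [indicator_of_notMem hxs, hr]
        simp
  -- After the swap the integrand is (φ + ∫ φ(s) h(s−t) ds) u(t): the first factor vanishes for t <
  -- a by the row equation, and beyond a both φ and u vanish.
  rw [h1, integral_add (happ huint) (happ hcint), hswap, ← integral_add (happ huint)]
  · refine integral_eq_zero_of_ae ?_
    filter_upwards [hrow, hueq] with t ht hut
    rw [Pi.zero_apply]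
    by_cases hta : t ∈ Iio a
    · rw [indicator_of_mem hta] at ht
      rw [← add_apply, ← map_add, ht, neg_add_cancel, map_zero]
      rfl
    · rw [indicator_of_notMem hta, indicator_of_notMem (fun h' => hta h'.2), add_zero] at hut
      rw [← hut, map_zero, map_zero, add_zero]
  · exact hrint

theorem IsAccelerant.isUnit_row {h : ℝ → Mat (Fin r)} (hacc : IsAccelerant h) (a : ℝ) :
    IsUnit (1 + trunc a ∘L rowOp hacc.integrable) :=
  isUnit_one_add_of_isCompactOperator
    ((isCompactOperator_rowOp hacc.integrable).clm_comp (trunc a)) (hacc.row_injective a)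

/-! ### Bounds for the columns of solutions of the Krein equation -/

section Columns

variable {X Y : Type*} [MeasurableSpace X] [MeasurableSpace Y] {μ : Measure X} {ν : Measure Y}

/-- Passing from iterated null sets to a product null set needs a measurable exceptional set, which
measurable modifications provide. It is what lets an estimate known row by row be used column by
column. -/
theorem ae_prod_le_of_ae_ae_le [SFinite ν] {f g : X × Y → ℝ≥0∞}
    (hf : AEMeasurable f (μ.prod ν)) (hg : AEMeasurable g (μ.prod ν))
    (h : ∀ᵐ x ∂μ, ∀ᵐ y ∂ν, f (x, y) ≤ g (x, y)) : ∀ᵐ z ∂μ.prod ν, f z ≤ g z := by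
  have hmk : ∀ᵐ z ∂μ.prod ν, hf.mk f z ≤ hg.mk g z := by
    refine (Measure.ae_prod_iff_ae_ae
      (measurableSet_le hf.measurable_mk hg.measurable_mk)).2 ?_
    filter_upwards [h, Measure.ae_ae_of_ae_prod hf.ae_eq_mk, Measure.ae_ae_of_ae_prod hg.ae_eq_mk]
      with x h1 h2 h3
    filter_upwards [h1, h2, h3] with y h1 h2 h3
    rwa [← h2, ← h3]
  filter_upwards [hmk, hf.ae_eq_mk, hg.ae_eq_mk] with z h1 h2 h3
  rwa [h2, h3]

theorem ae_ae_swap_of_ae_prod [SFinite μ] [SFinite ν] {P : X × Y → Prop}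
    (h : ∀ᵐ z ∂μ.prod ν, P z) : ∀ᵐ y ∂ν, ∀ᵐ x ∂μ, P (x, y) := by
  have : ∀ᵐ z ∂ν.prod μ, P z.swap :=
    (Measure.measurePreserving_swap (μ := ν) (ν := μ)).quasiMeasurePreserving.ae h
  exact Measure.ae_ae_of_ae_prod this

theorem aemeasurable_lintegral_mul [SFinite μ] [SFinite ν] {d : X → Y → ℝ≥0∞}
    {κ : Y → Y → ℝ≥0∞} (hd : AEMeasurable (fun z : X × Y => d z.1 z.2) (μ.prod ν))
    (hκ : AEMeasurable (fun z : Y × Y => κ z.1 z.2) (ν.prod ν)) :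
    AEMeasurable (fun z : X × Y => ∫⁻ s, d z.1 s * κ s z.2 ∂ν) (μ.prod ν) := by
  obtain ⟨d', hd', hdd⟩ := hd
  obtain ⟨κ', hκ', hκκ⟩ := hκ
  refine ⟨fun z => ∫⁻ s, d' (z.1, s) * κ' (s, z.2) ∂ν, ?_, ?_⟩
  · exact Measurable.lintegral_prod_right' (f := fun w : (X × Y) × Y =>
      d' (w.1.1, w.2) * κ' (w.2, w.1.2)) (by fun_prop)
  · filter_upwards [Measure.quasiMeasurePreserving_fst.ae (Measure.ae_ae_of_ae_prod hdd),
      Measure.quasiMeasurePreserving_snd.ae (ae_ae_swap_of_ae_prod hκκ)] with z h1 h2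
    refine lintegral_congr_ae ?_
    filter_upwards [h1, h2] with s h1 h2
    rw [← h1, ← h2]

/-- The `L_q` norms of the columns of `d`, if `d` is bounded by `F` plus its image under a kernel
with small marginals that acts on the rows. -/
theorem ae_lintegral_column_rpow_le [SFinite μ] [SFinite ν] {d F : X → Y → ℝ≥0∞}
    {κ : Y → Y → ℝ≥0∞} (hd : AEMeasurable (fun z : X × Y => d z.1 z.2) (μ.prod ν))
    (hF : AEMeasurable (fun z : X × Y => F z.1 z.2) (μ.prod ν))
    (hκ : AEMeasurable (fun z : Y × Y => κ z.1 z.2) (ν.prod ν)) {q : ℝ} (hq : 1 ≤ q)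
    (h₁ : ∀ᵐ s ∂ν, ∫⁻ t, κ s t ∂ν ≤ 2⁻¹) (h₂ : ∀ᵐ t ∂ν, ∫⁻ s, κ s t ∂ν ≤ 2⁻¹)
    (hfin : ∫⁻ x, ∫⁻ t, d x t ^ q ∂ν ∂μ ≠ ∞) {Z : ℝ≥0∞}
    (hZ : ∀ᵐ t ∂ν, ∫⁻ x, F x t ^ q ∂μ ≤ Z)
    (h : ∀ᵐ x ∂μ, ∀ᵐ t ∂ν, d x t ≤ F x t + ∫⁻ s, d x s * κ s t ∂ν) :
    ∀ᵐ t ∂ν, ∫⁻ x, d x t ^ q ∂μ ≤ 2 * (2 ^ (q - 1) * Z) := by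
  have hq1 : 0 ≤ q - 1 := by linarith
  have hdq : AEMeasurable (fun z : X × Y => d z.1 z.2 ^ q) (μ.prod ν) := hd.pow_const q
  -- The convexity factor 2^(q−1) is cancelled exactly by the factor (1/2)^(q−1) that Jensen gives
  -- for the weight κ(·,t) of mass at most 1/2. Hence d^q satisfies an inequality with the same
  -- kernel κ and coefficient 1.
  have hstep : ∀ᵐ x ∂μ, ∀ᵐ t ∂ν,
      d x t ^ q ≤ 2 ^ (q - 1) * F x t ^ q + ∫⁻ s, d x s ^ q * κ s t ∂ν := by
    filter_upwards [h, ae_aemeasurable_left hd] with x hx hdx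
    filter_upwards [hx, h₂, ae_aemeasurable_right hκ] with t ht h2 hκt
    calc d x t ^ q ≤ (F x t + ∫⁻ s, d x s * κ s t ∂ν) ^ q := by gcongr
      _ ≤ 2 ^ (q - 1) * (F x t ^ q + (∫⁻ s, d x s * κ s t ∂ν) ^ q) :=
        ENNReal.rpow_add_le_mul_rpow_add_rpow _ _ hq
      _ ≤ 2 ^ (q - 1) * (F x t ^ q + (2⁻¹) ^ (q - 1) * ∫⁻ s, d x s ^ q * κ s t ∂ν) := by
        gcongr
        simp only [mul_comm (d x _), mul_comm (d x _ ^ q)]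
        exact (rpow_lintegral_mul_le hκt hdx hq).trans (by gcongr)
      _ = _ := by
        rw [mul_add, ← mul_assoc (2 ^ (q - 1)) ((2⁻¹) ^ (q - 1)),
          ← ENNReal.mul_rpow_of_nonneg _ _ hq1,
          ENNReal.mul_inv_cancel two_ne_zero ENNReal.ofNat_ne_top, ENNReal.one_rpow, one_mul]
  have hrhs : AEMeasurable (fun z : X × Y => 2 ^ (q - 1) * F z.1 z.2 ^ q +
      ∫⁻ s, d z.1 s ^ q * κ s z.2 ∂ν) (μ.prod ν) :=
    ((hF.pow_const q).const_mul _).add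
      (aemeasurable_lintegral_mul (d := fun x s => d x s ^ q) hdq hκ)
  have hprod : ∀ᵐ t ∂ν, ∀ᵐ x ∂μ,
      d x t ^ q ≤ 2 ^ (q - 1) * F x t ^ q + ∫⁻ s, d x s ^ q * κ s t ∂ν :=
    ae_ae_swap_of_ae_prod (ae_prod_le_of_ae_ae_le hdq hrhs hstep)
  have hc : AEMeasurable (fun t => ∫⁻ x, d x t ^ q ∂μ) ν :=
    AEMeasurable.lintegral_prod_right' (f := fun z : Y × X => d z.2 z.1 ^ q) hdq.prod_swap
  -- Integrated in x, the inequality becomes a scalar one for t ↦ ∫ d(x,t)^q dx, with the kernel κ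
  -- unchanged.
  refine ae_le_two_mul_of_le_add_lintegral hκ hc ?_ h₁ h₂ ?_
  · rwa [← lintegral_lintegral_swap hdq]
  · filter_upwards [hprod, hZ, ae_aemeasurable_right hF, ae_aemeasurable_right hκ]
      with t ht hZt hFt hκt
    have hdκ : AEMeasurable (fun z : X × Y => d z.1 z.2 ^ q * κ z.2 t) (μ.prod ν) :=
      hdq.mul hκt.comp_snd
    calc ∫⁻ x, d x t ^ q ∂μ
        ≤ ∫⁻ x, (2 ^ (q - 1) * F x t ^ q + ∫⁻ s, d x s ^ q * κ s t ∂ν) ∂μ := lintegral_mono_ae ht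
      _ = 2 ^ (q - 1) * ∫⁻ x, F x t ^ q ∂μ + ∫⁻ s, ∫⁻ x, d x s ^ q * κ s t ∂μ ∂ν := by
        rw [lintegral_add_left' ((hFt.pow_const q).const_mul _),
          lintegral_const_mul'' _ (hFt.pow_const q), lintegral_lintegral_swap hdκ]
      _ ≤ 2 ^ (q - 1) * Z + ∫⁻ s, (∫⁻ x, d x s ^ q ∂μ) * κ s t ∂ν := by
        refine add_le_add (by gcongr) (lintegral_mono_ae ?_)
        filter_upwards [ae_aemeasurable_right (κ := fun x s => d x s ^ q) hdq] with s hs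
        rw [lintegral_mul_const'' _ hs]

end Columns

/-! ### Row equations, and the difference of two solutions -/

section Solutions

variable {A : Type*} [NormedRing A] [NormedAlgebra ℂ A]

/-- The Krein equation for a single row `φ = R(x,·)`, extended by zero beyond `x`. -/
def RowEquation (h : ℝ → A) (x : ℝ) (φ : ℝ → A) : Prop :=
  ∀ᵐ t ∂unitVol, φ t =
    -(Iio x).indicator (fun t => h (x - t) + ∫ s, φ s * h (s - t) ∂unitVol) t

omit [NormedAlgebra ℂ A] in
theorem lintegral_mul_sub_le {φ d : ℝ → A} (hφ : AEStronglyMeasurable φ unitVol)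
    (hd : AEStronglyMeasurable d symVol) :
    ∫⁻ t, ∫⁻ s, ‖φ s‖ₑ * ‖d (s - t)‖ₑ ∂unitVol ∂unitVol ≤
      (∫⁻ s, ‖φ s‖ₑ ∂unitVol) * ∫⁻ u, ‖d u‖ₑ ∂symVol := by
  have hm : AEMeasurable (fun z : ℝ × ℝ => ‖φ z.1‖ₑ * ‖d (z.1 - z.2)‖ₑ) (unitVol.prod unitVol) :=
    hφ.enorm.comp_fst.mul
      (hd.comp_quasiMeasurePreserving quasiMeasurePreserving_sub_unitVol).enorm
  rw [← lintegral_lintegral_swap hm, ← lintegral_mul_const'' _ hφ.enorm]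
  refine lintegral_mono_ae ?_
  filter_upwards [ae_unitVol_mem] with s hs
  rw [lintegral_const_mul' _ _ (by simp)]
  refine mul_le_mul' le_rfl ?_
  exact lintegral_sub_left_le (fun u => ‖d u‖ₑ) (Ioo_subset_Icc_self hs)

theorem enorm_integral_mul_le_lintegral (φ d : ℝ → A) (t : ℝ) :
    ‖∫ s, φ s * d (s - t) ∂unitVol‖ₑ ≤ ∫⁻ s, ‖φ s‖ₑ * ‖d (s - t)‖ₑ ∂unitVol := by
  refine (enorm_integral_le_lintegral_enorm _).trans (lintegral_mono fun s => ?_)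
  simp only [enorm_eq_nnnorm]
  exact_mod_cast nnnorm_mul_le _ _

theorem ae_integrable_mul_sub {φ d : ℝ → A} (hφ : Integrable φ unitVol)
    (hd : Integrable d symVol) :
    ∀ᵐ t ∂unitVol, Integrable (fun s => φ s * d (s - t)) unitVol := by
  filter_upwards [(isSchurKernel_sub (integrable_rowMul hd)).ae_integrable
    (integrable_rowMul hd).2.ne le_rfl ENNReal.one_ne_top
    (memLp_one_iff_integrable.2 hφ)] with t ht
  simpa only [rowMul_apply, neg_sub] using ht

/-- The splitting φ₁h₁ − φ₂h₂ = φ₂(h₁ − h₂) + (φ₁ − φ₂)h₁ leaves the unknown difference under the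
operator of h₁ alone, with a source term linear in h₁ − h₂. -/
theorem RowEquation.sub {h₁ h₂ : ℝ → A} (hh₁ : Integrable h₁ symVol) (hh₂ : Integrable h₂ symVol)
    {x : ℝ} {φ₁ φ₂ : ℝ → A} (hφ₁ : Integrable φ₁ unitVol) (hφ₂ : Integrable φ₂ unitVol)
    (e₁ : RowEquation h₁ x φ₁) (e₂ : RowEquation h₂ x φ₂) :
    ∀ᵐ t ∂unitVol, φ₁ t - φ₂ t = -(Iio x).indicator (fun t => (h₁ (x - t) - h₂ (x - t)) +
      ∫ s, φ₂ s * (h₁ (s - t) - h₂ (s - t)) ∂unitVol +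
      ∫ s, (φ₁ s - φ₂ s) * h₁ (s - t) ∂unitVol) t := by
  filter_upwards [e₁, e₂, ae_integrable_mul_sub hφ₁ hh₁, ae_integrable_mul_sub hφ₂ hh₁,
    ae_integrable_mul_sub hφ₂ hh₂] with t h1 h2 i11 i21 i22
  rw [h1, h2]
  by_cases ht : t ∈ Iio x
  · simp only [indicator_of_mem ht, mul_sub, sub_mul]
    rw [integral_sub i21 i22, integral_sub i11 i21]
    abel
  · simp only [indicator_of_notMem ht, neg_zero, sub_zero]

omit [NormedAlgebra ℂ A] in
theorem enorm_neg_indicator_le {f : ℝ → A} {s : Set ℝ} (t : ℝ) :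
    ‖-s.indicator f t‖ₑ ≤ ‖f t‖ₑ := by
  rw [enorm_neg]
  exact enorm_indicator_le_enorm_self _ _

/-- The `L_1` bound for the difference of two rows. -/
theorem RowEquation.lintegral_sub_le {h₁ h₂ : ℝ → A} (hh₁ : Integrable h₁ symVol)
    (hh₂ : Integrable h₂ symVol) {x : ℝ} (hx : x ∈ Icc (0 : ℝ) 1) {φ₁ φ₂ : ℝ → A}
    (hφ₁ : Integrable φ₁ unitVol) (hφ₂ : Integrable φ₂ unitVol) (e₁ : RowEquation h₁ x φ₁)
    (e₂ : RowEquation h₂ x φ₂) {M : ℝ} (hM : 0 ≤ M)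
    (hbd : ∀ φ, ‖φ‖ ≤ M * ‖φ + trunc x (rowOp hh₁ φ)‖) :
    ∫⁻ t, ‖φ₁ t - φ₂ t‖ₑ ∂unitVol ≤ ENNReal.ofReal M *
      ((1 + ∫⁻ s, ‖φ₂ s‖ₑ ∂unitVol) * ∫⁻ u, ‖h₁ u - h₂ u‖ₑ ∂symVol) := by
  have hψ : MemLp (fun t => φ₁ t - φ₂ t) 1 unitVol := memLp_one_iff_integrable.2 (hφ₁.sub hφ₂)
  set ψ := hψ.toLp _ with hψdef
  have hd : Integrable (fun u => h₁ u - h₂ u) symVol := hh₁.sub hh₂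
  have h1 : ∫⁻ t, ‖φ₁ t - φ₂ t‖ₑ ∂unitVol = ‖ψ‖ₑ := by
    rw [Lp.enorm_toLp, eLpNorm_one_eq_lintegral_enorm]
  -- The image of ψ is the cut-off source term: the 1 comes from the translate of h₁ − h₂, the other
  -- summand from its product with the row φ₂.
  have h2 : ‖ψ + trunc x (rowOp hh₁ ψ)‖ₑ ≤
      (1 + ∫⁻ s, ‖φ₂ s‖ₑ ∂unitVol) * ∫⁻ u, ‖h₁ u - h₂ u‖ₑ ∂symVol := by
    rw [Lp.enorm_def, eLpNorm_one_eq_lintegral_enorm]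
    calc ∫⁻ t, ‖(ψ + trunc x (rowOp hh₁ ψ)) t‖ₑ ∂unitVol
        ≤ ∫⁻ t, (‖h₁ (x - t) - h₂ (x - t)‖ₑ +
          ∫⁻ s, ‖φ₂ s‖ₑ * ‖h₁ (s - t) - h₂ (s - t)‖ₑ ∂unitVol) ∂unitVol := by
          refine lintegral_mono_ae ?_
          filter_upwards [Lp.coeFn_add ψ (trunc x (rowOp hh₁ ψ)), trunc_coeFn x (rowOp hh₁ ψ),
            rowOp_coeFn hh₁ ψ, hψ.coeFn_toLp, RowEquation.sub hh₁ hh₂ hφ₁ hφ₂ e₁ e₂]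
            with t ha hb hc he hf
          have hg : ∫ s, ψ s * h₁ (s - t) ∂unitVol =
              ∫ s, (φ₁ s - φ₂ s) * h₁ (s - t) ∂unitVol := by
            refine integral_congr_ae ?_
            filter_upwards [hψ.coeFn_toLp] with s hs
            rw [hψdef, hs]
          have : (ψ + trunc x (rowOp hh₁ ψ)) t =
              -(Iio x).indicator (fun t => (h₁ (x - t) - h₂ (x - t)) +
              ∫ s, φ₂ s * (h₁ (s - t) - h₂ (s - t)) ∂unitVol) t := by
            rw [ha, Pi.add_apply, hb, hψdef, he, hf, ← hψdef]
            by_cases ht : t ∈ Iio x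
            · simp only [indicator_of_mem ht, hc, hg]
              abel
            · simp only [indicator_of_notMem ht, neg_zero, add_zero]
          rw [this]
          refine (enorm_neg_indicator_le t).trans ((enorm_add_le _ _).trans ?_)
          gcongr
          exact enorm_integral_mul_le_lintegral φ₂ (fun u => h₁ u - h₂ u) t
      _ = ∫⁻ t, ‖h₁ (x - t) - h₂ (x - t)‖ₑ ∂unitVol + ∫⁻ t, ∫⁻ s, ‖φ₂ s‖ₑ *
          ‖h₁ (s - t) - h₂ (s - t)‖ₑ ∂unitVol ∂unitVol :=
          lintegral_add_left' (aestronglyMeasurable_comp_sub_left hd.1 hx).enorm _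
      _ ≤ _ := by
          rw [add_mul, one_mul]
          refine add_le_add ?_ ?_
          · exact lintegral_sub_left_le (fun u => ‖h₁ u - h₂ u‖ₑ) hx
          · exact lintegral_mul_sub_le hφ₂.1 hd.1
  rw [h1]
  calc ‖ψ‖ₑ = ENNReal.ofReal ‖ψ‖ := (ofReal_norm ψ).symm
    _ ≤ ENNReal.ofReal (M * ‖ψ + trunc x (rowOp hh₁ ψ)‖) := ENNReal.ofReal_le_ofReal (hbd ψ)
    _ = ENNReal.ofReal M * ‖ψ + trunc x (rowOp hh₁ ψ)‖ₑ := by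
        rw [ENNReal.ofReal_mul hM, ofReal_norm]
    _ ≤ _ := by gcongr

/-- `R` is a measurable function on the unit square with finite `L_q` norm, and almost all its
rows solve the Krein equation. -/
structure IsRowSolution (q : ℝ) (h : ℝ → A) (R : ℝ → ℝ → A) : Prop where
  aestronglyMeasurable : AEStronglyMeasurable (fun z : ℝ × ℝ => R z.1 z.2) (unitVol.prod unitVol)
  integrable : ∀ᵐ x ∂unitVol, Integrable (R x) unitVol
  finite : ∫⁻ x, ∫⁻ t, ‖R x t‖ₑ ^ q ∂unitVol ∂unitVol ≠ ∞
  equation : ∀ᵐ x ∂unitVol, RowEquation h x (R x)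

/-- Comparison with this solution turns estimates for differences into bounds for a single solution.
-/
theorem isRowSolution_zero {q : ℝ} (hq : 1 ≤ q) : IsRowSolution (A := A) q 0 0 where
  aestronglyMeasurable := aestronglyMeasurable_const (b := (0 : A))
  integrable := Eventually.of_forall fun _ => integrable_zero _ _ _
  finite := by simp [show 0 < q by linarith]
  equation := Eventually.of_forall fun x => Eventually.of_forall fun t => by simp

/-- The constant in the bound for the columns. -/
def columnConst (q : ℝ) (M N a b : ℝ≥0∞) : ℝ≥0∞ :=
  2 * (2 ^ (q - 1) * (2 ^ (q - 1) * (2 ^ (q - 1) * (1 + a ^ (q - 1) * b) +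
    (N * (M * (1 + a))) ^ q * 2 ^ (q - 1))))

theorem columnConst_ne_top {q : ℝ} (hq : 1 ≤ q) {M N a b : ℝ≥0∞} (hM : M ≠ ∞) (hN : N ≠ ∞)
    (ha : a ≠ ∞) (hb : b ≠ ∞) : columnConst q M N a b ≠ ∞ := by
  have h2 : (2 : ℝ≥0∞) ^ (q - 1) ≠ ∞ :=
    ENNReal.rpow_ne_top_of_nonneg (by linarith) ENNReal.ofNat_ne_top
  have ha' : a ^ (q - 1) ≠ ∞ := ENNReal.rpow_ne_top_of_nonneg (by linarith) ha
  have h3 : (N * (M * (1 + a))) ^ q ≠ ∞ := ENNReal.rpow_ne_top_of_nonneg (by linarith)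
    (ENNReal.mul_ne_top hN (ENNReal.mul_ne_top hM (ENNReal.add_ne_top.2 ⟨ENNReal.one_ne_top, ha⟩)))
  exact ENNReal.mul_ne_top ENNReal.ofNat_ne_top (ENNReal.mul_ne_top h2 (ENNReal.mul_ne_top h2
    (ENNReal.add_ne_top.2 ⟨ENNReal.mul_ne_top h2 (ENNReal.add_ne_top.2
      ⟨ENNReal.one_ne_top, ENNReal.mul_ne_top ha' hb⟩), ENNReal.mul_ne_top h3 h2⟩)))

omit [NormedAlgebra ℂ A] in
-- Jensen with weight 1; the base 2 is the length of (−1,1).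
theorem rpow_lintegral_symVol_le {d : ℝ → A} (hd : AEStronglyMeasurable d symVol) {q : ℝ}
    (hq : 1 ≤ q) :
    (∫⁻ u, ‖d u‖ₑ ∂symVol) ^ q ≤ 2 ^ (q - 1) * ∫⁻ u, ‖d u‖ₑ ^ q ∂symVol := by
  have := rpow_lintegral_mul_le (w := fun _ => 1) aemeasurable_const hd.enorm hq
  simp only [one_mul, lintegral_const, Measure.restrict_apply MeasurableSet.univ, univ_inter,
    Real.volume_Ioo] at this
  norm_num at this
  exact this

/-- The columns of the difference of two solutions of Krein equations. -/
theorem IsRowSolution.column_sub_le {q : ℝ} (hq : 1 ≤ q) {h₁ h₂ g : ℝ → A}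
    (hh₁ : Integrable h₁ symVol) (hh₂ : Integrable h₂ symVol) (hg : Integrable g symVol)
    {R₁ R₂ : ℝ → ℝ → A} (hR₁ : IsRowSolution q h₁ R₁) (hR₂ : IsRowSolution q h₂ R₂)
    {M : ℝ} (hM : 0 ≤ M)
    (hbd : ∀ x ∈ Icc (0 : ℝ) 1, ∀ φ, ‖φ‖ ≤ M * ‖φ + trunc x (rowOp hh₁ φ)‖)
    {N : ℝ≥0∞} (hgN : ∀ u, ‖g u‖ₑ ≤ N) (hsmall : ∫⁻ u, ‖h₁ u - g u‖ₑ ∂symVol ≤ 2⁻¹)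
    {a b : ℝ≥0∞} (ha : ∀ᵐ x ∂unitVol, ∫⁻ s, ‖R₂ x s‖ₑ ∂unitVol ≤ a)
    (hb : ∀ᵐ s ∂unitVol, ∫⁻ x, ‖R₂ x s‖ₑ ∂unitVol ≤ b) :
    ∀ᵐ t ∂unitVol, ∫⁻ x, ‖R₁ x t - R₂ x t‖ₑ ^ q ∂unitVol ≤
      columnConst q (ENNReal.ofReal M) N a b * ∫⁻ u, ‖h₁ u - h₂ u‖ₑ ^ q ∂symVol := by
  have hd : Integrable (fun u => h₁ u - h₂ u) symVol := hh₁.sub hh₂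
  have hq0 : 0 ≤ q := by linarith
  set Δ := ∫⁻ u, ‖h₁ u - h₂ u‖ₑ ∂symVol with hΔ
  set D := ∫⁻ u, ‖h₁ u - h₂ u‖ₑ ^ q ∂symVol with hD
  have hdm : AEMeasurable (fun z : ℝ × ℝ => ‖h₁ (z.1 - z.2) - h₂ (z.1 - z.2)‖ₑ)
      (unitVol.prod unitVol) := aemeasurable_enorm_sub hd
  have hKm : AEMeasurable (fun z : ℝ × ℝ =>
      ∫⁻ s, ‖R₂ z.1 s‖ₑ * ‖h₁ (s - z.2) - h₂ (s - z.2)‖ₑ ∂unitVol) (unitVol.prod unitVol) :=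
    aemeasurable_lintegral_mul (d := fun x s => ‖R₂ x s‖ₑ) (κ := fun s t => ‖h₁ (s - t) - h₂ (s - t)‖ₑ)
      hR₂.aestronglyMeasurable.enorm hdm
  -- Split h₁ = g + (h₁ − g) in the term containing the unknown difference. The kernel κ carries the
  -- small part; F collects the two source terms and the contribution of g, which the row bound
  -- controls. The nested powers of 2 in Z come from applying convexity of the q-th power twice to
  -- these three terms.
  have key := ae_lintegral_column_rpow_le (μ := unitVol) (ν := unitVol)
    (d := fun x t => ‖R₁ x t - R₂ x t‖ₑ)
    (F := fun x t => ‖h₁ (x - t) - h₂ (x - t)‖ₑ +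
      ∫⁻ s, ‖R₂ x s‖ₑ * ‖h₁ (s - t) - h₂ (s - t)‖ₑ ∂unitVol +
      N * (ENNReal.ofReal M * ((1 + a) * Δ)))
    (κ := fun s t => ‖h₁ (s - t) - g (s - t)‖ₑ)
    (Z := 2 ^ (q - 1) * (2 ^ (q - 1) * (1 + a ^ (q - 1) * b) +
    (N * (ENNReal.ofReal M * (1 + a))) ^ q * 2 ^ (q - 1)) * D)
    (hR₁.aestronglyMeasurable.sub hR₂.aestronglyMeasurable).enorm
    ((hdm.add hKm).add_const _) (aemeasurable_enorm_sub (hh₁.sub hg)) hq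
    (by
      filter_upwards [ae_unitVol_mem] with s hs
      exact (lintegral_sub_left_le (fun u => ‖h₁ u - g u‖ₑ) (Ioo_subset_Icc_self hs)).trans hsmall)
    (by
      filter_upwards [ae_unitVol_mem] with s hs
      exact (lintegral_sub_right_le (fun u => ‖h₁ u - g u‖ₑ) (Ioo_subset_Icc_self hs)).trans hsmall)
    ?_ ?_ ?_
  · filter_upwards [key] with t ht
    refine ht.trans_eq ?_
    rw [columnConst]
    ring
  · have hm2 : AEMeasurable (fun z : ℝ × ℝ => ‖R₁ z.1 z.2‖ₑ ^ q) (unitVol.prod unitVol) :=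
      hR₁.aestronglyMeasurable.enorm.pow_const q
    have hm3 : AEMeasurable (fun z : ℝ × ℝ => ‖R₂ z.1 z.2‖ₑ ^ q) (unitVol.prod unitVol) :=
      hR₂.aestronglyMeasurable.enorm.pow_const q
    refine ne_top_of_le_ne_top ?_ (lintegral_mono fun x => lintegral_mono fun t =>
      (ENNReal.rpow_le_rpow (enorm_sub_le (a := R₁ x t) (b := R₂ x t)) hq0).trans
        (ENNReal.rpow_add_le_mul_rpow_add_rpow _ _ hq))
    have hm23 : AEMeasurable (fun z : ℝ × ℝ => ‖R₁ z.1 z.2‖ₑ ^ q + ‖R₂ z.1 z.2‖ₑ ^ q)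
      (unitVol.prod unitVol) := hm2.add hm3
    rw [← lintegral_prod (fun z : ℝ × ℝ => 2 ^ (q - 1) * (‖R₁ z.1 z.2‖ₑ ^ q + ‖R₂ z.1 z.2‖ₑ ^ q))
      (hm23.const_mul _), lintegral_const_mul'' _ hm23]
    refine ENNReal.mul_ne_top (ENNReal.rpow_ne_top_of_nonneg (by linarith) ENNReal.ofNat_ne_top) ?_
    have := lintegral_add_left' hm2 (fun z : ℝ × ℝ => ‖R₂ z.1 z.2‖ₑ ^ q)
    refine (this.trans_ne ?_)
    rw [lintegral_prod _ hm2, lintegral_prod _ hm3]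
    exact ENNReal.add_ne_top.2 ⟨hR₁.finite, hR₂.finite⟩
  · have hswap := ae_aemeasurable_right (κ := fun x t =>
      ∫⁻ s, ‖R₂ x s‖ₑ * ‖h₁ (s - t) - h₂ (s - t)‖ₑ ∂unitVol) hKm
    filter_upwards [ae_unitVol_mem, hswap] with t ht hKt
    have htc := Ioo_subset_Icc_self ht
    have hdt := (aestronglyMeasurable_comp_sub_right hd.1 htc).enorm
    have b1 : ∫⁻ x, ‖h₁ (x - t) - h₂ (x - t)‖ₑ ^ q ∂unitVol ≤ D :=
      lintegral_sub_right_le (fun u => ‖h₁ u - h₂ u‖ₑ ^ q) htc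
    -- The Schur test with |R₂| as the kernel: a bounds its rows, b its columns.
    have b2 : ∫⁻ x, (∫⁻ s, ‖R₂ x s‖ₑ * ‖h₁ (s - t) - h₂ (s - t)‖ₑ ∂unitVol) ^ q ∂unitVol ≤
        a ^ (q - 1) * b * D :=
      (lintegral_rpow_lintegral_mul_le (κ := fun x s => ‖R₂ x s‖ₑ)
        hR₂.aestronglyMeasurable.enorm hdt hq ha hb).trans (by gcongr)
    have b3 : (N * (ENNReal.ofReal M * ((1 + a) * Δ))) ^ q ≤
        (N * (ENNReal.ofReal M * (1 + a))) ^ q * (2 ^ (q - 1) * D) := by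
      rw [← mul_assoc, ← mul_assoc, mul_assoc N, ENNReal.mul_rpow_of_nonneg _ _ hq0]
      gcongr
      exact rpow_lintegral_symVol_le hd.1 hq
    calc _ ≤ ∫⁻ x, (2 ^ (q - 1) * (2 ^ (q - 1) * (‖h₁ (x - t) - h₂ (x - t)‖ₑ ^ q +
          (∫⁻ s, ‖R₂ x s‖ₑ * ‖h₁ (s - t) - h₂ (s - t)‖ₑ ∂unitVol) ^ q) +
          (N * (ENNReal.ofReal M * ((1 + a) * Δ))) ^ q)) ∂unitVol := by
          refine lintegral_mono fun x => ?_
          refine (ENNReal.rpow_add_le_mul_rpow_add_rpow _ _ hq).trans ?_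
          gcongr
          exact ENNReal.rpow_add_le_mul_rpow_add_rpow _ _ hq
      _ = 2 ^ (q - 1) * (2 ^ (q - 1) * (∫⁻ x, ‖h₁ (x - t) - h₂ (x - t)‖ₑ ^ q ∂unitVol +
          ∫⁻ x, (∫⁻ s, ‖R₂ x s‖ₑ * ‖h₁ (s - t) - h₂ (s - t)‖ₑ ∂unitVol) ^ q ∂unitVol) +
          (N * (ENNReal.ofReal M * ((1 + a) * Δ))) ^ q) := by
          have m1 := hdt.pow_const q
          have m2 := hKt.pow_const q
          have m12 : AEMeasurable (fun x => ‖h₁ (x - t) - h₂ (x - t)‖ₑ ^ q +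
              (∫⁻ s, ‖R₂ x s‖ₑ * ‖h₁ (s - t) - h₂ (s - t)‖ₑ ∂unitVol) ^ q) unitVol := m1.add m2
          rw [lintegral_const_mul'' _ ((m12.const_mul _).add_const _),
            lintegral_add_right' _ aemeasurable_const, lintegral_const_mul'' _ m12]
          congr 3
          · rw [← lintegral_add_left' m1]
          · simp
      _ ≤ 2 ^ (q - 1) * (2 ^ (q - 1) * (D + a ^ (q - 1) * b * D) +
          (N * (ENNReal.ofReal M * (1 + a))) ^ q * (2 ^ (q - 1) * D)) := by gcongr
      _ = _ := by ring
  · filter_upwards [hR₁.integrable, hR₂.integrable, hR₁.equation, hR₂.equation, ha, ae_unitVol_mem]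
      with x i1 i2 e1 e2 hax hx
    have hL1 := e1.lintegral_sub_le hh₁ hh₂ (Ioo_subset_Icc_self hx) i1 i2 e2 hM
      (hbd x (Ioo_subset_Icc_self hx))
    filter_upwards [e1.sub hh₁ hh₂ i1 i2 e2] with t ht
    rw [ht]
    refine (enorm_neg_indicator_le t).trans ((enorm_add_le _ _).trans ?_)
    rw [add_assoc (_ + _)]
    refine add_le_add ((enorm_add_le _ _).trans ?_) ?_
    · gcongr
      exact enorm_integral_mul_le_lintegral (R₂ x) (fun u => h₁ u - h₂ u) t
    -- The bounded part g costs N times the L_1 norm of the row of the difference, which `hL1` has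
    -- already estimated.
    · refine (enorm_integral_mul_le hgN (i1.sub i2).1 t).trans ?_
      refine add_le_add (mul_le_mul' le_rfl (hL1.trans ?_)) le_rfl
      gcongr

end Solutions

/-! ### Uniqueness and Lipschitz dependence of solutions of the Krein equation -/

section Continuity

variable {F : Type*} [NormedAddCommGroup F] {p : ℝ≥0∞}

/-- A set of full measure in (0,1) is dense in [0,1]. The endpoints are included, which is how the
null set t = 0 is reached later. -/
theorem frequently_nhdsWithin_of_ae_unitVol {P : ℝ → Prop} (h : ∀ᵐ x ∂unitVol, P x) {x₀ : ℝ}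
    (hx₀ : x₀ ∈ Icc (0 : ℝ) 1) : ∃ᶠ x in 𝓝[Icc (0 : ℝ) 1] x₀, P x := by
  intro hev
  obtain ⟨U, hU, hxU, hsub⟩ := mem_nhdsWithin.1 hev
  have hne : (U ∩ Ioo (0 : ℝ) 1).Nonempty := by
    have : x₀ ∈ closure (Ioo (0 : ℝ) 1) := by rwa [closure_Ioo zero_ne_one]
    exact mem_closure_iff.1 this U hU hxU
  have hpos := (hU.inter isOpen_Ioo).measure_pos volume hne
  have hnull : volume (U ∩ Ioo (0 : ℝ) 1) = 0 := by
    rw [← Measure.restrict_apply hU.measurableSet]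
    have h2 : ∀ᵐ x ∂unitVol, x ∉ U := by
      filter_upwards [h, ae_unitVol_mem] with x hx hx1 hxU'
      exact hsub ⟨hxU', Ioo_subset_Icc_self hx1⟩ hx
    exact measure_eq_zero_iff_ae_notMem.2 h2
  exact hpos.ne' hnull

/-- Good slices accumulate at x₀, and by continuity in L_p the bound passes to the limit slice. -/
theorem eLpNorm_le_of_ae_of_tendsto (hp : 1 ≤ p) {S : ℝ → ℝ → F} {x₀ : ℝ}
    (hx₀ : x₀ ∈ Icc (0 : ℝ) 1) (hm : ∀ x ∈ Icc (0 : ℝ) 1, AEStronglyMeasurable (S x) unitVol)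
    (hc : Tendsto (fun x => eLpNorm (fun t => S x t - S x₀ t) p unitVol)
      (𝓝[Icc (0 : ℝ) 1] x₀) (𝓝 0))
    {K : ℝ≥0∞} (hK : ∀ᵐ x ∂unitVol, eLpNorm (S x) p unitVol ≤ K) :
    eLpNorm (S x₀) p unitVol ≤ K := by
  refine le_of_forall_pos_le_add fun ε hε => ?_
  have h1 := (hc.eventually (gt_mem_nhds hε)).and self_mem_nhdsWithin
  obtain ⟨x, hxK, hxε, hx⟩ := ((frequently_nhdsWithin_of_ae_unitVol hK hx₀).and_eventually h1).exists
  have e : S x₀ = S x - fun t => S x t - S x₀ t := by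
    ext t
    simp
  calc eLpNorm (S x₀) p unitVol = eLpNorm (S x - fun t => S x t - S x₀ t) p unitVol := by rw [← e]
    _ ≤ eLpNorm (S x) p unitVol + eLpNorm (fun t => S x t - S x₀ t) p unitVol :=
      eLpNorm_sub_le (hm x hx) ((hm x hx).sub (hm x₀ hx₀)) hp
    _ ≤ K + ε := by gcongr

theorem tendsto_eLpNorm_sub_sub (hp : 1 ≤ p) {S T : ℝ → ℝ → F} {x₀ : ℝ}
    (hx₀ : x₀ ∈ Icc (0 : ℝ) 1)
    (hmS : ∀ x ∈ Icc (0 : ℝ) 1, AEStronglyMeasurable (S x) unitVol)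
    (hmT : ∀ x ∈ Icc (0 : ℝ) 1, AEStronglyMeasurable (T x) unitVol)
    (hS : Tendsto (fun x => eLpNorm (fun t => S x t - S x₀ t) p unitVol)
      (𝓝[Icc (0 : ℝ) 1] x₀) (𝓝 0))
    (hT : Tendsto (fun x => eLpNorm (fun t => T x t - T x₀ t) p unitVol)
      (𝓝[Icc (0 : ℝ) 1] x₀) (𝓝 0)) :
    Tendsto (fun x => eLpNorm (fun t => (S x t - T x t) - (S x₀ t - T x₀ t)) p unitVol)
      (𝓝[Icc (0 : ℝ) 1] x₀) (𝓝 0) := by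
  have hsum := hS.add hT
  rw [add_zero] at hsum
  refine tendsto_of_tendsto_of_tendsto_of_le_of_le' tendsto_const_nhds hsum
    (Eventually.of_forall fun _ => zero_le) ?_
  filter_upwards [self_mem_nhdsWithin] with x hx
  have e : (fun t => (S x t - T x t) - (S x₀ t - T x₀ t)) =
      (fun t => S x t - S x₀ t) - fun t => T x t - T x₀ t := by
    ext t
    simp only [Pi.sub_apply]
    abel
  rw [e]
  exact eLpNorm_sub_le ((hmS x hx).sub (hmS x₀ hx₀)) ((hmT x hx).sub (hmT x₀ hx₀)) hp

theorem exists_eLpNorm_le_of_tendsto (hp : 1 ≤ p) {S : ℝ → ℝ → F}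
    (hm : ∀ x ∈ Icc (0 : ℝ) 1, MemLp (S x) p unitVol)
    (hc : ∀ x₀ ∈ Icc (0 : ℝ) 1, Tendsto (fun x => eLpNorm (fun t => S x t - S x₀ t) p unitVol)
      (𝓝[Icc (0 : ℝ) 1] x₀) (𝓝 0)) :
    ∃ C : ℝ≥0∞, C ≠ ∞ ∧ ∀ x ∈ Icc (0 : ℝ) 1, eLpNorm (S x) p unitVol ≤ C := by
  refine isCompact_Icc.induction_on
    (p := fun s => ∃ C : ℝ≥0∞, C ≠ ∞ ∧ ∀ x ∈ s, eLpNorm (S x) p unitVol ≤ C) ?_ ?_ ?_ ?_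
  · exact ⟨0, ENNReal.zero_ne_top, by simp⟩
  · rintro s t hst ⟨C, hC, h⟩
    exact ⟨C, hC, fun x hx => h x (hst hx)⟩
  · rintro s t ⟨C, hC, h⟩ ⟨C', hC', h'⟩
    refine ⟨max C C', by simp [hC, hC'], fun x hx => ?_⟩
    rcases hx with hx | hx
    · exact (h x hx).trans (le_max_left _ _)
    · exact (h' x hx).trans (le_max_right _ _)
  · intro x₀ hx₀
    refine ⟨_, ((hc x₀ hx₀).eventually (gt_mem_nhds one_pos)).and self_mem_nhdsWithin,
      1 + eLpNorm (S x₀) p unitVol, by simp [(hm x₀ hx₀).2.ne], fun x hx => ?_⟩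
    have e : S x = (fun t => S x t - S x₀ t) + S x₀ := by
      ext t
      simp
    calc eLpNorm (S x) p unitVol = eLpNorm ((fun t => S x t - S x₀ t) + S x₀) p unitVol := by
          rw [← e]
      _ ≤ eLpNorm (fun t => S x t - S x₀ t) p unitVol + eLpNorm (S x₀) p unitVol :=
          eLpNorm_add_le ((hm x hx.2).1.sub (hm x₀ hx₀).1) (hm x₀ hx₀).1 hp
      _ ≤ _ := by
          gcongr
          exact hx.1.le

end Continuity

/-! ### Solutions in G⁺ as row solutions; uniqueness -/

section KreinSolutions

variable {r : ℕ} {p : ℝ≥0∞} {h : ℝ → Mat (Fin r)} {R : ℝ → ℝ → Mat (Fin r)}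

theorem prod_unitVol_le :
    unitVol.prod unitVol ≤ (volume : Measure (ℝ × ℝ)).restrict (Icc (0 : ℝ) 1 ×ˢ Icc (0 : ℝ) 1) := by
  rw [Measure.prod_restrict, ← Measure.volume_eq_prod]
  exact Measure.restrict_mono (Set.prod_mono Ioo_subset_Icc_self Ioo_subset_Icc_self) le_rfl

theorem ae_ae_of_ae_restrict {Ω : Set (ℝ × ℝ)} (hΩ : IsOpen Ω) {P : ℝ × ℝ → Prop}
    (h : ∀ᵐ z ∂(volume : Measure (ℝ × ℝ)).restrict Ω, P z) :
    ∀ᵐ x ∂unitVol, ∀ᵐ t ∂unitVol, (x, t) ∈ Ω → P (x, t) := by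
  have h1 := (ae_restrict_iff' hΩ.measurableSet).1 h
  refine Measure.ae_ae_of_ae_prod (p := fun z => z ∈ Ω → P z) ?_
  rw [Measure.prod_restrict, ← Measure.volume_eq_prod]
  exact ae_restrict_of_ae h1

theorem isOpen_omegaPlus : IsOpen OmegaPlus :=
  (isOpen_lt continuous_const continuous_snd).inter
    ((isOpen_lt continuous_snd continuous_fst).inter (isOpen_lt continuous_fst continuous_const))

theorem isOpen_omegaMinus : IsOpen OmegaMinus :=
  (isOpen_lt continuous_const continuous_fst).inter
    ((isOpen_lt continuous_fst continuous_snd).inter (isOpen_lt continuous_snd continuous_const))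

theorem setIntegral_eq_of_ae_eq_zero {F : Type*} [NormedAddCommGroup F] [NormedSpace ℝ F] {x : ℝ}
    (hx : x ≤ 1) {f : ℝ → F} (hf : ∀ᵐ s ∂unitVol, x < s → f s = 0) :
    ∫ s in Ioo (0 : ℝ) x, f s = ∫ s, f s ∂unitVol := by
  rw [← integral_indicator measurableSet_Ioo, ← integral_indicator measurableSet_Ioo]
  refine integral_congr_ae ?_
  have hne : ∀ᵐ s : ℝ, s ≠ x := by simp [ae_iff, measure_singleton]
  filter_upwards [(ae_restrict_iff' measurableSet_Ioo).1 hf, hne] with s hs hsx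
  by_cases h1 : s ∈ Ioo (0 : ℝ) 1
  · rw [indicator_of_mem h1]
    rcases lt_or_gt_of_ne hsx with h2 | h2
    · rw [indicator_of_mem (show s ∈ Ioo (0 : ℝ) x from ⟨h1.1, h2⟩)]
    · rw [indicator_of_notMem (show s ∉ Ioo (0 : ℝ) x from fun h' => h2.not_gt h'.2), hs h1 h2]
  · rw [indicator_of_notMem h1, indicator_of_notMem fun h' => h1 ⟨h'.1, h'.2.trans_le hx⟩]

/-- Below the diagonal the row equation is the Krein equation, above it the vanishing on Ω₋. This
vanishing also allows the integral over (0,x) to be extended to (0,1), and the diagonal point of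
each row is null. -/
theorem IsKreinSolution.ae_rowEquation (hR : IsKreinSolution p h R) :
    ∀ᵐ x ∂unitVol, RowEquation h x (R x) := by
  filter_upwards [ae_ae_of_ae_restrict isOpen_omegaMinus hR.memGPlus.eq_zero,
    ae_ae_of_ae_restrict isOpen_omegaPlus hR.equation, ae_unitVol_mem] with x h0 h1 hx
  have hzero : ∀ᵐ s ∂unitVol, x < s → R x s = 0 := by
    filter_upwards [h0, ae_unitVol_mem] with s hs hs1 hxs using hs ⟨hx.1, hxs, hs1.2⟩
  have hne : ∀ᵐ s ∂unitVol, s ≠ x := by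
    refine ae_restrict_of_ae ?_
    simp [ae_iff, measure_singleton]
  filter_upwards [hzero, h1, ae_unitVol_mem, hne] with t ht0 ht1 ht htx
  rcases lt_or_gt_of_ne htx with h2 | h2
  · rw [indicator_of_mem (show t ∈ Iio x from h2)]
    have := ht1 ⟨ht.1, h2, hx.2⟩
    rw [setIntegral_eq_of_ae_eq_zero hx.2.le
      (by filter_upwards [hzero] with s hs hxs; rw [hs hxs, zero_mul]), add_assoc] at this
    exact eq_neg_of_add_eq_zero_left this
  · rw [indicator_of_notMem (show t ∉ Iio x from h2.not_gt), neg_zero, ht0 h2]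

theorem MemG.isRowSolution (hp1 : 1 ≤ p) (hp : p ≠ ∞) (hR : MemG p R)
    (heq : ∀ᵐ x ∂unitVol, RowEquation h x (R x)) : IsRowSolution p.toReal h R where
  aestronglyMeasurable := hR.aestronglyMeasurable.mono_measure prod_unitVol_le
  integrable := by
    filter_upwards [ae_unitVol_mem] with x hx
    exact (hR.memLp_left x (Ioo_subset_Icc_self hx)).integrable hp1
  finite := by
    obtain ⟨C, hC, hle⟩ := exists_eLpNorm_le_of_tendsto hp1 hR.memLp_left hR.continuous_left
    have hq := one_le_toReal hp1 hp
    refine ne_top_of_le_ne_top (b := ∫⁻ _, C ^ p.toReal ∂unitVol) ?_ (lintegral_mono_ae ?_)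
    · simp [ENNReal.rpow_ne_top_of_nonneg (by linarith : 0 ≤ p.toReal) hC]
    · filter_upwards [ae_unitVol_mem] with x hx
      rw [← eLpNorm_rpow_toReal (by positivity) hp]
      gcongr
      exact hle x (Ioo_subset_Icc_self hx)
  equation := heq

theorem MemG.sub_tendsto_left (hp1 : 1 ≤ p) {R₁ R₂ : ℝ → ℝ → Mat (Fin r)} (h₁ : MemG p R₁)
    (h₂ : MemG p R₂) {x₀ : ℝ} (hx₀ : x₀ ∈ Icc (0 : ℝ) 1) {K : ℝ≥0∞}
    (hK : ∀ᵐ x ∂unitVol, eLpNorm (fun t => R₁ x t - R₂ x t) p unitVol ≤ K) :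
    eLpNorm (fun t => R₁ x₀ t - R₂ x₀ t) p unitVol ≤ K :=
  eLpNorm_le_of_ae_of_tendsto (S := fun x t => R₁ x t - R₂ x t) hp1 hx₀
    (fun x hx => (h₁.memLp_left x hx).1.sub (h₂.memLp_left x hx).1)
    (tendsto_eLpNorm_sub_sub hp1 hx₀ (fun x hx => (h₁.memLp_left x hx).1)
      (fun x hx => (h₂.memLp_left x hx).1) (h₁.continuous_left x₀ hx₀)
      (h₂.continuous_left x₀ hx₀)) hK

theorem MemG.sub_tendsto_right (hp1 : 1 ≤ p) {R₁ R₂ : ℝ → ℝ → Mat (Fin r)} (h₁ : MemG p R₁)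
    (h₂ : MemG p R₂) {t₀ : ℝ} (ht₀ : t₀ ∈ Icc (0 : ℝ) 1) {K : ℝ≥0∞}
    (hK : ∀ᵐ t ∂unitVol, eLpNorm (fun x => R₁ x t - R₂ x t) p unitVol ≤ K) :
    eLpNorm (fun x => R₁ x t₀ - R₂ x t₀) p unitVol ≤ K :=
  eLpNorm_le_of_ae_of_tendsto (S := fun t x => R₁ x t - R₂ x t) hp1 ht₀
    (fun t ht => (h₁.memLp_right t ht).1.sub (h₂.memLp_right t ht).1)
    (tendsto_eLpNorm_sub_sub (S := fun t x => R₁ x t) (T := fun t x => R₂ x t) hp1 ht₀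
      (fun t ht => (h₁.memLp_right t ht).1)
      (fun t ht => (h₂.memLp_right t ht).1) (h₁.continuous_right t₀ ht₀)
      (h₂.continuous_right t₀ ht₀)) hK

/-- With equal accelerants the L_1 row bound has right-hand side zero, so almost all rows agree.
Fubini gives the same for almost all columns, and continuity in L_p extends both to every slice. -/
theorem IsAccelerant.gEq_of_isKreinSolution (hp1 : 1 ≤ p) (hp : p ≠ ∞)
    (hacc : IsAccelerant h) {R₁ R₂ : ℝ → ℝ → Mat (Fin r)} (h₁ : IsKreinSolution p h R₁)
    (h₂ : IsKreinSolution p h R₂) : GEq R₁ R₂ := by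
  have hh := hacc.integrable
  have hp0 : p ≠ 0 := by positivity
  obtain ⟨M, δ, hM, hδ, hbd⟩ := exists_row_bound hh hacc.isUnit_row
  have s₁ := h₁.memGPlus.toMemG.isRowSolution hp1 hp h₁.ae_rowEquation
  have s₂ := h₂.memGPlus.toMemG.isRowSolution hp1 hp h₂.ae_rowEquation
  have hrow : ∀ᵐ x ∂unitVol, ∀ᵐ t ∂unitVol, R₁ x t - R₂ x t = 0 := by
    filter_upwards [s₁.integrable, s₂.integrable, s₁.equation, s₂.equation, ae_unitVol_mem]
      with x i₁ i₂ e₁ e₂ hx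
    have hxc := Ioo_subset_Icc_self hx
    have := e₁.lintegral_sub_le hh hh hxc i₁ i₂ e₂ hM.le
      (hbd h hh (by simp) x hxc)
    simp only [sub_self, enorm_zero, lintegral_zero, mul_zero, nonpos_iff_eq_zero] at this
    have h0 := (lintegral_eq_zero_iff' (i₁.1.sub i₂.1).enorm).1 this
    filter_upwards [h0] with t ht
    simpa using ht
  have hcol : ∀ᵐ t ∂unitVol, ∀ᵐ x ∂unitVol, R₁ x t - R₂ x t = 0 := by
    have hm : AEMeasurable (fun z : ℝ × ℝ => ‖R₁ z.1 z.2 - R₂ z.1 z.2‖ₑ)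
        (unitVol.prod unitVol) := (s₁.aestronglyMeasurable.sub s₂.aestronglyMeasurable).enorm
    have := ae_ae_swap_of_ae_prod (ae_prod_le_of_ae_ae_le hm (aemeasurable_const (b := 0)) (by
      filter_upwards [hrow] with x hx
      filter_upwards [hx] with t ht
      simp [ht]))
    filter_upwards [this] with t ht
    filter_upwards [ht] with x hx
    simpa using hx
  constructor
  · intro x hx
    have : eLpNorm (fun t => R₁ x t - R₂ x t) p unitVol ≤ 0 := by
      refine h₁.memGPlus.toMemG.sub_tendsto_left hp1 h₂.memGPlus.toMemG hx ?_
      filter_upwards [hrow] with x hx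
      rw [eLpNorm_congr_ae hx]
      simp
    have h0 := (eLpNorm_eq_zero_iff (f := fun t => R₁ x t - R₂ x t)
      ((h₁.memGPlus.memLp_left x hx).1.sub (h₂.memGPlus.memLp_left x hx).1) hp0).1
      (nonpos_iff_eq_zero.1 this)
    filter_upwards [h0] with t ht using sub_eq_zero.1 ht
  · intro t ht
    have : eLpNorm (fun x => R₁ x t - R₂ x t) p unitVol ≤ 0 := by
      refine h₁.memGPlus.toMemG.sub_tendsto_right hp1 h₂.memGPlus.toMemG ht ?_
      filter_upwards [hcol] with x hx
      rw [eLpNorm_congr_ae hx]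
      simp
    have h0 := (eLpNorm_eq_zero_iff (f := fun x => R₁ x t - R₂ x t)
      ((h₁.memGPlus.memLp_right t ht).1.sub (h₂.memGPlus.memLp_right t ht).1) hp0).1
      (nonpos_iff_eq_zero.1 this)
    filter_upwards [h0] with x hx using sub_eq_zero.1 hx

end KreinSolutions

/-! ### A priori bounds for rows and columns of one solution -/

section Bounds

variable {A : Type*} [NormedRing A] [NormedAlgebra ℂ A] {q : ℝ} {h g : ℝ → A} {R : ℝ → ℝ → A}

/-- The difference bound for rows, applied against the zero solution for the zero accelerant. -/
theorem IsRowSolution.row_le (hh : Integrable h symVol) (hR : IsRowSolution q h R) {M : ℝ}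
    (hM : 0 ≤ M) (hbd : ∀ x ∈ Icc (0 : ℝ) 1, ∀ φ, ‖φ‖ ≤ M * ‖φ + trunc x (rowOp hh φ)‖) :
    ∀ᵐ x ∂unitVol, ∫⁻ s, ‖R x s‖ₑ ∂unitVol ≤ ENNReal.ofReal M * ∫⁻ u, ‖h u‖ₑ ∂symVol := by
  filter_upwards [hR.integrable, hR.equation, (isRowSolution_zero (A := A) le_rfl).equation,
    ae_unitVol_mem] with x i e e0 hx
  have hxc := Ioo_subset_Icc_self hx
  have := e.lintegral_sub_le hh (integrable_zero _ _ _) hxc i (integrable_zero _ _ _) e0 hM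
    (hbd x hxc)
  simpa using this

/-- The column estimate for differences with exponent 1, against the zero solution; the constants a
and b of that solution are zero. -/
theorem IsRowSolution.column_le (hh : Integrable h symVol) (hg : Integrable g symVol)
    (hR : IsRowSolution q h R) {M : ℝ} (hM : 0 ≤ M)
    (hbd : ∀ x ∈ Icc (0 : ℝ) 1, ∀ φ, ‖φ‖ ≤ M * ‖φ + trunc x (rowOp hh φ)‖)
    {N : ℝ≥0∞} (hgN : ∀ u, ‖g u‖ₑ ≤ N) (hsmall : ∫⁻ u, ‖h u - g u‖ₑ ∂symVol ≤ 2⁻¹) :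
    ∀ᵐ s ∂unitVol, ∫⁻ x, ‖R x s‖ₑ ∂unitVol ≤
      columnConst 1 (ENNReal.ofReal M) N 0 0 * ∫⁻ u, ‖h u‖ₑ ∂symVol := by
  -- Finiteness for the exponent 1 is not read off from the exponent q but from the uniform row
  -- bound.
  have hR1 : IsRowSolution 1 h R :=
    { hR with
      finite := by
        refine ne_top_of_le_ne_top
          (b := ∫⁻ _, ENNReal.ofReal M * ∫⁻ u, ‖h u‖ₑ ∂symVol ∂unitVol) ?_ (lintegral_mono_ae ?_)
        · simp [ENNReal.mul_ne_top ENNReal.ofReal_ne_top hh.2.ne]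
        · simpa only [ENNReal.rpow_one] using hR.row_le hh hM hbd }
  have := hR1.column_sub_le le_rfl hh (integrable_zero _ _ _) hg (isRowSolution_zero le_rfl) hM hbd
    hgN hsmall (a := 0) (b := 0) (by simp) (by simp)
  simpa using this

end Bounds

/-! ### The Lipschitz estimate for the traces R(·,0) -/

section Lipschitz

variable {r : ℕ} {p : ℝ≥0∞} {h₀ : ℝ → Mat (Fin r)}

/-- The traces `R(·,0)` of the solutions of the Krein equations depend on the accelerant in a
locally Lipschitz way. -/
theorem IsAccelerant.exists_lipschitz_bound (hp1 : 1 ≤ p) (hp : p ≠ ∞) (hacc : IsAccelerant h₀) :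
    ∃ δ : ℝ, 0 < δ ∧ ∃ K : ℝ≥0∞, K ≠ ∞ ∧ ∀ h₁ h₂ : ℝ → Mat (Fin r),
      Integrable h₁ symVol → Integrable h₂ symVol →
      ∫⁻ u, ‖h₁ u - h₀ u‖ₑ ∂symVol ≤ ENNReal.ofReal δ →
      ∫⁻ u, ‖h₂ u - h₀ u‖ₑ ∂symVol ≤ ENNReal.ofReal δ →
      ∀ R₁ R₂, IsKreinSolution p h₁ R₁ → IsKreinSolution p h₂ R₂ →
        eLpNorm (fun x => R₁ x 0 - R₂ x 0) p unitVol ≤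
          K * eLpNorm (fun u => h₁ u - h₂ u) p symVol := by
  have hh₀ := hacc.integrable
  have hq := one_le_toReal hp1 hp
  have hq0 : 0 < p.toReal := by linarith
  obtain ⟨M, δ₁, hM, hδ₁, hbd⟩ := exists_row_bound hh₀ hacc.isUnit_row
  -- The tolerance 1/4 for g, together with δ ≤ 1/4 below, keeps every h near h₀ within 1/2 of the
  -- same g, so one bound N serves the whole neighbourhood.
  obtain ⟨g, N, hN, hgN, hg, hsmall⟩ := exists_bounded_lintegral_sub_le hh₀ (ε := 4⁻¹) (by simp)
  set L : ℝ≥0∞ := ∫⁻ u, ‖h₀ u‖ₑ ∂symVol + 4⁻¹ with hL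
  have hLtop : L ≠ ∞ := ENNReal.add_ne_top.2 ⟨hh₀.2.ne, by simp⟩
  set a := ENNReal.ofReal M * L with ha
  set b := columnConst 1 (ENNReal.ofReal M) N 0 0 * L with hb
  have hatop : a ≠ ∞ := ENNReal.mul_ne_top ENNReal.ofReal_ne_top hLtop
  have hbtop : b ≠ ∞ := ENNReal.mul_ne_top (columnConst_ne_top le_rfl ENNReal.ofReal_ne_top hN
    ENNReal.zero_ne_top ENNReal.zero_ne_top) hLtop
  set K := columnConst p.toReal (ENNReal.ofReal M) N a b with hK
  have hKtop : K ≠ ∞ := columnConst_ne_top hq ENNReal.ofReal_ne_top hN hatop hbtop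
  have h4 : ENNReal.ofReal (1 / 4) = 4⁻¹ := by
    rw [one_div, ENNReal.ofReal_inv_of_pos (by norm_num)]
    norm_num
  -- The constant K bounds p-th powers of column norms, hence the exponent 1/p.
  refine ⟨min δ₁ (1 / 4), by positivity, K ^ (1 / p.toReal),
    ENNReal.rpow_ne_top_of_nonneg (by positivity) hKtop,
    fun h₁ h₂ hh₁ hh₂ hd₁ hd₂ R₁ R₂ hR₁ hR₂ => ?_⟩
  have near : ∀ h' : ℝ → Mat (Fin r), ∀ hh' : Integrable h' symVol,
      ∫⁻ u, ‖h' u - h₀ u‖ₑ ∂symVol ≤ ENNReal.ofReal (min δ₁ (1 / 4)) →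
      (∀ x ∈ Icc (0 : ℝ) 1, ∀ φ, ‖φ‖ ≤ M * ‖φ + trunc x (rowOp hh' φ)‖) ∧
      ∫⁻ u, ‖h' u - g u‖ₑ ∂symVol ≤ 2⁻¹ ∧ ∫⁻ u, ‖h' u‖ₑ ∂symVol ≤ L := by
    intro h' hh' hd
    have hd4 : ∫⁻ u, ‖h' u - h₀ u‖ₑ ∂symVol ≤ 4⁻¹ :=
      hd.trans ((ENNReal.ofReal_le_ofReal (min_le_right _ _)).trans_eq h4)
    have hm : AEMeasurable (fun u => ‖h' u - h₀ u‖ₑ) symVol := (hh'.1.sub hh₀.1).enorm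
    refine ⟨hbd h' hh' (hd.trans (ENNReal.ofReal_le_ofReal (min_le_left _ _))), ?_, ?_⟩
    · calc ∫⁻ u, ‖h' u - g u‖ₑ ∂symVol ≤ ∫⁻ u, (‖h' u - h₀ u‖ₑ + ‖h₀ u - g u‖ₑ) ∂symVol := by
            refine lintegral_mono fun u => ?_
            rw [← sub_add_sub_cancel (h' u) (h₀ u) (g u)]
            exact enorm_add_le _ _
        _ = _ := lintegral_add_left' hm _
        _ ≤ 4⁻¹ + 4⁻¹ := add_le_add hd4 hsmall
        _ = 2⁻¹ := by
            rw [← two_mul, show (4 : ℝ≥0∞) = 2 * 2 by norm_num,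
              ENNReal.mul_inv (by simp) (by simp), ← mul_assoc,
              ENNReal.mul_inv_cancel two_ne_zero ENNReal.ofNat_ne_top, one_mul]
    · calc ∫⁻ u, ‖h' u‖ₑ ∂symVol ≤ ∫⁻ u, (‖h₀ u‖ₑ + ‖h' u - h₀ u‖ₑ) ∂symVol := by
            refine lintegral_mono fun u => ?_
            calc ‖h' u‖ₑ = ‖h₀ u + (h' u - h₀ u)‖ₑ := by rw [add_sub_cancel]
              _ ≤ _ := enorm_add_le _ _
        _ = _ := lintegral_add_right' _ hm
        _ ≤ L := add_le_add le_rfl hd4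
  obtain ⟨hbd₁, hsm₁, -⟩ := near h₁ hh₁ hd₁
  obtain ⟨hbd₂, hsm₂, hL₂⟩ := near h₂ hh₂ hd₂
  have s₁ := hR₁.memGPlus.toMemG.isRowSolution hp1 hp hR₁.ae_rowEquation
  have s₂ := hR₂.memGPlus.toMemG.isRowSolution hp1 hp hR₂.ae_rowEquation
  have hcol := s₁.column_sub_le hq hh₁ hh₂ hg s₂ hM.le hbd₁ hgN hsm₁ (a := a) (b := b)
    ((s₂.row_le hh₂ hM.le hbd₂).mono fun x hx => hx.trans (mul_le_mul' le_rfl hL₂))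
    ((s₂.column_le hh₂ hg hM.le hbd₂ hgN hsm₂).mono fun x hx => hx.trans (mul_le_mul' le_rfl hL₂))
  -- The column bound holds for almost every t; continuity of the columns yields it at t = 0.
  refine hR₁.memGPlus.toMemG.sub_tendsto_right hp1 hR₂.memGPlus.toMemG (by simp) ?_
  filter_upwards [hcol] with t ht
  rw [← ENNReal.rpow_le_rpow_iff hq0, ENNReal.mul_rpow_of_nonneg _ _ hq0.le,
    eLpNorm_rpow_toReal (by positivity) hp, eLpNorm_rpow_toReal (by positivity) hp,
    ← ENNReal.rpow_mul, one_div_mul_cancel hq0.ne', ENNReal.rpow_one]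
  exact ht

end Lipschitz

/-! ### Existence of solutions of the Krein equation -/

section Translation

variable {E : Type*} [NormedAddCommGroup E] {p : ℝ≥0∞}

/-- Continuity of translations in L_p, stated for a continuous family of measure preserving maps so
as to cover both x − t and s − t. -/
theorem tendsto_eLpNorm_comp_sub_comp (hp1 : 1 ≤ p) (hp : p ≠ ∞) {H : ℝ → E}
    (hH : MemLp H p volume) {g : ℝ → ℝ → ℝ} (hg : Continuous (Function.uncurry g))
    (hgm : ∀ x, MeasurePreserving (g x) volume volume) (x₀ : ℝ) :
    Tendsto (fun x => eLpNorm (fun t => H (g x t) - H (g x₀ t)) p volume) (𝓝 x₀) (𝓝 0) := by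
  have : Fact (1 ≤ p) := ⟨hp1⟩
  let G : ℝ → C(ℝ, ℝ) := fun x => ⟨g x, hg.comp (Continuous.prodMk_right x)⟩
  have hG : Continuous G := ContinuousMap.continuous_of_continuous_uncurry G hg
  have hc := (continuous_const (y := hH.toLp H)).compMeasurePreservingLp hG hgm hp
  have hae : ∀ x, Lp.compMeasurePreserving (G x) (hgm x) (hH.toLp H) =ᵐ[volume]
      fun t => H (g x t) := fun x =>
    (Lp.coeFn_compMeasurePreserving _ (hgm x)).trans
      ((hgm x).quasiMeasurePreserving.ae_eq_comp hH.coeFn_toLp)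
  refine (tendsto_iff_edist_tendsto_0.1 (hc.tendsto x₀)).congr fun x => ?_
  rw [Lp.edist_def]
  exact eLpNorm_congr_ae ((hae x).sub (hae x₀))

/-- Cutting off a continuous family of `L_p` functions. -/
theorem tendsto_eLpNorm_indicator_sub_indicator (hp1 : 1 ≤ p) (hp : p ≠ ∞) {μ : Measure ℝ}
    [NullSingletonClass μ] {f : ℝ → ℝ → E} {a₀ : ℝ} (hm : ∀ a, AEStronglyMeasurable (f a) μ)
    (hf : MemLp (f a₀) p μ)
    (hc : Tendsto (fun a => eLpNorm (fun x => f a x - f a₀ x) p μ) (𝓝 a₀) (𝓝 0))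
    {I : ℝ → Set ℝ} (hI : ∀ a, MeasurableSet (I a))
    (hloc : ∀ x, x ≠ a₀ → ∀ᶠ a in 𝓝 a₀, x ∈ I a ↔ x ∈ I a₀) :
    Tendsto (fun a => eLpNorm (fun x => (I a).indicator (f a) x - (I a₀).indicator (f a₀) x) p μ)
      (𝓝 a₀) (𝓝 0) := by
  have hsum := hc.add (tendsto_eLpNorm_indicator_sub (zero_lt_one.trans_le hp1).ne' hp hf hI hloc)
  rw [add_zero] at hsum
  refine tendsto_of_tendsto_of_tendsto_of_le_of_le tendsto_const_nhds hsum
    (fun _ => zero_le) fun a => ?_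
  have e : (fun x => (I a).indicator (f a) x - (I a₀).indicator (f a₀) x) =
      ((I a).indicator fun x => f a x - f a₀ x) +
        fun x => (I a).indicator (f a₀) x - (I a₀).indicator (f a₀) x := by
    ext x
    rw [Pi.add_apply]
    by_cases h : x ∈ I a <;> simp [h]
  rw [e]
  refine (eLpNorm_add_le (((hm a).sub (hm a₀)).indicator (hI a))
    ((hf.1.indicator (hI a)).sub (hf.1.indicator (hI a₀))) hp1).trans ?_
  exact add_le_add (eLpNorm_indicator_le _) le_rfl

end Translation

/-! ### Jointly measurable representatives -/

section Representative

variable {E : Type*} [NormedAddCommGroup E] [NormedSpace ℂ E] [CompleteSpace E]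

omit [CompleteSpace E] in
theorem integral_trunc_eq (f : Lp E 1 unitVol) {s : ℝ} (hs : 0 ≤ s) :
    ∫ t, trunc s f t ∂unitVol = ∫ t in (0 : ℝ)..s, (Ioo (0 : ℝ) 1).indicator f t := by
  rw [integral_congr_ae (trunc_coeFn s f), intervalIntegral.integral_of_le hs,
    integral_Ioc_eq_integral_Ioo, ← integral_indicator measurableSet_Ioo,
    ← integral_indicator measurableSet_Ioo]
  congr 1
  ext t
  by_cases h1 : t ∈ Ioo (0 : ℝ) 1
  · by_cases h2 : t < s
    · rw [indicator_of_mem h1, indicator_of_mem (show t ∈ Iio s from h2),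
        indicator_of_mem (show t ∈ Ioo 0 s from ⟨h1.1, h2⟩), indicator_of_mem h1]
    · rw [indicator_of_mem h1, indicator_of_notMem (show t ∉ Iio s from h2),
        indicator_of_notMem fun h => h2 h.2]
  · rw [indicator_of_notMem h1]
    by_cases h2 : t ∈ Ioo 0 s
    · rw [indicator_of_mem h2, indicator_of_notMem h1]
    · rw [indicator_of_notMem h2]

omit [CompleteSpace E] in
theorem continuous_trunc_apply_prod :
    Continuous fun z : Lp E 1 unitVol × ℝ => trunc z.2 z.1 := by
  refine continuous_prod_of_continuous_lipschitzWith _ 1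
    (fun f => continuous_trunc_apply ENNReal.one_ne_top f) fun a => ?_
  refine LipschitzWith.of_dist_le_mul fun f g => ?_
  have h1 := (trunc (E := E) (p := 1) a).le_of_opNorm_le (norm_trunc_le a) (f - g)
  rw [map_sub] at h1
  rw [dist_eq_norm, dist_eq_norm, NNReal.coe_one]
  exact h1

omit [CompleteSpace E] in
theorem continuous_integral_trunc {φ : ℝ → Lp E 1 unitVol} (hφ : Continuous φ) :
    Continuous fun z : ℝ × ℝ => ∫ t, trunc z.2 (φ z.1) t ∂unitVol :=
  continuous_integral.comp
    (continuous_trunc_apply_prod.comp ((hφ.comp continuous_fst).prodMk continuous_snd))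

/-- A continuous family of `L_1` functions has a jointly measurable representative. -/
theorem exists_stronglyMeasurable_representative {φ : ℝ → Lp E 1 unitVol} (hφ : Continuous φ) :
    ∃ Φ : ℝ → ℝ → E, StronglyMeasurable (fun z : ℝ × ℝ => Φ z.1 z.2) ∧
      ∀ x, Φ x =ᵐ[unitVol] φ x := by
  -- For s in (0,1), F(x,s) is the primitive of φ_x and is jointly continuous. By Lebesgue
  -- differentiation its right difference quotients along e_n → 0 converge to φ_x(s) for almost
  -- every s, and `limUnder` of a sequence of continuous functions is strongly measurable in (x,s).
  set F : ℝ × ℝ → E := fun z => ∫ t, trunc z.2 (φ z.1) t ∂unitVol with hF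
  have hFc : Continuous F := continuous_integral_trunc hφ
  let e : ℕ → ℝ := fun n => 1 / ((n : ℝ) + 1)
  have he : Tendsto e atTop (𝓝[>] 0) :=
    tendsto_nhdsWithin_iff.2 ⟨tendsto_one_div_add_atTop_nhds_zero_nat,
      Eventually.of_forall fun n => mem_Ioi.2 (by positivity)⟩
  refine ⟨fun x s => limUnder atTop fun n => (e n)⁻¹ • (F (x, s + e n) - F (x, s)), ?_, fun x => ?_⟩
  · refine StronglyMeasurable.limUnder fun n => Continuous.stronglyMeasurable ?_
    have h1 : Continuous fun z : ℝ × ℝ => F (z.1, z.2 + e n) := hFc.comp (by fun_prop)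
    exact (h1.sub hFc).const_smul _
  · have hint : Integrable ((Ioo (0 : ℝ) 1).indicator (φ x)) volume :=
      (integrable_indicator_iff measurableSet_Ioo).2
        (memLp_one_iff_integrable.1 (Lp.memLp (φ x)))
    filter_upwards [ae_restrict_of_ae (LocallyIntegrable.ae_hasDerivAt_integral hint.locallyIntegrable),
      ae_unitVol_mem] with s hs hs1
    have := (hs 0).tendsto_slope_zero_right.comp he
    rw [indicator_of_mem hs1] at this
    refine Tendsto.limUnder_eq (this.congr fun n => ?_)
    have hn : 0 ≤ e n := by positivity
    rw [Function.comp_apply, hF]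
    simp only
    rw [integral_trunc_eq _ hs1.1.le, integral_trunc_eq _ (by linarith [hs1.1])]

end Representative

/-! ### Continuous rows, Young's inequality and the Schur bounds -/

section Existence

variable {A : Type*} [NormedRing A] [NormedAlgebra ℂ A] {H : ℝ → A} {p : ℝ≥0∞}

omit [NormedAlgebra ℂ A] in
theorem memLp_comp_sub_left (hH : MemLp H p volume) (x : ℝ) :
    MemLp (fun t => H (x - t)) p unitVol :=
  (hH.comp_measurePreserving (Measure.measurePreserving_sub_left volume x)).mono_measure
    Measure.restrict_le_self

omit [NormedAlgebra ℂ A] in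
theorem memLp_comp_sub_right (hH : MemLp H p volume) (t : ℝ) :
    MemLp (fun s => H (s - t)) p unitVol :=
  (hH.comp_measurePreserving (measurePreserving_sub_right volume t)).mono_measure
    Measure.restrict_le_self

omit [NormedAlgebra ℂ A] in
theorem tendsto_eLpNorm_comp_sub_left (hp1 : 1 ≤ p) (hp : p ≠ ∞) (hH : MemLp H p volume) (x₀ : ℝ) :
    Tendsto (fun x => eLpNorm (fun t => H (x - t) - H (x₀ - t)) p unitVol) (𝓝 x₀) (𝓝 0) :=
  tendsto_of_tendsto_of_tendsto_of_le_of_le tendsto_const_nhds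
    (tendsto_eLpNorm_comp_sub_comp hp1 hp hH (g := fun x t => x - t) (by fun_prop)
      (fun x => Measure.measurePreserving_sub_left volume x) x₀) (fun _ => zero_le)
    fun _ => eLpNorm_mono_measure _ Measure.restrict_le_self

omit [NormedAlgebra ℂ A] in
theorem tendsto_eLpNorm_comp_sub_right (hp1 : 1 ≤ p) (hp : p ≠ ∞) (hH : MemLp H p volume)
    (t₀ : ℝ) :
    Tendsto (fun t => eLpNorm (fun s => H (s - t) - H (s - t₀)) p unitVol) (𝓝 t₀) (𝓝 0) :=
  tendsto_of_tendsto_of_tendsto_of_le_of_le tendsto_const_nhds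
    (tendsto_eLpNorm_comp_sub_comp hp1 hp hH (g := fun t s => s - t)
      (by simp only [Function.uncurry_def]; fun_prop)
      (fun t => measurePreserving_sub_right volume t) t₀) (fun _ => zero_le)
    fun _ => eLpNorm_mono_measure _ Measure.restrict_le_self

theorem continuousAt_inverse_of_isUnit {X : Type*} [NormedAddCommGroup X] [NormedSpace ℂ X]
    [CompleteSpace X] {S : X →L[ℂ] X} (hS : IsUnit S) : ContinuousAt Ring.inverse S := by
  obtain ⟨u, rfl⟩ := hS
  exact NormedRing.inverse_continuousAt u

/-- The rows of the solution of the Krein equation form a continuous family in `L_1`. -/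
theorem exists_continuous_rowEquation [FiniteDimensional ℂ A] [CompleteSpace A]
    (hH : MemLp H 1 volume) (hh : Integrable H symVol)
    (hu : ∀ a, IsUnit (1 + trunc a ∘L rowOp hh)) :
    ∃ φ : ℝ → Lp A 1 unitVol, Continuous φ ∧ ∀ x, RowEquation H x (φ x) := by
  let f : ℝ → Lp A 1 unitVol := fun x => (memLp_comp_sub_left hH x).toLp _
  have hf : Continuous f := by
    refine continuous_iff_continuousAt.2 fun x₀ => tendsto_iff_edist_tendsto_0.2 ?_
    refine (tendsto_eLpNorm_comp_sub_left le_rfl ENNReal.one_ne_top hH x₀).congr fun x => ?_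
    rw [Lp.edist_toLp_toLp]
    rfl
  have hb : Continuous fun x => trunc x (f x) :=
    continuous_trunc_apply_prod.comp (hf.prodMk continuous_id)
  have hinv : Continuous fun x => Ring.inverse (1 + trunc x ∘L rowOp hh) := by
    refine continuous_iff_continuousAt.2 fun x => ?_
    have h1 := continuousAt_inverse_of_isUnit (hu x)
    exact ContinuousAt.comp (f := fun x => 1 + trunc x ∘L rowOp hh) h1
      (continuous_const.add (continuous_trunc_rowOp hh)).continuousAt
  -- The row equation solved explicitly: φ_x = −(1 + P_x T)⁻¹ P_x H(x − ·), continuous in x because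
  -- each factor is.
  refine ⟨fun x => -(Ring.inverse (1 + trunc x ∘L rowOp hh) (trunc x (f x))),
    (hinv.clm_apply hb).neg, fun x => ?_⟩
  set φ := -(Ring.inverse (1 + trunc x ∘L rowOp hh) (trunc x (f x))) with hφ
  have e : φ + trunc x (rowOp hh φ) = -trunc x (f x) := by
    have h1 := congrArg (fun S : Lp A 1 unitVol →L[ℂ] Lp A 1 unitVol => S (trunc x (f x)))
      (Ring.mul_inverse_cancel _ (hu x))
    have h2 : Ring.inverse (1 + trunc x ∘L rowOp hh) (trunc x (f x)) +
        trunc x (rowOp hh (Ring.inverse (1 + trunc x ∘L rowOp hh) (trunc x (f x)))) =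
        trunc x (f x) := h1
    rw [hφ, map_neg, map_neg, ← neg_add, h2]
  have e' := congrArg (fun ψ : Lp A 1 unitVol => (ψ : ℝ → A)) e
  filter_upwards [Lp.coeFn_add φ (trunc x (rowOp hh φ)), Lp.coeFn_neg (trunc x (f x)),
    trunc_coeFn x (f x), trunc_coeFn x (rowOp hh φ), rowOp_coeFn hh φ,
    (memLp_comp_sub_left hH x).coeFn_toLp] with t h1 h2 h3 h4 h5 h6
  rw [e', h2, Pi.neg_apply, h3, Pi.add_apply, h4] at h1
  rw [← sub_eq_iff_eq_add.2 h1]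
  by_cases ht : t ∈ Iio x
  · simp only [indicator_of_mem ht, f]
    rw [h5, h6]
    abel
  · simp only [indicator_of_notMem ht, neg_zero, sub_zero]

/-- Young's inequality. -/
theorem eLpNorm_integral_mul_sub_le (hp1 : 1 ≤ p) (hp : p ≠ ∞) {ψ : ℝ → A}
    (hψ : AEStronglyMeasurable ψ unitVol) (hHm : StronglyMeasurable H) :
    eLpNorm (fun t => ∫ s, ψ s * H (s - t) ∂unitVol) p unitVol ≤
      (∫⁻ s, ‖ψ s‖ₑ ∂unitVol) * eLpNorm H p volume := by
  have hq := one_le_toReal hp1 hp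
  set W := ∫⁻ s, ‖ψ s‖ₑ ∂unitVol with hW
  have hm : ∀ t, StronglyMeasurable fun s => H (s - t) := fun t =>
    hHm.comp_measurable (by fun_prop)
  have hm2 : AEMeasurable (fun z : ℝ × ℝ => ‖ψ z.2‖ₑ * ‖H (z.2 - z.1)‖ₑ ^ p.toReal)
      (unitVol.prod unitVol) :=
    hψ.enorm.comp_snd.mul ((hHm.comp_measurable (by fun_prop :
      Measurable fun z : ℝ × ℝ => z.2 - z.1)).enorm.pow_const _).aemeasurable
  rw [← ENNReal.rpow_le_rpow_iff (show 0 < p.toReal by linarith),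
    eLpNorm_rpow_toReal (by positivity) hp, ENNReal.mul_rpow_of_nonneg _ _ (by linarith),
    eLpNorm_rpow_toReal (by positivity) hp]
  calc ∫⁻ t, ‖∫ s, ψ s * H (s - t) ∂unitVol‖ₑ ^ p.toReal ∂unitVol
      ≤ ∫⁻ t, W ^ (p.toReal - 1) * ∫⁻ s, ‖ψ s‖ₑ * ‖H (s - t)‖ₑ ^ p.toReal ∂unitVol ∂unitVol := by
        refine lintegral_mono fun t => ?_
        refine le_trans ?_ (rpow_lintegral_mul_le hψ.enorm (hm t).enorm.aemeasurable hq)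
        gcongr
        exact enorm_integral_mul_le_lintegral ψ H t
    _ = W ^ (p.toReal - 1) * ∫⁻ s, ∫⁻ t, ‖ψ s‖ₑ * ‖H (s - t)‖ₑ ^ p.toReal ∂unitVol ∂unitVol := by
        rw [lintegral_const_mul'' _ (AEMeasurable.lintegral_prod_right' hm2),
          lintegral_lintegral_swap hm2]
    _ ≤ W ^ (p.toReal - 1) * ∫⁻ s, ‖ψ s‖ₑ * ∫⁻ u, ‖H u‖ₑ ^ p.toReal ∂volume ∂unitVol := by
        refine mul_le_mul' le_rfl (lintegral_mono fun s => ?_)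
        rw [lintegral_const_mul' _ _ (by simp)]
        refine mul_le_mul' le_rfl ((setLIntegral_le_lintegral _ _).trans_eq ?_)
        exact lintegral_sub_left_eq_self (fun u => ‖H u‖ₑ ^ p.toReal) s
    _ = W ^ p.toReal * ∫⁻ u, ‖H u‖ₑ ^ p.toReal ∂volume := by
        rw [lintegral_mul_const'' _ hψ.enorm, ← mul_assoc]
        congr 1
        calc W ^ (p.toReal - 1) * W = W ^ (p.toReal - 1) * W ^ (1 : ℝ) := by rw [ENNReal.rpow_one]
          _ = _ := by
            rw [← ENNReal.rpow_add_of_nonneg _ _ (by linarith) zero_le_one, sub_add_cancel]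

/-- The kernel formed by the rows of the Krein equation satisfies the bounds of the Schur test. -/
theorem exists_isSchurKernel_rows [FiniteDimensional ℂ A] [CompleteSpace A]
    (hh : Integrable H symVol) (hu : ∀ a, IsUnit (1 + trunc a ∘L rowOp hh)) {Φ : ℝ → ℝ → A}
    (hΦ : StronglyMeasurable fun z : ℝ × ℝ => Φ z.1 z.2)
    (hint : ∀ x, Integrable (Φ x) unitVol) {C : ℝ≥0∞} (hC : C ≠ ∞)
    (hbound : ∀ x ∈ Icc (0 : ℝ) 1, ∫⁻ s, ‖Φ x s‖ₑ ∂unitVol ≤ C)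
    (heq : ∀ x, RowEquation H x (Φ x)) :
    ∃ C' : ℝ≥0∞, C' ≠ ∞ ∧
      IsSchurKernel unitVol (fun x s => ContinuousLinearMap.mul ℂ A (Φ x s)) C' := by
  obtain ⟨M, δ, hM, hδ, hbd⟩ := exists_row_bound hh hu
  obtain ⟨g, N, hN, hgN, hg, hsmall⟩ := exists_bounded_lintegral_sub_le hh (ε := 2⁻¹) (by simp)
  have hle : ∀ᵐ x ∂unitVol, ∫⁻ s, ‖Φ x s‖ₑ ∂unitVol ≤ C := by
    filter_upwards [ae_unitVol_mem] with x hx using hbound x (Ioo_subset_Icc_self hx)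
  have hR : IsRowSolution 1 H Φ :=
    { aestronglyMeasurable := hΦ.aestronglyMeasurable
      integrable := Eventually.of_forall hint
      finite := by
        simp only [ENNReal.rpow_one]
        refine ne_top_of_le_ne_top (b := ∫⁻ _, C ∂unitVol) ?_ (lintegral_mono_ae hle)
        simp [hC]
      equation := Eventually.of_forall heq }
  -- The columns of Φ are not visible from its construction by rows; their bound comes from the a
  -- priori estimate.
  have hcol := hR.column_le hh hg hM.le (hbd H hh (by simp)) hgN hsmall
  set B := columnConst 1 (ENNReal.ofReal M) N 0 0 * ∫⁻ u, ‖H u‖ₑ ∂symVol with hB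
  have hBtop : B ≠ ∞ := ENNReal.mul_ne_top (columnConst_ne_top le_rfl ENNReal.ofReal_ne_top hN
    ENNReal.zero_ne_top ENNReal.zero_ne_top) hh.2.ne
  have hnorm : ∀ a : A, ‖ContinuousLinearMap.mul ℂ A a‖ₑ ≤ ‖a‖ₑ := fun a => by
    rw [← ofReal_norm, ← ofReal_norm]
    exact ENNReal.ofReal_le_ofReal (ContinuousLinearMap.opNorm_mul_apply_le ℂ A a)
  refine ⟨max C B, by simp [hC, hBtop], ?_, ?_, ?_⟩
  · exact ((ContinuousLinearMap.mul ℂ A).continuous.comp_stronglyMeasurable hΦ).aestronglyMeasurable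
  · filter_upwards [hle] with x hx
    exact (lintegral_mono fun s => hnorm _).trans (hx.trans (le_max_left _ _))
  · filter_upwards [hcol] with s hs
    exact (lintegral_mono fun x => hnorm _).trans (hs.trans (le_max_right _ _))

end Existence

/-! ### The candidate kernel and its slices -/

section Kernel

variable {A : Type*} [NormedRing A] [NormedAlgebra ℂ A] {H : ℝ → A} {p : ℝ≥0∞}
  {Φ : ℝ → ℝ → A}

/-- The negative of the solution of the Krein equation, before it is cut off at the diagonal. -/
def fullKernel (H : ℝ → A) (Φ : ℝ → ℝ → A) (x t : ℝ) : A :=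
  H (x - t) + ∫ s, Φ x s * H (s - t) ∂unitVol

theorem stronglyMeasurable_fullKernel (hH : StronglyMeasurable H)
    (hΦ : StronglyMeasurable fun z : ℝ × ℝ => Φ z.1 z.2) :
    StronglyMeasurable fun z : ℝ × ℝ => fullKernel H Φ z.1 z.2 := by
  have h1 : StronglyMeasurable fun w : (ℝ × ℝ) × ℝ => Φ w.1.1 w.2 * H (w.2 - w.1.2) :=
    (hΦ.comp_measurable (g := fun w : (ℝ × ℝ) × ℝ => (w.1.1, w.2)) (by fun_prop)).mul
      (hH.comp_measurable (by fun_prop))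
  exact (hH.comp_measurable (g := fun z : ℝ × ℝ => z.1 - z.2) (by fun_prop)).add
    h1.integral_prod_right'

theorem memLp_fullKernel_left (hp1 : 1 ≤ p) (hp : p ≠ ∞) (hHm : StronglyMeasurable H)
    (hH : MemLp H p volume) (hΦ : StronglyMeasurable fun z : ℝ × ℝ => Φ z.1 z.2)
    (hint : ∀ x, Integrable (Φ x) unitVol) (x : ℝ) : MemLp (fullKernel H Φ x) p unitVol := by
  have hG : StronglyMeasurable (fullKernel H Φ x) :=
    (stronglyMeasurable_fullKernel hHm hΦ).comp_measurable measurable_prodMk_left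
  have h1 := memLp_comp_sub_left hH x
  refine h1.add ⟨?_, lt_of_le_of_lt (eLpNorm_integral_mul_sub_le hp1 hp (hint x).1 hHm)
    (ENNReal.mul_lt_top (hint x).2 hH.2)⟩
  refine (hG.aestronglyMeasurable.sub h1.1).congr (Eventually.of_forall fun t => ?_)
  simp [fullKernel]

/-- Integration against H(s − t) maps L_1 to L_p by Young's inequality, so L_1 continuity of the
rows Φ is upgraded to L_p continuity. -/
theorem tendsto_fullKernel_left (hp1 : 1 ≤ p) (hp : p ≠ ∞) (hHm : StronglyMeasurable H)
    (hh : Integrable H symVol) (hH : MemLp H p volume)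
    (hΦ : StronglyMeasurable fun z : ℝ × ℝ => Φ z.1 z.2)
    (hint : ∀ x, Integrable (Φ x) unitVol) {x₀ : ℝ}
    (hc : Tendsto (fun x => ∫⁻ s, ‖Φ x s - Φ x₀ s‖ₑ ∂unitVol) (𝓝 x₀) (𝓝 0)) :
    Tendsto (fun x => eLpNorm (fun t => fullKernel H Φ x t - fullKernel H Φ x₀ t) p unitVol)
      (𝓝 x₀) (𝓝 0) := by
  have hsum := (tendsto_eLpNorm_comp_sub_left hp1 hp hH x₀).add
    (ENNReal.Tendsto.mul_const hc (Or.inr hH.2.ne))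
  rw [zero_mul, add_zero] at hsum
  refine tendsto_of_tendsto_of_tendsto_of_le_of_le tendsto_const_nhds hsum
    (fun _ => zero_le) fun x => ?_
  have e : (fun t => fullKernel H Φ x t - fullKernel H Φ x₀ t) =ᵐ[unitVol]
      (fun t => H (x - t) - H (x₀ - t)) + fun t => ∫ s, (Φ x s - Φ x₀ s) * H (s - t) ∂unitVol := by
    filter_upwards [ae_integrable_mul_sub (hint x) hh, ae_integrable_mul_sub (hint x₀) hh]
      with t h1 h2
    simp only [Pi.add_apply, fullKernel, sub_mul]
    rw [integral_sub h1 h2]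
    abel
  have hm : StronglyMeasurable fun t => ∫ s, (Φ x s - Φ x₀ s) * H (s - t) ∂unitVol := by
    have hΦx : ∀ y, StronglyMeasurable (Φ y) := fun y => hΦ.comp_measurable measurable_prodMk_left
    have h1 : StronglyMeasurable fun w : ℝ × ℝ => (Φ x w.2 - Φ x₀ w.2) * H (w.2 - w.1) :=
      (((hΦx x).sub (hΦx x₀)).comp_measurable measurable_snd).mul
        (hHm.comp_measurable (by fun_prop))
    exact h1.integral_prod_right'
  rw [eLpNorm_congr_ae e]
  refine (eLpNorm_add_le ((memLp_comp_sub_left hH x).1.sub (memLp_comp_sub_left hH x₀).1)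
    hm.aestronglyMeasurable hp1).trans (add_le_add le_rfl ?_)
  exact eLpNorm_integral_mul_sub_le hp1 hp ((hint x).1.sub (hint x₀).1) hHm

variable {C : ℝ≥0∞}

/-- A column is H(· − t) plus its image under the integral operator with kernel Φ, which the Schur
test bounds on L_p. This holds for every t, including t = 0. -/
theorem memLp_fullKernel_right (hp1 : 1 ≤ p) (hp : p ≠ ∞) (hH : MemLp H p volume) (hC : C ≠ ∞)
    (hK : IsSchurKernel unitVol (fun x s => ContinuousLinearMap.mul ℂ A (Φ x s)) C) (t : ℝ) :
    MemLp (fun x => fullKernel H Φ x t) p unitVol :=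
  (memLp_comp_sub_right hH t).add (hK.memLp_integral hC hp1 hp (memLp_comp_sub_right hH t))

theorem tendsto_fullKernel_right (hp1 : 1 ≤ p) (hp : p ≠ ∞) (hH : MemLp H p volume) (hC : C ≠ ∞)
    (hK : IsSchurKernel unitVol (fun x s => ContinuousLinearMap.mul ℂ A (Φ x s)) C) (t₀ : ℝ) :
    Tendsto (fun t => eLpNorm (fun x => fullKernel H Φ x t - fullKernel H Φ x t₀) p unitVol)
      (𝓝 t₀) (𝓝 0) := by
  have hT := tendsto_eLpNorm_comp_sub_right hp1 hp hH t₀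
  have hsum := hT.add (ENNReal.Tendsto.const_mul hT (Or.inr hC))
  rw [mul_zero, add_zero] at hsum
  refine tendsto_of_tendsto_of_tendsto_of_le_of_le tendsto_const_nhds hsum
    (fun _ => zero_le) fun t => ?_
  have hd := (memLp_comp_sub_right hH t).sub (memLp_comp_sub_right hH t₀)
  have e : (fun x => fullKernel H Φ x t - fullKernel H Φ x t₀) =ᵐ[unitVol]
      (fun x => H (x - t) - H (x - t₀)) + fun x => ∫ s, ContinuousLinearMap.mul ℂ A (Φ x s)
        (((fun s => H (s - t)) - fun s => H (s - t₀)) s) ∂unitVol := by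
    filter_upwards [hK.ae_integrable hC hp1 hp (memLp_comp_sub_right hH t),
      hK.ae_integrable hC hp1 hp (memLp_comp_sub_right hH t₀)] with x h1 h2
    simp only [ContinuousLinearMap.mul_apply'] at h1 h2
    simp only [Pi.add_apply, Pi.sub_apply, fullKernel, ContinuousLinearMap.mul_apply', mul_sub]
    rw [integral_sub h1 h2]
    abel
  rw [eLpNorm_congr_ae e]
  refine (eLpNorm_add_le hd.1 (hK.memLp_integral hC hp1 hp hd).1 hp1).trans
    (add_le_add le_rfl ?_)
  exact hK.eLpNorm_integral_le hd.1 hp1 hp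

/-- The solution of the Krein equation whose rows agree with those of `Φ`. -/
def cutKernel (H : ℝ → A) (Φ : ℝ → ℝ → A) (x t : ℝ) : A :=
  -(Iio x).indicator (fullKernel H Φ x) t

theorem cutKernel_eq_neg_indicator_Ioi (x t : ℝ) :
    cutKernel H Φ x t = -(Ioi t).indicator (fun x => fullKernel H Φ x t) x := rfl

theorem cutKernel_equation {x t : ℝ} (hx : x ≤ 1) (ht : t < x)
    (hrow : cutKernel H Φ x =ᵐ[unitVol] Φ x) :
    cutKernel H Φ x t + H (x - t) + ∫ s in Ioo (0 : ℝ) x, cutKernel H Φ x s * H (s - t) = 0 := by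
  rw [setIntegral_eq_of_ae_eq_zero hx (Eventually.of_forall fun s hs => by
    rw [cutKernel, indicator_of_notMem (show s ∉ Iio x from hs.not_gt), neg_zero, zero_mul])]
  have : ∫ s, cutKernel H Φ x s * H (s - t) ∂unitVol = ∫ s, Φ x s * H (s - t) ∂unitVol := by
    refine integral_congr_ae ?_
    filter_upwards [hrow] with s hs
    rw [hs]
  rw [this, cutKernel, indicator_of_mem (show t ∈ Iio x from ht), fullKernel]
  abel

omit [NormedAlgebra ℂ A] in
theorem neg_sub_neg_eq_neg_sub (f g : ℝ → A) :
    (fun t => -f t - -g t) = -fun t => f t - g t := by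
  ext t
  simp only [Pi.neg_apply]
  abel

end Kernel

/-! ### Solvability of the Krein equation and independence of representatives -/

section Solution

variable {r : ℕ} {p : ℝ≥0∞} {H : ℝ → Mat (Fin r)}

/-- Solvability of the Krein equation. -/
theorem IsAccelerant.exists_isKreinSolution_of_stronglyMeasurable (hp1 : 1 ≤ p) (hp : p ≠ ∞)
    (hacc : IsAccelerant H) (hHm : StronglyMeasurable H) (hH1 : MemLp H 1 volume)
    (hH : MemLp H p volume) : ∃ R, IsKreinSolution p H R := by
  have hh := hacc.integrable
  obtain ⟨φ, hφc, hφ⟩ := exists_continuous_rowEquation hH1 hh hacc.isUnit_row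
  obtain ⟨Φ, hΦ, hΦφ⟩ := exists_stronglyMeasurable_representative hφc
  have hint : ∀ x, Integrable (Φ x) unitVol := fun x =>
    (memLp_one_iff_integrable.1 (Lp.memLp (φ x))).congr (hΦφ x).symm
  -- By the row equation the cut kernel changes each row of Φ only on a null set. Unlike Φ, it has
  -- every column under control.
  have hrow : ∀ x, cutKernel H Φ x =ᵐ[unitVol] Φ x := fun x => by
    filter_upwards [hφ x, hΦφ x] with t h1 h2
    rw [h2, h1, cutKernel]
    have e : ∀ t, ∫ s, Φ x s * H (s - t) ∂unitVol = ∫ s, φ x s * H (s - t) ∂unitVol := fun t => by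
      refine integral_congr_ae ?_
      filter_upwards [hΦφ x] with s hs
      rw [hs]
    by_cases ht : t ∈ Iio x
    · rw [indicator_of_mem ht, indicator_of_mem ht, fullKernel, e]
    · rw [indicator_of_notMem ht, indicator_of_notMem ht]
  have heq : ∀ x, RowEquation H x (Φ x) := fun x => by
    filter_upwards [hrow x] with t ht
    rw [← ht]
    rfl
  have hlint : ∀ x x₀, ∫⁻ s, ‖Φ x s - Φ x₀ s‖ₑ ∂unitVol = edist (φ x) (φ x₀) := fun x x₀ => by
    rw [Lp.edist_def, eLpNorm_one_eq_lintegral_enorm]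
    refine lintegral_congr_ae ?_
    filter_upwards [hΦφ x, hΦφ x₀] with s h1 h2
    rw [h1, h2, Pi.sub_apply]
  have hc : ∀ x₀, Tendsto (fun x => ∫⁻ s, ‖Φ x s - Φ x₀ s‖ₑ ∂unitVol) (𝓝 x₀) (𝓝 0) :=
    fun x₀ => by
      simp only [hlint]
      exact tendsto_iff_edist_tendsto_0.1 (hφc.tendsto x₀)
  obtain ⟨C, hCb⟩ := isCompact_Icc.exists_bound_of_continuousOn (hφc.continuousOn (s := Icc 0 1))
  obtain ⟨C', hC', hK⟩ := exists_isSchurKernel_rows hh hacc.isUnit_row hΦ hint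
    (C := ENNReal.ofReal C) ENNReal.ofReal_ne_top (fun x hx => by
      have : ∫⁻ s, ‖Φ x s‖ₑ ∂unitVol = ‖φ x‖ₑ := by
        rw [Lp.enorm_def, eLpNorm_one_eq_lintegral_enorm]
        refine lintegral_congr_ae ?_
        filter_upwards [hΦφ x] with s h1
        rw [h1]
      rw [this, ← ofReal_norm]
      exact ENNReal.ofReal_le_ofReal (hCb x hx)) heq
  have hG := stronglyMeasurable_fullKernel hHm hΦ
  have hGm : MemG p (cutKernel H Φ) :=
    { aestronglyMeasurable := by
        have hs : MeasurableSet {z : ℝ × ℝ | z.2 < z.1} := measurableSet_lt measurable_snd measurable_fst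
        exact (hG.indicator hs).neg.aestronglyMeasurable
      memLp_left := fun x _ =>
        ((memLp_fullKernel_left hp1 hp hHm hH hΦ hint x).indicator measurableSet_Iio).neg
      memLp_right := fun t _ =>
        ((memLp_fullKernel_right hp1 hp hH hC' hK t).indicator measurableSet_Ioi).neg
      continuous_left := fun x₀ _ => by
        have := tendsto_eLpNorm_indicator_sub_indicator hp1 hp (I := Iio)
          (fun x => (memLp_fullKernel_left hp1 hp hHm hH hΦ hint x).1)
          (memLp_fullKernel_left hp1 hp hHm hH hΦ hint x₀)
          (tendsto_fullKernel_left hp1 hp hHm hh hH hΦ hint (hc x₀))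
          (fun _ => measurableSet_Iio) (fun x hx => eventually_mem_Iio_iff hx)
        refine (this.mono_left nhdsWithin_le_nhds).congr fun x => ?_
        simp only [cutKernel]
        rw [neg_sub_neg_eq_neg_sub, eLpNorm_neg]
      continuous_right := fun t₀ _ => by
        have := tendsto_eLpNorm_indicator_sub_indicator hp1 hp (I := Ioi)
          (f := fun t x => fullKernel H Φ x t)
          (fun t => (memLp_fullKernel_right hp1 hp hH hC' hK t).1)
          (memLp_fullKernel_right hp1 hp hH hC' hK t₀)
          (tendsto_fullKernel_right hp1 hp hH hC' hK t₀)
          (fun _ => measurableSet_Ioi) (fun x hx => by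
            rcases hx.lt_or_gt with h | h
            · filter_upwards [eventually_gt_nhds h] with a ha
              simp [not_lt.2 h.le, not_lt.2 ha.le]
            · filter_upwards [eventually_lt_nhds h] with a ha
              simp [h, ha])
        refine (this.mono_left nhdsWithin_le_nhds).congr fun t => ?_
        simp only [cutKernel_eq_neg_indicator_Ioi]
        rw [neg_sub_neg_eq_neg_sub, eLpNorm_neg] }
  refine ⟨cutKernel H Φ, ⟨hGm, ?_⟩, ?_⟩
  · filter_upwards [ae_restrict_mem isOpen_omegaMinus.measurableSet] with z hz
    rw [cutKernel, indicator_of_notMem (show z.2 ∉ Iio z.1 from hz.2.1.not_gt), neg_zero]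
  · filter_upwards [ae_restrict_mem isOpen_omegaPlus.measurableSet] with z hz
    exact cutKernel_equation hz.2.2.le hz.2.1 (hrow z.1)

/-- For (x,t) in Ω₊ the arguments x − t and s − t stay in (−1,1), so the equation sees only the
class of h there. This permits a change to a convenient representative. -/
theorem IsKreinSolution.congr {h h' : ℝ → Mat (Fin r)} {R : ℝ → ℝ → Mat (Fin r)}
    (hR : IsKreinSolution p h R) (hh : h =ᵐ[symVol] h') : IsKreinSolution p h' R where
  memGPlus := hR.memGPlus
  equation := by
    have hsub : (volume : Measure (ℝ × ℝ)).restrict OmegaPlus ≤ unitVol.prod unitVol := by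
      rw [Measure.prod_restrict, ← Measure.volume_eq_prod]
      have : OmegaPlus ⊆ Ioo (0 : ℝ) 1 ×ˢ Ioo (0 : ℝ) 1 := fun z hz =>
        ⟨⟨hz.1.trans hz.2.1, hz.2.2⟩, ⟨hz.1, hz.2.1.trans hz.2.2⟩⟩
      exact Measure.restrict_mono this le_rfl
    have h1 : ∀ᵐ z ∂unitVol.prod unitVol, h (z.1 - z.2) = h' (z.1 - z.2) :=
      quasiMeasurePreserving_sub_unitVol.ae_eq_comp hh
    filter_upwards [hR.equation, ae_mono hsub h1, ae_restrict_mem isOpen_omegaPlus.measurableSet]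
      with z h2 h3 hz
    rw [← h2, h3]
    congr 1
    have hq : Measure.QuasiMeasurePreserving (fun s => s - z.2)
        (volume.restrict (Ioo (0 : ℝ) z.1)) symVol := by
      refine (measurePreserving_sub_right volume z.2).quasiMeasurePreserving.restrict
        fun s hs => ?_
      constructor <;> linarith [hs.1, hs.2, hz.1, hz.2.1, hz.2.2]
    refine integral_congr_ae ?_
    filter_upwards [hq.ae_eq_comp hh] with s hs
    simp only [Function.comp_apply] at hs
    rw [hs]

theorem IsAccelerant.congr {h h' : ℝ → Mat (Fin r)} (hacc : IsAccelerant h)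
    (hh : h =ᵐ[symVol] h') : IsAccelerant h' := by
  refine ⟨(memLp_congr_ae hh).1 hacc.1, fun α hα f hf => hacc.2 α hα f ?_⟩
  filter_upwards [hf, ae_unitVol_mem] with x hx hx1
  rw [← hx]
  congr 1
  have hq : Measure.QuasiMeasurePreserving (fun t => x - t)
      (volume.restrict (Ioo (0 : ℝ) α)) symVol := by
    refine (Measure.measurePreserving_sub_left volume x).quasiMeasurePreserving.restrict
      fun s hs => ?_
    constructor <;> linarith [hs.1, hs.2, hx1.1, hx1.2, hα.2]
  refine integral_congr_ae ?_
  filter_upwards [hq.ae_eq_comp hh] with s hs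
  simp only [Function.comp_apply] at hs
  rw [hs]

theorem IsAccelerant.exists_isKreinSolution (hp1 : 1 ≤ p) (hp : p ≠ ∞) {h : ℝ → Mat (Fin r)}
    (hacc : IsAccelerant h) (hh : MemLp h p symVol) : ∃ R, IsKreinSolution p h R := by
  -- A strongly measurable version extended by zero, so that its translates are L_p functions on the
  -- whole line.
  set H : ℝ → Mat (Fin r) := (Ioo (-1 : ℝ) 1).indicator (hh.1.mk h) with hH
  have hHm : StronglyMeasurable H := hh.1.stronglyMeasurable_mk.indicator measurableSet_Ioo
  have hhH : h =ᵐ[symVol] H := by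
    filter_upwards [hh.1.ae_eq_mk, ae_restrict_mem measurableSet_Ioo] with u h1 h2
    rw [h1, hH, indicator_of_mem h2]
  have hLp : ∀ q : ℝ≥0∞, MemLp h q symVol → MemLp H q volume := fun q hq =>
    (memLp_indicator_iff_restrict measurableSet_Ioo).2 ((memLp_congr_ae hh.1.ae_eq_mk).1 hq)
  obtain ⟨R, hR⟩ := (hacc.congr hhH).exists_isKreinSolution_of_stronglyMeasurable hp1 hp hHm
    (hLp 1 hacc.1) (hLp p hh)
  exact ⟨R, hR.congr hhH.symm⟩

theorem IsAccelerant.hasUniqueKreinSolution (hp1 : 1 ≤ p) (hp : p ≠ ∞) {h : ℝ → Mat (Fin r)}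
    (hacc : IsAccelerant h) (hh : MemLp h p symVol) : HasUniqueKreinSolution p h :=
  ⟨hacc.exists_isKreinSolution hp1 hp hh,
    fun _ _ h₁ h₂ => hacc.gEq_of_isKreinSolution hp1 hp h₁ h₂⟩

end Solution

/-! ### The Krein mapping -/

section KreinMap

variable {r : ℕ} {p : ℝ≥0∞}

theorem memLp_sharp {h : ℝ → Mat (Fin r)} (hh : MemLp h p symVol) : MemLp (sharp h) p symVol :=
  hh.comp_measurePreserving measurePreserving_neg_symVol

theorem eLpNorm_sharp_sub {h₁ h₂ : ℝ → Mat (Fin r)} (hh₁ : AEStronglyMeasurable h₁ symVol)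
    (hh₂ : AEStronglyMeasurable h₂ symVol) :
    eLpNorm (fun u => sharp h₁ u - sharp h₂ u) p symVol = eLpNorm (fun u => h₁ u - h₂ u) p symVol :=
  eLpNorm_comp_measurePreserving (p := p) (f := fun u : ℝ => -u) (g := fun u => h₁ u - h₂ u)
    (hh₁.sub hh₂) measurePreserving_neg_symVol

theorem isKreinSolution_kreinKernel {h : ℝ → Mat (Fin r)} (H : ∃ R, IsKreinSolution p h R) :
    IsKreinSolution p h (kreinKernel p h) := by
  rw [kreinKernel, dif_pos H]
  exact H.choose_spec

variable (r) in
/-- The embedding of the upper right block, multiplied by `i`. -/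
def upperBlock : Mat (Fin r) →L[ℂ] Mat (Fin r ⊕ Fin r) :=
  LinearMap.toContinuousLinearMap
    { toFun := fun A => Matrix.fromBlocks 0 (Complex.I • A) 0 0
      map_add' := fun A B => by simp [Matrix.fromBlocks_add]
      map_smul' := fun c A => by simp [Matrix.fromBlocks_smul, smul_comm c] }

variable (r) in
/-- The embedding of the lower left block, multiplied by `-i`. -/
def lowerBlock : Mat (Fin r) →L[ℂ] Mat (Fin r ⊕ Fin r) :=
  LinearMap.toContinuousLinearMap
    { toFun := fun A => Matrix.fromBlocks 0 0 (-(Complex.I • A)) 0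
      map_add' := fun A B => by simp [Matrix.fromBlocks_add, add_comm]
      map_smul' := fun c A => by simp [Matrix.fromBlocks_smul, smul_comm c] }

theorem kreinPotential_eq (h : ℝ → Mat (Fin r)) (x : ℝ) :
    kreinPotential p h x =
      upperBlock r (kreinKernel p h x 0) + lowerBlock r (kreinKernel p (sharp h) x 0) := by
  change _ = Matrix.fromBlocks 0 (Complex.I • kreinKernel p h x 0) 0 0 +
    Matrix.fromBlocks 0 0 (-(Complex.I • kreinKernel p (sharp h) x 0)) 0
  simp [kreinPotential, Matrix.fromBlocks_add]

theorem eLpNorm_clm_apply_le {E F : Type*} [NormedAddCommGroup E] [NormedSpace ℂ E]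
    [NormedAddCommGroup F] [NormedSpace ℂ F] (T : E →L[ℂ] F) (f : ℝ → E) {μ : Measure ℝ} :
    eLpNorm (fun x => T (f x)) p μ ≤ ‖T‖ₑ * eLpNorm f p μ := by
  refine (eLpNorm_le_nnreal_smul_eLpNorm_of_ae_le_mul (c := ‖T‖₊)
    (Eventually.of_forall fun x => T.le_opNNNorm (f x)) p).trans_eq ?_
  rfl

theorem eLpNorm_kreinPotential_sub_le (hp1 : 1 ≤ p) (h₁ h₂ : ℝ → Mat (Fin r)) :
    eLpNorm (fun x => kreinPotential p h₁ x - kreinPotential p h₂ x) p unitVol ≤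
      ‖upperBlock r‖ₑ * eLpNorm (fun x => kreinKernel p h₁ x 0 - kreinKernel p h₂ x 0) p unitVol +
      ‖lowerBlock r‖ₑ * eLpNorm (fun x => kreinKernel p (sharp h₁) x 0 -
        kreinKernel p (sharp h₂) x 0) p unitVol := by
  have e : (fun x => kreinPotential p h₁ x - kreinPotential p h₂ x) =
      (fun x => upperBlock r (kreinKernel p h₁ x 0 - kreinKernel p h₂ x 0)) +
      fun x => lowerBlock r (kreinKernel p (sharp h₁) x 0 - kreinKernel p (sharp h₂) x 0) := by
    ext1 x
    rw [Pi.add_apply, kreinPotential_eq, kreinPotential_eq, map_sub, map_sub]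
    abel
  have m : ∀ g : ℝ → Mat (Fin r), AEStronglyMeasurable (fun x => kreinKernel p g x 0) unitVol :=
    fun g => (memLp_kreinKernel p g).1
  rw [e]
  refine (eLpNorm_add_le
    ((upperBlock r).continuous.comp_aestronglyMeasurable ((m h₁).sub (m h₂)))
    ((lowerBlock r).continuous.comp_aestronglyMeasurable ((m (sharp h₁)).sub (m (sharp h₂))))
    hp1).trans ?_
  exact add_le_add (eLpNorm_clm_apply_le (upperBlock r) _) (eLpNorm_clm_apply_le (lowerBlock r) _)

/-- Closeness in `L_p(-1,1)` implies closeness in `L_1(-1,1)`. -/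
theorem exists_lintegral_le_of_dist_lt [Fact (1 ≤ p)] (h₀ : LpSym p r) {δ : ℝ} (hδ : 0 < δ) :
    ∃ ε > 0, ∀ h ∈ Metric.ball h₀ ε, ∫⁻ u, ‖h u - h₀ u‖ₑ ∂symVol ≤ ENNReal.ofReal δ := by
  -- Hölder's constant 2^(1−1/p) for the inclusion of L_p(−1,1) in L_1(−1,1).
  set c : ℝ≥0∞ := symVol univ ^ (1 / (1 : ℝ≥0∞).toReal - 1 / p.toReal) with hc
  have hc0 : symVol univ = 2 := by
    rw [Measure.restrict_apply MeasurableSet.univ, univ_inter, Real.volume_Ioo]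
    norm_num
  have hctop : c ≠ ∞ := by
    rw [hc, hc0]
    exact ENNReal.rpow_ne_top_of_ne_zero two_ne_zero ENNReal.ofNat_ne_top
  refine ⟨δ / (c.toReal + 1), by positivity, fun h hh => ?_⟩
  have h1 := eLpNorm_le_eLpNorm_mul_rpow_measure_univ (μ := symVol) (Fact.out : 1 ≤ p)
    (f := fun u => h u - h₀ u) ((Lp.aestronglyMeasurable h).sub (Lp.aestronglyMeasurable h₀))
  rw [eLpNorm_one_eq_lintegral_enorm, ← hc] at h1
  have h2 : eLpNorm (fun u => h u - h₀ u) p symVol = ENNReal.ofReal (dist h h₀) := by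
    rw [← edist_dist, Lp.edist_def]
    rfl
  refine h1.trans ?_
  rw [h2, ← ENNReal.ofReal_toReal hctop, ← ENNReal.ofReal_mul dist_nonneg]
  refine ENNReal.ofReal_le_ofReal ?_
  have h3 : dist h h₀ < δ / (c.toReal + 1) := hh
  rw [lt_div_iff₀ (by positivity)] at h3
  nlinarith [dist_nonneg (x := h) (y := h₀)]

/-- The trace estimate is used twice, near h₀ for the upper block and near h₀^♯ for the lower one.
Reflection is an isometry of L_p(−1,1), so a single ball around h₀ serves both; it is also taken
small enough in L_1 to consist of accelerants. -/
theorem locallyLipschitzMap_kreinMap [Fact (1 ≤ p)] (hp : p ≠ ∞) :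
    LocallyLipschitzMap (kreinMap p r) := by
  have hp1 : 1 ≤ p := Fact.out
  rintro ⟨h₀, hacc⟩
  change IsAccelerant (h₀ : ℝ → Mat (Fin r)) at hacc
  have hm₀ := Lp.aestronglyMeasurable h₀
  obtain ⟨δ₀, hδ₀, hopen⟩ := hacc.exists_forall_isAccelerant
  obtain ⟨δ₁, hδ₁, K₁, hK₁, hlip₁⟩ := hacc.exists_lipschitz_bound hp1 hp
  obtain ⟨δ₂, hδ₂, K₂, hK₂, hlip₂⟩ := hacc.sharp.exists_lipschitz_bound hp1 hp
  obtain ⟨ε, hε, hball⟩ := exists_lintegral_le_of_dist_lt h₀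
    (δ := min δ₀ (min δ₁ δ₂)) (by positivity)
  set K : ℝ≥0∞ := ‖upperBlock r‖ₑ * K₁ + ‖lowerBlock r‖ₑ * K₂ with hK
  have hKtop : K ≠ ∞ := ENNReal.add_ne_top.2
    ⟨ENNReal.mul_ne_top enorm_ne_top hK₁, ENNReal.mul_ne_top enorm_ne_top hK₂⟩
  refine ⟨Metric.ball h₀ ε, Metric.ball_mem_nhds _ hε, fun h hh => ?_, K.toReal + 1,
    by positivity, ?_⟩
  · exact hopen h ((Lp.memLp h).integrable hp1)
      ((hball h hh).trans (ENNReal.ofReal_le_ofReal (min_le_left _ _)))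
  rintro ⟨h₁, ha₁⟩ ⟨h₂, ha₂⟩ hb₁ hb₂
  change IsAccelerant (h₁ : ℝ → Mat (Fin r)) at ha₁
  change IsAccelerant (h₂ : ℝ → Mat (Fin r)) at ha₂
  have hm₁ := Lp.aestronglyMeasurable h₁
  have hm₂ := Lp.aestronglyMeasurable h₂
  have hs : ∀ h ∈ Metric.ball h₀ ε, ∫⁻ u, ‖sharp h u - sharp h₀ u‖ₑ ∂symVol ≤
      ENNReal.ofReal δ₂ := fun h hh => by
    rw [← eLpNorm_one_eq_lintegral_enorm,
      eLpNorm_sharp_sub (Lp.aestronglyMeasurable h) hm₀, eLpNorm_one_eq_lintegral_enorm]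
    exact (hball h hh).trans
      (ENNReal.ofReal_le_ofReal ((min_le_right _ _).trans (min_le_right _ _)))
  have hn : ∀ h ∈ Metric.ball h₀ ε, ∫⁻ u, ‖h u - h₀ u‖ₑ ∂symVol ≤
      ENNReal.ofReal δ₁ := fun h hh => (hball h hh).trans
      (ENNReal.ofReal_le_ofReal ((min_le_right _ _).trans (min_le_left _ _)))
  have b₁ := hlip₁ h₁ h₂ ha₁.integrable ha₂.integrable (hn h₁ hb₁) (hn h₂ hb₂) _ _
    (isKreinSolution_kreinKernel (ha₁.exists_isKreinSolution hp1 hp (Lp.memLp h₁)))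
    (isKreinSolution_kreinKernel (ha₂.exists_isKreinSolution hp1 hp (Lp.memLp h₂)))
  have b₂ := hlip₂ (sharp h₁) (sharp h₂) ha₁.sharp.integrable ha₂.sharp.integrable
    (hs h₁ hb₁) (hs h₂ hb₂) _ _
    (isKreinSolution_kreinKernel
      (ha₁.sharp.exists_isKreinSolution hp1 hp (memLp_sharp (Lp.memLp h₁))))
    (isKreinSolution_kreinKernel
      (ha₂.sharp.exists_isKreinSolution hp1 hp (memLp_sharp (Lp.memLp h₂))))
  rw [eLpNorm_sharp_sub hm₁ hm₂] at b₂
  have hd : eLpNorm (fun u => h₁ u - h₂ u) p symVol = edist h₁ h₂ := by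
    rw [Lp.edist_def]
    rfl
  rw [hd] at b₁ b₂
  have hmain : edist (kreinMap p r ⟨h₁, ha₁⟩) (kreinMap p r ⟨h₂, ha₂⟩) ≤ K * edist h₁ h₂ := by
    have h3 : edist (kreinMap p r ⟨h₁, ha₁⟩) (kreinMap p r ⟨h₂, ha₂⟩) =
        eLpNorm (fun x => kreinPotential p h₁ x - kreinPotential p h₂ x) p unitVol := by
      change edist ((memLp_kreinPotential p h₁).toLp _) ((memLp_kreinPotential p h₂).toLp _) = _
      rw [Lp.edist_toLp_toLp]
      rfl
    rw [h3, hK, add_mul, mul_assoc, mul_assoc]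
    exact (eLpNorm_kreinPotential_sub_le hp1 _ _).trans
      (add_le_add (mul_le_mul' le_rfl b₁) (mul_le_mul' le_rfl b₂))
  have h4 : dist (kreinMap p r ⟨h₁, ha₁⟩) (kreinMap p r ⟨h₂, ha₂⟩) ≤ K.toReal * dist h₁ h₂ := by
    rw [dist_edist, dist_edist, ← ENNReal.toReal_mul]
    exact ENNReal.toReal_mono (ENNReal.mul_ne_top hKtop (edist_ne_top _ _)) hmain
  refine h4.trans ?_
  change _ ≤ (K.toReal + 1) * dist h₁ h₂
  nlinarith [dist_nonneg (x := h₁) (y := h₂)]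

end KreinMap

end Krein

end

/-- For `p ∈ [1,∞)` the Krein mapping `Θ : 𝔥_{p,r} → 𝔔_p` is well defined (the Krein equations for
`h` and for `h^♯` are uniquely solvable in `G⁺_{p,r}`) and locally Lipschitz. -/
theorem lemma3p4 (r : ℕ) (p : ℝ≥0∞) [Fact (1 ≤ p)] (hp : p ≠ ∞) :
    (∀ h ∈ Krein.accelerants p r,
      Krein.HasUniqueKreinSolution p h ∧ Krein.HasUniqueKreinSolution p (Krein.sharp h)) ∧
    Krein.LocallyLipschitzMap (Krein.kreinMap p r) := by
  have hp1 : 1 ≤ p := Fact.out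
  refine ⟨fun h hh => ⟨?_, ?_⟩, Krein.locallyLipschitzMap_kreinMap hp⟩
  · exact Krein.IsAccelerant.hasUniqueKreinSolution hp1 hp hh (Lp.memLp h)
  · exact (Krein.IsAccelerant.sharp hh).hasUniqueKreinSolution hp1 hp
      (Krein.memLp_sharp (Lp.memLp h))
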